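/- \textbf{Setting.} Let $(\Omega,\mathcal F,\mathbb P)$ be a probability space, $\Theta=[a,1]$ with $0<a<1$, and $\mu$ a finite measure on $\Theta$ that is absolutely continuous with respect to Lebesgue measure. For $i=1,2$ let $\mathcal X_i\subset L^2(\mathbb P)$ be closed, convex and bounded with $0\in\mathcal X_i$, let $\varrho_i:L^2(\mathbb P)\to\mathbb R\cup\{+\infty\}$ be a monetary risk measure (that is, $X\le Y$ implies $\varrho_i(X)\ge\varrho_i(Y)$, and $\varrho_i(X+m)=\varrho_i(X)-m$ for $m\in\mathbb R$) which is convex, law invariant and has the Fatou property ($\varrho_i(X)\le\liminf_n\varrho_i(X_n)$ whenever $X_n\to X$ in norm), and let $W_i\in L^2(\mathbb P)$ with $\varrho_i(W_i)<\infty$. An agent of type $\theta\in\Theta$ has utility $U(\theta,Y)=\mathrm E[Y]-\theta\,\mathrm{Var}[Y]$. An \emph{admissible catalogue} of firm $i$ is a family $C_i=\{(X_i(\theta),p_i(\theta))\}_{\theta\in\Theta}$ with $X_i(\theta)\in\mathcal X_i$, $p_i(\theta)\in\mathbb R$ and $\theta\mapsto X_i(\theta)$ strongly measurable ($\mu$-a.e.)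 that is incentive compatible, $U(\theta,X_i(\theta))-p_i(\theta)\ge U(\theta,X_i(t))-p_i(t)$ for all $\theta,t\in\Theta$, and individually rational for the agents, $U(\theta,X_i(\theta))-p_i(\theta)\ge0$ for all $\theta\in\Theta$. Its indirect utility is $v_i(\theta)=\sup_{t\in\Theta}\{U(\theta,X_i(t))-p_i(t)\}$; it satisfies $v_i'(\theta)=-\mathrm{Var}[X_i(\theta)]$ for $\mu$-almost every $\theta$. Put $\Theta_1=\{v_1>v_2\}$, $\Theta_2=\{v_2>v_1\}$, $\Theta_0=\{v_1=v_2\}$. A \emph{tie-breaking rule} is a measurable $f:\Theta\to[0,1]$; write $f_1=f$, $f_2=1-f$. With $\bar X_i(\theta)=X_i(\theta)-\mathrm E[X_i(\theta)]$, the risk assessment of firm $i$ after trading is $A_i=R_i-I_i$, where $$R_i=\varrho_i\Big(W_i-\int_{\Theta_i}\bar X_i\,d\mu-\int_{\Theta_0}f_i\bar X_i\,d\mu\Big),\qquad I_i=\int_{\Theta_i}(\theta v_i'-v_i)\,d\mu+\int_{\Theta_0}(\theta v_i'-v_i)f_i\,d\mu,$$ and the aggregate risk is $A(C_1,C_2,f)=A_1(C_1,C_2,f)+A_2(C_1,C_2,f)$.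 Let $\Psi$ be the infimum of $A(C_1,C_2,f)$ over all pairs of admissible catalogues and all tie-breaking rules (no individual rationality constraint is imposed on the firms). A \emph{transfer socially efficient allocation} is a quadruple $(C_1,C_2,f,T)$ of admissible catalogues, a tie-breaking rule and a real number $T$ such that $$A(C_1,C_2,f)=\Psi,\qquad A_1(C_1,C_2,f)-T\le\varrho_1(W_1),\qquad A_2(C_1,C_2,f)+T\le\varrho_2(W_2).$$ \textbf{Statement.} There exists a transfer socially efficient allocation $(C_1^*,C_2^*,f^*,T^*)$. Moreover there are a real number $r\ge0$ (the rent of risk exchange) with $$A(C_1^*,C_2^*,f^*)=\varrho_1(W_1)+\varrho_2(W_2)-r$$ and real numbers $r_1,r_2$ with $r_2-r_1=r$ and $T^*\in[r_1,r_2]$ such that, for every $T\in\mathbb R$, $(C_1^*,C_2^*,f^*,T)$ is a transfer socially efficient allocation if and only if $T\in[r_1,r_2]$. -/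

import Mathlib

open MeasureTheory ProbabilityTheory Filter Topology
open scoped ENNReal

noncomputable section

namespace OTC

/-- The space of square integrable random variables. -/
abbrev L2 {Ω : Type*} [MeasurableSpace Ω] (P : Measure Ω) : Type _ := Lp ℝ (2 : ℝ≥0∞) P

section RiskMeasures

variable {Ω : Type*} [MeasurableSpace Ω] {P : Measure Ω} [IsProbabilityMeasure P]

/-- Monetary measures of risk `ρ : L² → ℝ ∪ {+∞}`. -/
structure IsMonetaryRiskMeasure (ρ : L2 P → EReal) : Prop where
  ne_bot : ∀ X, ρ X ≠ ⊥
  monotone : ∀ X Y : L2 P, X ≤ Y → ρ Y ≤ ρ X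
  cash_invariant : ∀ (X : L2 P) (m : ℝ), ρ (X + Lp.const 2 P m) = ρ X - (m : EReal)

/-- Convexity of a measure of risk. -/
def IsConvexRisk (ρ : L2 P → EReal) : Prop :=
  ∀ (X Y : L2 P) (t : ℝ), 0 ≤ t → t ≤ 1 →
    ρ (t • X + (1 - t) • Y) ≤ (t : EReal) * ρ X + ((1 - t : ℝ) : EReal) * ρ Y

/-- Law invariance: random variables with the same law carry the same risk. -/
def IsLawInvariant (ρ : L2 P → EReal) : Prop :=
  ∀ X Y : L2 P, P.map (X : Ω → ℝ) = P.map (Y : Ω → ℝ) → ρ X = ρ Y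

/-- The Fatou property along norm convergent sequences. -/
def HasFatouProperty (ρ : L2 P → EReal) : Prop :=
  ∀ (X : ℕ → L2 P) (Y : L2 P), Tendsto X atTop (𝓝 Y) → ρ Y ≤ liminf (fun n => ρ (X n)) atTop

end RiskMeasures

section Agents

variable {Ω : Type*} [MeasurableSpace Ω] {P : Measure Ω} [IsProbabilityMeasure P]

/-- Expectation of a random variable. -/
def mean (X : L2 P) : ℝ := ∫ ω, X ω ∂P

/-- Variance of a random variable. -/
def var (X : L2 P) : ℝ := variance (X : Ω → ℝ) P

/-- The centred random variable `X - E[X]`. -/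
def centered (X : L2 P) : L2 P := X - Lp.const 2 P (mean X)

/-- Mean-variance utility `U(θ, Y) = E[Y] - θ Var[Y]` of an agent of type `θ`. -/
def utility (θ : ℝ) (Y : L2 P) : ℝ := mean Y - θ * var Y

/-- A catalogue `{(X(θ), p(θ))}` of products and prices, indexed by the types
`θ ∈ [a, 1]`; the values at indices outside `[a, 1]` play no role. -/
structure Catalogue {Ω : Type*} [MeasurableSpace Ω] (P : Measure Ω) where
  product : ℝ → L2 P
  price : ℝ → ℝ

/-- Indirect utility `v(θ, C) = sup {U(θ, X) - p | (X, p) ∈ C}`. -/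
def indirectUtility (a : ℝ) (C : Catalogue P) (θ : ℝ) : ℝ :=
  ⨆ t : Set.Icc a 1, (utility θ (C.product t) - C.price t)

/-- Incentive compatible, individually rational catalogues with products in the financially
feasible set `𝒳`. The last field, the variance constraint `v' = -Var[X]`, is how incentive
compatibility enters the planner's problem; it follows from the other fields (envelope theorem),
and in particular determines the price as `p(θ) = E[X(θ)] + θ v'(θ) - v(θ)`. -/
structure IsAdmissible (a : ℝ) (μ : Measure ℝ) (𝒳 : Set (L2 P)) (C : Catalogue P) : Prop where
  product_mem : ∀ θ ∈ Set.Icc a 1, C.product θ ∈ 𝒳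
  measurable_product : AEStronglyMeasurable C.product μ
  incentive_compatible : ∀ θ ∈ Set.Icc a 1, ∀ t ∈ Set.Icc a 1,
    utility θ (C.product t) - C.price t ≤ utility θ (C.product θ) - C.price θ
  individually_rational : ∀ θ ∈ Set.Icc a 1, 0 ≤ utility θ (C.product θ) - C.price θ
  variance_eq : ∀ᵐ θ ∂μ, HasDerivAt (indirectUtility a C) (-var (C.product θ)) θ

/-- Tie-breaking rules: measurable functions with values in `[0, 1]` on the set of types. -/
def IsTieBreakingRule (a : ℝ) (f : ℝ → ℝ) : Prop :=
  Measurable f ∧ ∀ θ ∈ Set.Icc a 1, 0 ≤ f θ ∧ f θ ≤ 1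

/-- The proportions `f₁ = f` and `f₂ = 1 - f` of indifferent agents contracting with each firm. -/
def share (f : ℝ → ℝ) (i : Fin 2) (θ : ℝ) : ℝ := if i = 0 then f θ else 1 - f θ

/-- `Θ_i`: the types that strictly prefer firm `i`; here `i.rev` is the other firm. -/
def segment (a : ℝ) (C : Fin 2 → Catalogue P) (i : Fin 2) : Set ℝ :=
  {θ ∈ Set.Icc a 1 | indirectUtility a (C i.rev) θ < indirectUtility a (C i) θ}

/-- `Θ_0`: the indifferent types. -/
def tieSet (a : ℝ) (C : Fin 2 → Catalogue P) : Set ℝ :=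
  {θ ∈ Set.Icc a 1 | indirectUtility a (C 0) θ = indirectUtility a (C 1) θ}

end Agents

section Firms

variable {Ω : Type*} [MeasurableSpace Ω] {P : Measure Ω} [IsProbabilityMeasure P]

/-- `R_i`: risk of firm `i` after trading, with centred products (the means of the products are
part of the prices and cancel, by cash invariance). Types with `v₁ = v₂ = 0` take the outside
option; they contribute nothing, as `v_i' = 0` almost everywhere on that set. -/
def risk (a : ℝ) (μ : Measure ℝ) (ρ : Fin 2 → L2 P → EReal) (W : Fin 2 → L2 P)
    (C : Fin 2 → Catalogue P) (f : ℝ → ℝ) (i : Fin 2) : EReal :=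
  ρ i (W i - (∫ θ in segment a C i, centered ((C i).product θ) ∂μ)
    - ∫ θ in tieSet a C, share f i θ • centered ((C i).product θ) ∂μ)

/-- `I_i`: income of firm `i`, the integral of `θ v_i'(θ) - v_i(θ)` over its customers. -/
def income (a : ℝ) (μ : Measure ℝ) (C : Fin 2 → Catalogue P) (f : ℝ → ℝ) (i : Fin 2) : ℝ :=
  (∫ θ in segment a C i,
      (θ * deriv (indirectUtility a (C i)) θ - indirectUtility a (C i) θ) ∂μ)
    + ∫ θ in tieSet a C,
      (θ * deriv (indirectUtility a (C i)) θ - indirectUtility a (C i) θ) * share f i θ ∂μ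

/-- `A_i = R_i - I_i`: risk assessment of firm `i` after trading. -/
def assessment (a : ℝ) (μ : Measure ℝ) (ρ : Fin 2 → L2 P → EReal) (W : Fin 2 → L2 P)
    (C : Fin 2 → Catalogue P) (f : ℝ → ℝ) (i : Fin 2) : EReal :=
  risk a μ ρ W C f i - (income a μ C f i : EReal)

/-- `A = A₁ + A₂`: aggregate risk. -/
def aggregateRisk (a : ℝ) (μ : Measure ℝ) (ρ : Fin 2 → L2 P → EReal) (W : Fin 2 → L2 P)
    (C : Fin 2 → Catalogue P) (f : ℝ → ℝ) : EReal :=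
  assessment a μ ρ W C f 0 + assessment a μ ρ W C f 1

/-- `Ψ`: infimum of the aggregate risk, without individual rationality at the firms' level. -/
def plannerValue (a : ℝ) (μ : Measure ℝ) (𝒳 : Fin 2 → Set (L2 P))
    (ρ : Fin 2 → L2 P → EReal) (W : Fin 2 → L2 P) : EReal :=
  sInf {A : EReal | ∃ (C : Fin 2 → Catalogue P) (f : ℝ → ℝ),
    (∀ i, IsAdmissible a μ (𝒳 i) (C i)) ∧ IsTieBreakingRule a f ∧
      A = aggregateRisk a μ ρ W C f}

/-- `(C₁, C₂, f)` minimizes the aggregate risk and the cash transfer `T`, paid by the second firm to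
the first one, makes it individually rational for both firms. -/
structure IsTransferEfficient (a : ℝ) (μ : Measure ℝ) (𝒳 : Fin 2 → Set (L2 P))
    (ρ : Fin 2 → L2 P → EReal) (W : Fin 2 → L2 P)
    (C : Fin 2 → Catalogue P) (f : ℝ → ℝ) (T : ℝ) : Prop where
  admissible : ∀ i, IsAdmissible a μ (𝒳 i) (C i)
  tieBreaking : IsTieBreakingRule a f
  optimal : plannerValue a μ 𝒳 ρ W = aggregateRisk a μ ρ W C f
  rational_fst : assessment a μ ρ W C f 0 - (T : EReal) ≤ ρ 0 (W 0)
  rational_snd : assessment a μ ρ W C f 1 + (T : EReal) ≤ ρ 1 (W 1)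

end Firms

end OTC

end

set_option linter.unusedSectionVars false

noncomputable section

/-! Among the types that buy, only the larger indirect utility v = max(v₁, v₂) matters: it has
slopes -q, where q is the variance of the chosen product, q is decreasing, and a type brings the
income -(θ q + v). This suggests a relaxed problem (`IsPlan`): a decreasing q, a market share, and
feasible products with variance at most q, where v is replaced by its least possible value, the
integral of q from θ to 1. Every pair of catalogues yields a plan that does no worse
(`exists_plan_le_aggregateRisk`), so it suffices to minimize over plans and to implement a minimizer
by catalogues.

A minimizing sequence has a limit although nothing is compact in norm. Helly's theorem handles q.
The remaining data are recorded as (share, share • product): in these coordinates the constraints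
are convex, so convex combinations of tails, which converge strongly in a Hilbert space, remain
almost feasible. Convexity and the Fatou property of the risk measures do the rest
(`exists_optimal_plan`).

Two obstacles separate an optimal plan from catalogues. First, the inequality on the variances must
be an equality for the products sold. If it were slack, one could move high variance products
towards lower types by a monotone transport, average the low variance ones behind them, keep the
position of each firm, and lower q: a strict gain (`IsPlan.exists_improvement`,
`IsOptimalPlan.var_eq`). Second, each firm needs one feasible product whose variance dominates q
wherever it sells. Averaging the products sold on a set of types keeps a plan optimal, hence cannot
lower the variance much; the parallelogram law then makes products of nearly maximal variance
converge (`IsOptimalPlan.exists_var_ge`). With such products x i, firm i offers variances min(q, var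
(x i)). Its indirect utility equals the common one where it sells and is no larger elsewhere, so the
tie-breaking rule can reproduce the shares (`IsPlan.exists_catalogues`).

The plan without trade shows that the minimum is at most the sum of the initial risks. The
difference is the rent, and the two rationality constraints on a transfer cut out an interval of
that length. -/

namespace OTC

/-! ### Compactness: convex combinations of tails and Helly selection -/

/-- A bounded sequence in a Hilbert space has convergent convex combinations of its tails. -/
theorem exists_tendsto_mem_convexHull_tail {H : Type*} [NormedAddCommGroup H]
    [InnerProductSpace ℝ H] [CompleteSpace H] (z : ℕ → H) {R : ℝ} (hz : ∀ n, ‖z n‖ ≤ R) :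
    ∃ (y : ℕ → H) (y₀ : H), (∀ n, y n ∈ convexHull ℝ (z '' Set.Ici n)) ∧
      Tendsto y atTop (𝓝 y₀) := by
  set C : ℕ → Set H := fun n => convexHull ℝ (z '' Set.Ici n) with hC
  have hanti : ∀ {m n}, m ≤ n → C n ⊆ C m := fun h =>
    convexHull_mono (Set.image_mono (Set.Ici_subset_Ici.2 h))
  have hmem : ∀ n, z n ∈ C n := fun n => subset_convexHull _ _ ⟨n, Set.mem_Ici.2 le_rfl, rfl⟩
  have hne : ∀ n, (norm '' C n).Nonempty := fun n => ⟨_, _, hmem n, rfl⟩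
  have hbdd : ∀ n, BddBelow (norm '' C n) := fun n =>
    ⟨0, by rintro _ ⟨x, -, rfl⟩; exact norm_nonneg x⟩
  set d : ℕ → ℝ := fun n => sInf (norm '' C n) with hd
  have hd0 : ∀ n, 0 ≤ d n := fun n =>
    le_csInf (hne n) (by rintro _ ⟨x, -, rfl⟩; exact norm_nonneg x)
  have hle : ∀ n, ∀ x ∈ C n, d n ≤ ‖x‖ := fun n x hx => csInf_le (hbdd n) ⟨x, hx, rfl⟩
  have hmono : Monotone d := fun m n h =>
    csInf_le_csInf (hbdd m) (hne n) (Set.image_mono (hanti h))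
  have hdR : BddAbove (Set.range d) :=
    ⟨R, by rintro _ ⟨n, rfl⟩; exact (hle n _ (hmem n)).trans (hz n)⟩
  have hlim := tendsto_atTop_ciSup hmono hdR
  set D := ⨆ n, d n with hD
  have hdD : ∀ n, d n ≤ D := fun n => le_ciSup hdR n
  -- The infima d n of the norm over the tail hulls increase to a finite D. Near-minimizers form a
  -- Cauchy sequence: the midpoint of y n and y m lies in C n and has norm at least d n, so the
  -- parallelogram law bounds their distance.
  have hex : ∀ n : ℕ, ∃ x ∈ C n, ‖x‖ < d n + 1 / ((n : ℝ) + 1) := by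
    intro n
    obtain ⟨_, ⟨x, hx, rfl⟩, hlt⟩ := exists_lt_of_csInf_lt (hne n)
      (show sInf (norm '' C n) < d n + 1 / ((n : ℝ) + 1) from
        lt_add_of_pos_right _ (by positivity))
    exact ⟨x, hx, hlt⟩
  choose y hy hlt using hex
  have hcau : CauchySeq y := by
    refine cauchySeq_of_le_tendsto_0'
      (fun n : ℕ => √(4 * (D + 1 / ((n : ℝ) + 1)) ^ 2 - 4 * d n ^ 2)) ?_ ?_
    · intro n m hnm
      rw [dist_eq_norm]
      refine Real.le_sqrt_of_sq_le ?_
      have h1 := parallelogram_law_with_norm ℝ (y n) (y m)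
      have hmid : (1 / 2 : ℝ) • y n + (1 / 2 : ℝ) • y m ∈ C n :=
        convex_convexHull ℝ _ (hy n) (hanti hnm (hy m)) (by norm_num) (by norm_num) (by norm_num)
      have h2 := hle n _ hmid
      rw [← smul_add, norm_smul] at h2
      norm_num at h2
      have h3 : ‖y n‖ ≤ D + 1 / ((n : ℝ) + 1) := (hlt n).le.trans (by linarith [hdD n])
      have h4 : ‖y m‖ ≤ D + 1 / ((n : ℝ) + 1) := by
        refine (hlt m).le.trans (add_le_add (hdD m) ?_)
        exact one_div_le_one_div_of_le (by positivity) (by exact_mod_cast Nat.succ_le_succ hnm)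
      have h5 := hd0 n
      have h6 := norm_nonneg (y n)
      have h7 := norm_nonneg (y m)
      have h8 : ‖y n‖ ^ 2 ≤ (D + 1 / ((n : ℝ) + 1)) ^ 2 := pow_le_pow_left₀ h6 h3 2
      have h9 : ‖y m‖ ^ 2 ≤ (D + 1 / ((n : ℝ) + 1)) ^ 2 := pow_le_pow_left₀ h7 h4 2
      have h10 : (2 * d n) ^ 2 ≤ ‖y n + y m‖ ^ 2 := pow_le_pow_left₀ (by linarith) (by linarith) 2
      nlinarith
    · have h1 : Tendsto (fun n : ℕ => D + 1 / ((n : ℝ) + 1)) atTop (𝓝 (D + 0)) :=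
        tendsto_const_nhds.add tendsto_one_div_add_atTop_nhds_zero_nat
      have h2 := (((h1.pow 2).const_mul 4).sub ((hlim.pow 2).const_mul 4)).sqrt
      simpa using h2
  obtain ⟨y₀, h₀⟩ := cauchySeq_tendsto_of_complete hcau
  exact ⟨y, y₀, hy, h₀⟩

/-- Helly's selection theorem for uniformly bounded antitone functions. -/
theorem exists_subseq_tendsto_antitone (q : ℕ → ℝ → ℝ) {B : ℝ} (hq : ∀ n, Antitone (q n))
    (h0 : ∀ n x, 0 ≤ q n x) (hB : ∀ n x, q n x ≤ B) :
    ∃ (σ : ℕ → ℕ) (Q : ℝ → ℝ) (N : Set ℝ), StrictMono σ ∧ Antitone Q ∧ (∀ x, 0 ≤ Q x) ∧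
      (∀ x, Q x ≤ B) ∧ N.Countable ∧
      ∀ x ∉ N, Tendsto (fun n => q (σ n) x) atTop (𝓝 (Q x)) := by
  have hcomp : IsCompact (Set.univ.pi fun _ : ℚ => Set.Icc (0 : ℝ) B) :=
    isCompact_univ_pi fun _ => isCompact_Icc
  obtain ⟨ℓ, -, σ, hσ, hlim⟩ := hcomp.tendsto_subseq
    (x := fun n => fun r : ℚ => q n r) (fun n r _ => ⟨h0 n r, hB n r⟩)
  rw [tendsto_pi_nhds] at hlim
  have hba : ∀ x, IsBoundedUnder (· ≤ ·) atTop fun n => q (σ n) x := fun x =>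
    isBoundedUnder_of ⟨B, fun n => hB _ x⟩
  have hbb : ∀ x, IsBoundedUnder (· ≥ ·) atTop fun n => q (σ n) x := fun x =>
    isBoundedUnder_of ⟨0, fun n => h0 _ x⟩
  -- The limsup is defined and antitone everywhere and agrees with the limits on ℚ; only its
  -- countably many discontinuities have to be discarded.
  set Q : ℝ → ℝ := fun x => limsup (fun n => q (σ n) x) atTop with hQ
  have hQr : ∀ r : ℚ, Q r = ℓ r := fun r => (hlim r).limsup_eq
  have hanti : Antitone Q := fun x y hxy =>
    limsup_le_limsup (Eventually.of_forall fun n => hq _ hxy) (hbb y).isCoboundedUnder_le (hba x)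
  refine ⟨σ, Q, {x | ¬ ContinuousAt Q x}, hσ, hanti, fun x => ?_, fun x => ?_,
    hanti.countable_not_continuousAt, fun x hx => ?_⟩
  · exact le_limsup_of_le (hba x) fun b hb => by
      obtain ⟨n, hn⟩ := hb.exists
      exact (h0 _ x).trans hn
  · exact limsup_le_of_le (hbb x).isCoboundedUnder_le (Eventually.of_forall fun n => hB _ x)
  · have hx : ContinuousAt Q x := not_not.1 hx
    refine tendsto_of_le_liminf_of_limsup_le ?_ le_rfl (hba x) (hbb x)
    have hright : Tendsto Q (𝓝[>] x) (𝓝 (Q x)) := hx.tendsto.mono_left nhdsWithin_le_nhds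
    refine le_of_tendsto hright ?_
    filter_upwards [self_mem_nhdsWithin] with y hy
    obtain ⟨r, hr1, hr2⟩ := exists_rat_btwn (show x < y from hy)
    calc Q y ≤ Q r := hanti hr2.le
      _ = liminf (fun n => q (σ n) r) atTop := by rw [hQr]; exact (hlim r).liminf_eq.symm
      _ ≤ liminf (fun n => q (σ n) x) atTop :=
        liminf_le_liminf (Eventually.of_forall fun n => hq _ hr1.le) (hbb r)
          (hba x).isCoboundedUnder_ge

/-! ### Mean and variance as Hilbert space data -/

section Centering

variable {Ω : Type*} [MeasurableSpace Ω] {P : Measure Ω} [IsProbabilityMeasure P]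

theorem const_one_eq : Lp.const (2 : ℝ≥0∞) P (1 : ℝ) =
    indicatorConstLp 2 MeasurableSet.univ (measure_ne_top P _) (1 : ℝ) := by
  ext1
  filter_upwards [Lp.coeFn_const (p := 2) (μ := P) (c := (1 : ℝ)),
    indicatorConstLp_coeFn (p := 2) (hs := MeasurableSet.univ) (hμs := measure_ne_top P _)
      (c := (1 : ℝ))] with ω h1 h2
  rw [h1, h2]; simp

theorem mean_eq_inner (X : L2 P) : mean X = inner ℝ (Lp.const (2 : ℝ≥0∞) P (1 : ℝ)) X := by
  rw [const_one_eq, L2.inner_indicatorConstLp_one]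
  simp [mean]

theorem norm_const_one : ‖Lp.const (2 : ℝ≥0∞) P (1 : ℝ)‖ = 1 := by
  rw [Lp.norm_const] <;> simp

/-- The mean as a continuous linear functional. -/
def meanL : L2 P →L[ℝ] ℝ := innerSL ℝ (Lp.const (2 : ℝ≥0∞) P (1 : ℝ))

theorem meanL_apply (X : L2 P) : meanL X = mean X := by
  rw [mean_eq_inner]; rfl

/-- Centring as a continuous linear map. -/
def centerL : L2 P →L[ℝ] L2 P :=
  ContinuousLinearMap.id ℝ (L2 P) - (Lp.constL 2 P ℝ).comp meanL

theorem centerL_apply (X : L2 P) : centerL X = centered X := by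
  simp [centerL, centered, meanL_apply]

theorem centered_eq (X : L2 P) :
    centered X = X - mean X • Lp.const (2 : ℝ≥0∞) P (1 : ℝ) := by
  rw [centered]
  congr 1
  have := (Lp.constₗ 2 P ℝ : ℝ →ₗ[ℝ] L2 P).map_smul (mean X) 1
  simpa using this

theorem norm_centered_sq (X : L2 P) : ‖centered X‖ ^ 2 = ‖X‖ ^ 2 - mean X ^ 2 := by
  rw [centered_eq, norm_sub_sq_real, norm_smul, norm_const_one, inner_smul_right,
    real_inner_comm, ← mean_eq_inner, mul_one, Real.norm_eq_abs, sq_abs]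
  ring

theorem var_eq_norm_sq (X : L2 P) : var X = ‖centerL X‖ ^ 2 := by
  rw [centerL_apply, norm_centered_sq, var, variance_eq_sub (Lp.memLp X), mean,
    ← real_inner_self_eq_norm_sq, L2.inner_def]
  simp [pow_two]

theorem var_eq_sub (X : L2 P) : var X = ‖X‖ ^ 2 - mean X ^ 2 := by
  rw [var_eq_norm_sq, centerL_apply, norm_centered_sq]

theorem var_nonneg (X : L2 P) : 0 ≤ var X := by rw [var_eq_norm_sq]; positivity

theorem var_le_norm_sq (X : L2 P) : var X ≤ ‖X‖ ^ 2 := by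
  rw [var_eq_sub]; nlinarith [sq_nonneg (mean X)]

theorem norm_centerL_le (X : L2 P) : ‖centerL X‖ ≤ ‖X‖ := by
  have h := var_le_norm_sq X
  rw [var_eq_norm_sq] at h
  exact (sq_le_sq₀ (norm_nonneg _) (norm_nonneg _)).1 h

theorem var_zero : var (0 : L2 P) = 0 := by rw [var_eq_norm_sq]; simp

theorem var_smul (c : ℝ) (X : L2 P) : var (c • X) = c ^ 2 * var X := by
  rw [var_eq_norm_sq, var_eq_norm_sq, map_smul, norm_smul, mul_pow, Real.norm_eq_abs, sq_abs]

theorem continuous_var : Continuous (var : L2 P → ℝ) := by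
  have : (var : L2 P → ℝ) = fun X => ‖centerL X‖ ^ 2 := funext var_eq_norm_sq
  rw [this]; fun_prop

theorem var_le_iff {c : ℝ} (hc : 0 ≤ c) (X : L2 P) :
    var X ≤ c ↔ X ∈ centerL ⁻¹' Metric.closedBall (0 : L2 P) √c := by
  rw [var_eq_norm_sq, Set.mem_preimage, mem_closedBall_zero_iff, Real.le_sqrt (norm_nonneg _) hc]

/-- Variance is the squared norm of a linear image, so a nonempty sublevel set is the preimage of a
ball. -/
theorem convex_var_le (c : ℝ) : Convex ℝ {X : L2 P | var X ≤ c} := by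
  rcases lt_or_ge c 0 with h | h
  · have : {X : L2 P | var X ≤ c} = ∅ := by
      ext X; simpa using h.trans_le (var_nonneg X)
    rw [this]; exact convex_empty
  · have : {X : L2 P | var X ≤ c} = centerL ⁻¹' Metric.closedBall (0 : L2 P) √c := by
      ext X; exact var_le_iff h X
    rw [this]
    exact (convex_closedBall _ _).linear_preimage (centerL : L2 P →L[ℝ] L2 P).toLinearMap

theorem isClosed_var_le (c : ℝ) : IsClosed {X : L2 P | var X ≤ c} :=
  isClosed_le continuous_var continuous_const

end Centering

/-! ### The relaxed problem and its cost -/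

section Plans

variable {Ω : Type*} [MeasurableSpace Ω] {P : Measure Ω} [IsProbabilityMeasure P]

/-- Relaxed allocations: `q` bounds the variances, `share φ i` is the proportion of agents served
by firm `i`, and `X i` are the products of firm `i`. -/
structure IsPlan (μ : Measure ℝ) (𝒳 : Fin 2 → Set (L2 P)) (B : ℝ) (q φ : ℝ → ℝ)
    (X : Fin 2 → ℝ → L2 P) : Prop where
  antitone : Antitone q
  nonneg : ∀ θ, 0 ≤ q θ
  le_bound : ∀ θ, q θ ≤ B
  measurable : Measurable φ
  share_mem : ∀ θ, φ θ ∈ Set.Icc (0 : ℝ) 1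
  stronglyMeasurable : ∀ i, StronglyMeasurable (X i)
  mem : ∀ i, ∀ᵐ θ ∂μ, X i θ ∈ 𝒳 i
  var_le : ∀ i, ∀ᵐ θ ∂μ, var (X i θ) ≤ q θ

/-- The surplus `∫ q` of type `θ` when the variances are given by `q`. -/
def surplus (q : ℝ → ℝ) (θ : ℝ) : ℝ := ∫ s in θ..1, q s

/-- Minus the aggregate income. -/
def planCost (μ : Measure ℝ) (q : ℝ → ℝ) : ℝ := ∫ θ, (surplus q θ + θ * q θ) ∂μ

/-- The position of firm `i`. -/
def planPosition (μ : Measure ℝ) (W : Fin 2 → L2 P) (φ : ℝ → ℝ) (X : Fin 2 → ℝ → L2 P)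
    (i : Fin 2) : L2 P :=
  W i - centerL (∫ θ, share φ i θ • X i θ ∂μ)

/-- Aggregate risk net of income. -/
def planRisk (μ : Measure ℝ) (ρ : Fin 2 → L2 P → EReal) (W : Fin 2 → L2 P) (φ : ℝ → ℝ)
    (X : Fin 2 → ℝ → L2 P) : EReal :=
  ρ 0 (planPosition μ W φ X 0) + ρ 1 (planPosition μ W φ X 1)

theorem share_nonneg {φ : ℝ → ℝ} {θ : ℝ} (h : φ θ ∈ Set.Icc (0 : ℝ) 1) (i : Fin 2) :
    0 ≤ share φ i θ := by
  fin_cases i <;> simp [share, h.1, h.2]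

theorem share_le_one {φ : ℝ → ℝ} {θ : ℝ} (h : φ θ ∈ Set.Icc (0 : ℝ) 1) (i : Fin 2) :
    share φ i θ ≤ 1 := by
  fin_cases i <;> simp [share, h.1, h.2]

theorem measurable_share {φ : ℝ → ℝ} (h : Measurable φ) (i : Fin 2) :
    Measurable (share φ i) := by
  fin_cases i
  · exact h
  · exact measurable_const.sub h

variable {μ : Measure ℝ} [IsFiniteMeasure μ]

theorem intervalIntegrable_of_antitone {q : ℝ → ℝ} (hq : Antitone q) (x y : ℝ) :
    IntervalIntegrable q volume x y := (hq.antitoneOn _).intervalIntegrable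

theorem abs_surplus_le {q : ℝ → ℝ} {B θ : ℝ} (h0 : ∀ x, 0 ≤ q x) (hB : ∀ x, q x ≤ B) :
    |surplus q θ| ≤ B * |1 - θ| := by
  have := intervalIntegral.norm_integral_le_of_norm_le_const (a := θ) (b := 1) (f := q) (C := B)
    fun x _ => by rw [Real.norm_eq_abs, abs_of_nonneg (h0 x)]; exact hB x
  simpa [surplus] using this

theorem continuous_surplus {q : ℝ → ℝ} (hq : Antitone q) : Continuous (surplus q) := by
  have : surplus q = fun θ => -∫ s in (1 : ℝ)..θ, q s := by
    ext θ; exact intervalIntegral.integral_symm _ _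
  rw [this]
  exact (intervalIntegral.continuous_primitive (fun x y => intervalIntegrable_of_antitone hq x y)
    1).neg

theorem ae_mem_Icc {a : ℝ} (hμ : μ (Set.Icc a 1)ᶜ = 0) : ∀ᵐ θ ∂μ, θ ∈ Set.Icc a 1 := hμ

theorem abs_cost_integrand_le {a : ℝ} (ha : 0 < a) {q : ℝ → ℝ} {B θ : ℝ} (h0 : ∀ x, 0 ≤ q x)
    (hB : ∀ x, q x ≤ B) (hθ : θ ∈ Set.Icc a 1) : |surplus q θ + θ * q θ| ≤ 2 * B := by
  have hB0 : 0 ≤ B := (h0 0).trans (hB 0)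
  have h1 := abs_surplus_le (θ := θ) h0 hB
  have h2 : |1 - θ| ≤ 1 := by rw [abs_le]; constructor <;> linarith [hθ.1, hθ.2]
  have h3 : |θ * q θ| ≤ B := by
    rw [abs_of_nonneg (mul_nonneg (ha.le.trans hθ.1) (h0 θ))]
    nlinarith [h0 θ, hB θ, hθ.2, hθ.1]
  have := abs_add_le (surplus q θ) (θ * q θ)
  nlinarith

theorem integrable_cost {a : ℝ} (ha : 0 < a) (hμ : μ (Set.Icc a 1)ᶜ = 0) {q : ℝ → ℝ} {B : ℝ}
    (hq : Antitone q) (h0 : ∀ x, 0 ≤ q x) (hB : ∀ x, q x ≤ B) :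
    Integrable (fun θ => surplus q θ + θ * q θ) μ := by
  refine Integrable.of_bound (C := 2 * B) ?_ ?_
  · exact ((continuous_surplus hq).measurable.add
      (measurable_id.mul hq.measurable)).aestronglyMeasurable
  · filter_upwards [ae_mem_Icc hμ] with θ hθ
    exact abs_cost_integrand_le ha h0 hB hθ

theorem ae_notMem_countable (hac : μ ≪ volume) {N : Set ℝ} (hN : N.Countable) :
    ∀ᵐ θ ∂μ, θ ∉ N := by
  have : μ N = 0 := hac (hN.measure_zero volume)
  exact measure_eq_zero_iff_ae_notMem.1 this

/-- Dominated convergence is used twice, inside the surplus and for μ; a countable exceptional set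
is null for both Lebesgue measure and μ. -/
theorem tendsto_planCost {a : ℝ} (ha : 0 < a) (hμ : μ (Set.Icc a 1)ᶜ = 0) (hac : μ ≪ volume)
    {q : ℕ → ℝ → ℝ} {Q : ℝ → ℝ} {B : ℝ} (hq : ∀ n, Antitone (q n)) (h0 : ∀ n x, 0 ≤ q n x)
    (hB : ∀ n x, q n x ≤ B) {N : Set ℝ} (hN : N.Countable)
    (hlim : ∀ x ∉ N, Tendsto (fun n => q n x) atTop (𝓝 (Q x))) :
    Tendsto (fun n => planCost μ (q n)) atTop (𝓝 (planCost μ Q)) := by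
  refine tendsto_integral_of_dominated_convergence (fun _ => 2 * B) ?_ (integrable_const _) ?_ ?_
  · exact fun n => (integrable_cost ha hμ (hq n) (h0 n) (hB n)).aestronglyMeasurable
  · intro n
    filter_upwards [ae_mem_Icc hμ] with θ hθ
    exact abs_cost_integrand_le ha (h0 n) (hB n) hθ
  · filter_upwards [ae_notMem_countable hac hN] with θ hθ
    refine Tendsto.add ?_ ((hlim θ hθ).const_mul θ)
    refine intervalIntegral.tendsto_integral_filter_of_dominated_convergence (fun _ => B) ?_ ?_ ?_ ?_
    · exact Eventually.of_forall fun n => (hq n).measurable.aestronglyMeasurable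
    · refine Eventually.of_forall fun n => ae_of_all _ fun x _ => ?_
      rw [Real.norm_eq_abs, abs_of_nonneg (h0 n x)]; exact hB n x
    · exact intervalIntegrable_const
    · filter_upwards [measure_eq_zero_iff_ae_notMem.1 (hN.measure_zero volume)] with x hx _
      exact hlim x hx

/-- Bounded sequences in `L²(ℝ) × L²(L²(P))²` have almost everywhere convergent convex
combinations of their tails. -/
theorem exists_ae_tendsto_convexHull_tail
    (z : ℕ → Lp ℝ 2 μ × (Fin 2 → Lp (L2 P) 2 μ)) {R : ℝ}
    (h1 : ∀ n, ‖(z n).1‖ ≤ R) (h2 : ∀ n i, ‖(z n).2 i‖ ≤ R) :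
    ∃ (y : ℕ → Lp ℝ 2 μ × (Fin 2 → Lp (L2 P) 2 μ)) (y₀ : Lp ℝ 2 μ × (Fin 2 → Lp (L2 P) 2 μ)),
      (∀ n, y n ∈ convexHull ℝ (z '' Set.Ici n)) ∧
      (∀ᵐ θ ∂μ, Tendsto (fun n => (y n).1 θ) atTop (𝓝 (y₀.1 θ))) ∧
      ∀ i, ∀ᵐ θ ∂μ, Tendsto (fun n => (y n).2 i θ) atTop (𝓝 (y₀.2 i θ)) := by
  -- The product and the function space carry sup norms, so a Hilbert norm is put on the same data
  -- and forgotten again by the linear map Λ.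
  let H := WithLp 2 (Lp ℝ 2 μ × PiLp 2 fun _ : Fin 2 => Lp (L2 P) 2 μ)
  let Λ : H →ₗ[ℝ] Lp ℝ 2 μ × (Fin 2 → Lp (L2 P) 2 μ) :=
    { toFun := fun x => (x.fst, fun i => x.snd i)
      map_add' := fun _ _ => rfl
      map_smul' := fun _ _ => rfl }
  let w : ℕ → H := fun n => WithLp.toLp 2 ((z n).1, WithLp.toLp 2 (z n).2)
  have hΛw : ∀ n, Λ (w n) = z n := fun _ => rfl
  have hw : ∀ n, ‖w n‖ ≤ √(3 * R ^ 2) := by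
    intro n
    refine Real.le_sqrt_of_sq_le ?_
    rw [WithLp.prod_norm_sq_eq_of_L2, PiLp.norm_sq_eq_of_L2, Fin.sum_univ_two]
    have e1 : ‖(z n).1‖ ^ 2 ≤ R ^ 2 := pow_le_pow_left₀ (norm_nonneg _) (h1 n) 2
    have e2 : ∀ i, ‖(z n).2 i‖ ^ 2 ≤ R ^ 2 := fun i => pow_le_pow_left₀ (norm_nonneg _) (h2 n i) 2
    have := e2 0
    have := e2 1
    change ‖(z n).1‖ ^ 2 + (‖(z n).2 0‖ ^ 2 + ‖(z n).2 1‖ ^ 2) ≤ _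
    linarith
  obtain ⟨y, y₀, hy, hlim⟩ := exists_tendsto_mem_convexHull_tail w hw
  have hl0 : Tendsto (fun n => (y n).fst) atTop (𝓝 y₀.fst) :=
    ((WithLp.prod_continuous_ofLp 2 _ _).fst.tendsto y₀).comp hlim
  have hl1 : ∀ i, Tendsto (fun n => (y n).snd i) atTop (𝓝 (y₀.snd i)) := fun i =>
    ((((PiLp.continuous_ofLp 2 _).comp (WithLp.prod_continuous_ofLp 2 _ _).snd).tendsto
      y₀).comp hlim).apply_nhds i
  -- Norm convergence gives almost everywhere convergence only along subsequences: one extraction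
  -- for each of the three coordinates. Later indices still give hulls of tails.
  obtain ⟨σ, hσ, ha⟩ := (tendstoInMeasure_of_tendsto_Lp hl0).exists_seq_tendsto_ae
  obtain ⟨τ, hτ, hb⟩ := (tendstoInMeasure_of_tendsto_Lp
    ((hl1 0).comp hσ.tendsto_atTop)).exists_seq_tendsto_ae
  obtain ⟨υ, hυ, hc⟩ := (tendstoInMeasure_of_tendsto_Lp
    ((hl1 1).comp (hσ.comp hτ).tendsto_atTop)).exists_seq_tendsto_ae
  refine ⟨fun n => Λ (y (σ (τ (υ n)))), Λ y₀, fun n => ?_, ?_, ?_⟩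
  · have hn : n ≤ σ (τ (υ n)) := ((hσ.comp hτ).comp hυ).le_apply
    have hmem : Λ (y (σ (τ (υ n)))) ∈ Λ '' convexHull ℝ (w '' Set.Ici (σ (τ (υ n)))) :=
      ⟨_, hy _, rfl⟩
    rw [LinearMap.image_convexHull, Set.image_image] at hmem
    exact convexHull_mono (Set.image_mono (Set.Ici_subset_Ici.2 hn)) hmem
  · filter_upwards [ha] with θ h
    exact h.comp (hτ.comp hυ).tendsto_atTop
  · intro i
    fin_cases i
    · filter_upwards [hb] with θ h
      exact h.comp hυ.tendsto_atTop
    · exact hc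

end Plans

open scoped Pointwise

/-! ### Convex constraints and their closure -/

section Existence

variable {Ω : Type*} [MeasurableSpace Ω] {P : Measure Ω} [IsProbabilityMeasure P]
  {μ : Measure ℝ} [IsFiniteMeasure μ]

/-- A real upper bound forces both risks to be finite, which reduces convexity to arithmetic in ℝ.
-/
theorem convex_sum_risk_le {ρ : Fin 2 → L2 P → EReal} (hbot : ∀ i X, ρ i X ≠ ⊥)
    (hconv : ∀ i, IsConvexRisk (ρ i)) (s : ℝ) :
    Convex ℝ {Y : Fin 2 → L2 P | ρ 0 (Y 0) + ρ 1 (Y 1) ≤ s} := by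
  have key : ∀ Y : Fin 2 → L2 P, ρ 0 (Y 0) + ρ 1 (Y 1) ≤ s →
      ∃ r₀ r₁ : ℝ, ρ 0 (Y 0) = r₀ ∧ ρ 1 (Y 1) = r₁ ∧ r₀ + r₁ ≤ s := by
    intro Y hY
    have h0 : ρ 0 (Y 0) ≠ ⊤ := by
      intro h; rw [h, EReal.top_add_of_ne_bot (hbot _ _)] at hY
      exact absurd (top_le_iff.1 hY) (EReal.coe_ne_top s)
    have h1 : ρ 1 (Y 1) ≠ ⊤ := by
      intro h; rw [h, EReal.add_top_of_ne_bot (hbot _ _)] at hY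
      exact absurd (top_le_iff.1 hY) (EReal.coe_ne_top s)
    lift ρ 0 (Y 0) to ℝ using ⟨h0, hbot _ _⟩ with r₀ hr₀
    lift ρ 1 (Y 1) to ℝ using ⟨h1, hbot _ _⟩ with r₁ hr₁
    exact ⟨r₀, r₁, rfl, rfl, by exact_mod_cast hY⟩
  intro Y hY Z hZ t u ht hu htu
  obtain ⟨r₀, r₁, hr₀, hr₁, hr⟩ := key Y hY
  obtain ⟨s₀, s₁, hs₀, hs₁, hs⟩ := key Z hZ
  obtain rfl : u = 1 - t := by linarith
  have c0 := hconv 0 (Y 0) (Z 0) t ht (by linarith)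
  have c1 := hconv 1 (Y 1) (Z 1) t ht (by linarith)
  rw [hr₀, hs₀] at c0
  rw [hr₁, hs₁] at c1
  refine (add_le_add c0 c1).trans ?_
  have : t * r₀ + (1 - t) * s₀ + (t * r₁ + (1 - t) * s₁) ≤ s := by nlinarith
  exact_mod_cast this

theorem sum_risk_le_of_tendsto {ρ : Fin 2 → L2 P → EReal}
    (hfatou : ∀ i, HasFatouProperty (ρ i)) {Y : ℕ → Fin 2 → L2 P} {Y₀ : Fin 2 → L2 P}
    (hY : ∀ i, Tendsto (fun n => Y n i) atTop (𝓝 (Y₀ i))) {s : EReal}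
    (hs : ∀ᶠ n in atTop, ρ 0 (Y n 0) + ρ 1 (Y n 1) ≤ s) : ρ 0 (Y₀ 0) + ρ 1 (Y₀ 1) ≤ s := by
  refine (add_le_add (hfatou 0 _ _ (hY 0)) (hfatou 1 _ _ (hY 1))).trans
    (EReal.le_liminf_add.trans ?_)
  exact liminf_le_of_frequently_le' hs.frequently

/-- Feasible products with variance at most every bound of the tail of `q`. -/
def tailFeasible (𝒳 : Set (L2 P)) (q : ℕ → ℝ → ℝ) (n : ℕ) (θ : ℝ) : Set (L2 P) :=
  𝒳 ∩ ⋂ c ∈ {c : ℝ | ∀ k, n ≤ k → q k θ ≤ c}, {X | var X ≤ c}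

theorem convex_tailFeasible {𝒳 : Set (L2 P)} (h : Convex ℝ 𝒳) (q : ℕ → ℝ → ℝ) (n : ℕ) (θ : ℝ) :
    Convex ℝ (tailFeasible 𝒳 q n θ) :=
  h.inter (convex_iInter₂ fun c _ => convex_var_le c)

/-- The convex constraints satisfied by the tails of a sequence of plans. -/
def tailConstraints (μ : Measure ℝ) (𝒳 : Fin 2 → Set (L2 P)) (q : ℕ → ℝ → ℝ) (n : ℕ) :
    Set (Lp ℝ 2 μ × (Fin 2 → Lp (L2 P) 2 μ)) :=
  {z | (∀ᵐ θ ∂μ, z.1 θ ∈ Set.Icc (0 : ℝ) 1) ∧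
    ∀ i, ∀ᵐ θ ∂μ, z.2 i θ ∈ share z.1 i θ • tailFeasible (𝒳 i) q n θ}

/-- The relation g ∈ s • K is jointly convex in (s, g) for s ≥ 0, because (s + t) • K = s • K + t •
K for convex K. This is why shares and products are recorded multiplied together. -/
theorem convex_tailConstraints {𝒳 : Fin 2 → Set (L2 P)} (h𝒳 : ∀ i, Convex ℝ (𝒳 i))
    (q : ℕ → ℝ → ℝ) (n : ℕ) : Convex ℝ (tailConstraints μ 𝒳 q n) := by
  intro y hy z hz t u ht hu htu
  have hfst : ∀ᵐ θ ∂μ, (t • y + u • z).1 θ = t * y.1 θ + u * z.1 θ := by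
    filter_upwards [Lp.coeFn_add (t • y.1) (u • z.1), Lp.coeFn_smul t y.1,
      Lp.coeFn_smul u z.1] with θ h1 h2 h3
    simp only [Prod.fst_add, Prod.smul_fst]
    rw [h1, Pi.add_apply, h2, h3]
    rfl
  refine ⟨?_, fun i => ?_⟩
  · filter_upwards [hfst, hy.1, hz.1] with θ h h1 h2
    rw [h]
    exact convex_Icc (0 : ℝ) 1 h1 h2 ht hu htu
  · have hsnd : ∀ᵐ θ ∂μ, (t • y + u • z).2 i θ = t • y.2 i θ + u • z.2 i θ := by
      filter_upwards [Lp.coeFn_add (t • y.2 i) (u • z.2 i), Lp.coeFn_smul t (y.2 i),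
        Lp.coeFn_smul u (z.2 i)] with θ h1 h2 h3
      simp only [Prod.snd_add, Prod.smul_snd, Pi.add_apply, Pi.smul_apply]
      rw [h1, Pi.add_apply, h2, h3]; rfl
    filter_upwards [hfst, hsnd, hy.1, hz.1, hy.2 i, hz.2 i] with θ h h' h1 h2 h3 h4
    have hshare : share (t • y + u • z).1 i θ = t * share y.1 i θ + u * share z.1 i θ := by
      unfold share
      split_ifs
      · exact h
      · rw [h]; linear_combination (-1 : ℝ) * htu
    rw [h', hshare, (convex_tailFeasible (h𝒳 i) q n θ).add_smul
      (mul_nonneg ht (share_nonneg h1 i)) (mul_nonneg hu (share_nonneg h2 i)), mul_smul, mul_smul]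
    exact Set.add_mem_add (Set.smul_mem_smul_set h3) (Set.smul_mem_smul_set h4)

/-- Where the limiting share vanishes, boundedness of 𝒳 kills the limit of the products; elsewhere
one divides by the share. Since q converges at θ, any c above its limit eventually bounds the whole
tail. -/
theorem mem_of_tendsto_share_smul {𝒳 : Set (L2 P)} (hcl : IsClosed 𝒳) {R : ℝ}
    (hR : ∀ x ∈ 𝒳, ‖x‖ ≤ R) {q : ℕ → ℝ → ℝ} {Q θ : ℝ}
    (hq : Tendsto (fun n => q n θ) atTop (𝓝 Q)) {s : ℕ → ℝ} {s₀ : ℝ} {g : ℕ → L2 P} {g₀ : L2 P}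
    (hs : Tendsto s atTop (𝓝 s₀)) (hg : Tendsto g atTop (𝓝 g₀))
    (hmem : ∀ n, g n ∈ s n • tailFeasible 𝒳 q n θ) :
    (s₀ = 0 → g₀ = 0) ∧ (s₀ ≠ 0 → s₀⁻¹ • g₀ ∈ 𝒳 ∧ var (s₀⁻¹ • g₀) ≤ Q) := by
  choose x hx hxg using fun n => Set.mem_smul_set.1 (hmem n)
  refine ⟨fun h0 => ?_, fun h0 => ?_⟩
  · subst h0
    have h1 : Tendsto (fun n => |s n| * R) atTop (𝓝 0) := by
      simpa using hs.abs.mul_const R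
    refine tendsto_nhds_unique hg (squeeze_zero_norm (fun n => ?_) h1)
    rw [← hxg, norm_smul, Real.norm_eq_abs]
    exact mul_le_mul_of_nonneg_left (hR _ (hx n).1) (abs_nonneg _)
  · have hlim : Tendsto (fun n => (s n)⁻¹ • g n) atTop (𝓝 (s₀⁻¹ • g₀)) := (hs.inv₀ h0).smul hg
    have hxl : Tendsto x atTop (𝓝 (s₀⁻¹ • g₀)) := by
      refine hlim.congr' ?_
      filter_upwards [hs.eventually_ne h0] with n hn
      rw [← hxg, smul_smul, inv_mul_cancel₀ hn, one_smul]
    refine ⟨hcl.mem_of_tendsto hxl (Eventually.of_forall fun n => (hx n).1), ?_⟩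
    refine le_of_forall_gt_imp_ge_of_dense fun c hc => ?_
    obtain ⟨m, hm⟩ := eventually_atTop.1 (hq.eventually (gt_mem_nhds hc))
    refine le_of_tendsto ((continuous_var.tendsto _).comp hxl) ?_
    filter_upwards [eventually_ge_atTop m] with n hn
    exact Set.mem_iInter₂.1 (hx n).2 c fun k hk => (hm k (hn.trans hk)).le

end Existence

/-! ### Existence of an optimal plan -/

section Limit

variable {Ω : Type*} [MeasurableSpace Ω] {P : Measure Ω} [IsProbabilityMeasure P]
  {μ : Measure ℝ} [IsFiniteMeasure μ]

theorem IsPlan.memLp_share {𝒳 : Fin 2 → Set (L2 P)} {B : ℝ} {q φ : ℝ → ℝ} {X : Fin 2 → ℝ → L2 P}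
    (h : IsPlan μ 𝒳 B q φ X) : MemLp φ 2 μ :=
  MemLp.of_bound h.measurable.aestronglyMeasurable 1 (ae_of_all _ fun θ => by
    rw [Real.norm_eq_abs, abs_of_nonneg (h.share_mem θ).1]; exact (h.share_mem θ).2)

theorem IsPlan.aestronglyMeasurable_smul {𝒳 : Fin 2 → Set (L2 P)} {B : ℝ} {q φ : ℝ → ℝ}
    {X : Fin 2 → ℝ → L2 P} (h : IsPlan μ 𝒳 B q φ X) (i : Fin 2) :
    AEStronglyMeasurable (fun θ => share φ i θ • X i θ) μ :=
  (measurable_share h.measurable i).aestronglyMeasurable.smul (h.stronglyMeasurable i).aestronglyMeasurable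

theorem norm_smul_le_of_mem {x : L2 P} {s R : ℝ} (h0 : 0 ≤ s) (h1 : s ≤ 1) (hx : ‖x‖ ≤ R) :
    ‖s • x‖ ≤ R := by
  rw [norm_smul, Real.norm_eq_abs, abs_of_nonneg h0]
  nlinarith [norm_nonneg x]

theorem IsPlan.norm_smul_le {𝒳 : Fin 2 → Set (L2 P)} {B : ℝ} {q φ : ℝ → ℝ} {X : Fin 2 → ℝ → L2 P}
    (h : IsPlan μ 𝒳 B q φ X) {R : ℝ} (hR : ∀ i, ∀ x ∈ 𝒳 i, ‖x‖ ≤ R) (i : Fin 2) :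
    ∀ᵐ θ ∂μ, ‖share φ i θ • X i θ‖ ≤ R := by
  filter_upwards [h.mem i] with θ hθ
  exact norm_smul_le_of_mem (share_nonneg (h.share_mem θ) i) (share_le_one (h.share_mem θ) i)
    (hR i _ hθ)

theorem IsPlan.memLp_smul {𝒳 : Fin 2 → Set (L2 P)} {B : ℝ} {q φ : ℝ → ℝ} {X : Fin 2 → ℝ → L2 P}
    (h : IsPlan μ 𝒳 B q φ X) {R : ℝ} (hR : ∀ i, ∀ x ∈ 𝒳 i, ‖x‖ ≤ R) (i : Fin 2) :
    MemLp (fun θ => share φ i θ • X i θ) 2 μ :=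
  MemLp.of_bound (h.aestronglyMeasurable_smul i) R (h.norm_smul_le hR i)

/-- Convex combinations of tails satisfy the tail constraints and, by convexity, any eventual bound
on the risk; both survive the limit, the latter by the Fatou property. Real levels s avoid convex
combinations of infinite risks. -/
theorem exists_limit_plan {𝒳 : Fin 2 → Set (L2 P)} (hcl : ∀ i, IsClosed (𝒳 i))
    (hcv : ∀ i, Convex ℝ (𝒳 i)) (h0 : ∀ i, (0 : L2 P) ∈ 𝒳 i) {R : ℝ}
    (hR : ∀ i, ∀ x ∈ 𝒳 i, ‖x‖ ≤ R) (hac : μ ≪ volume)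
    {ρ : Fin 2 → L2 P → EReal} (hbot : ∀ i X, ρ i X ≠ ⊥) (hconv : ∀ i, IsConvexRisk (ρ i))
    (hfatou : ∀ i, HasFatouProperty (ρ i)) (W : Fin 2 → L2 P)
    {B : ℝ} {q φ : ℕ → ℝ → ℝ} {X : ℕ → Fin 2 → ℝ → L2 P}
    (hp : ∀ n, IsPlan μ 𝒳 B (q n) (φ n) (X n)) {Q : ℝ → ℝ} (hQ : Antitone Q)
    (hQ0 : ∀ x, 0 ≤ Q x) (hQB : ∀ x, Q x ≤ B) {N : Set ℝ} (hN : N.Countable)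
    (hlim : ∀ x ∉ N, Tendsto (fun n => q n x) atTop (𝓝 (Q x))) :
    ∃ (φ' : ℝ → ℝ) (X' : Fin 2 → ℝ → L2 P), IsPlan μ 𝒳 B Q φ' X' ∧
      ∀ s : ℝ, (∀ᶠ n in atTop, planRisk μ ρ W (φ n) (X n) ≤ s) → planRisk μ ρ W φ' X' ≤ s := by
  have hR0 : 0 ≤ R := (norm_nonneg _).trans (hR 0 0 (h0 0))
  set z : ℕ → Lp ℝ 2 μ × (Fin 2 → Lp (L2 P) 2 μ) := fun n =>
    ((hp n).memLp_share.toLp _, fun i => ((hp n).memLp_smul hR i).toLp _) with hz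
  have hz1 : ∀ n, ∀ᵐ θ ∂μ, (z n).1 θ = φ n θ := fun n => (hp n).memLp_share.coeFn_toLp
  have hz2 : ∀ n i, ∀ᵐ θ ∂μ, (z n).2 i θ = share (φ n) i θ • X n i θ := fun n i =>
    ((hp n).memLp_smul hR i).coeFn_toLp
  have hn1 : ∀ n, ‖(z n).1‖ ≤
      ((measureUnivNNReal μ : ℝ) ^ (2 : ℝ≥0∞).toReal⁻¹) * (1 + R) := by
    intro n
    refine Lp.norm_le_of_ae_bound (by linarith) ?_
    filter_upwards [hz1 n] with θ h
    rw [h, Real.norm_eq_abs, abs_of_nonneg ((hp n).share_mem θ).1]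
    linarith [((hp n).share_mem θ).2]
  have hn2 : ∀ n i, ‖(z n).2 i‖ ≤
      ((measureUnivNNReal μ : ℝ) ^ (2 : ℝ≥0∞).toReal⁻¹) * (1 + R) := by
    intro n i
    refine Lp.norm_le_of_ae_bound (by linarith) ?_
    filter_upwards [hz2 n i, (hp n).norm_smul_le hR i] with θ h h'
    rw [h]; linarith
  obtain ⟨y, y₀, hy, hlim1, hlim2⟩ := exists_ae_tendsto_convexHull_tail z hn1 hn2
  have hzmem : ∀ n k, n ≤ k → z k ∈ tailConstraints μ 𝒳 q n := by
    intro n k hnk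
    refine ⟨?_, fun i => ?_⟩
    · filter_upwards [hz1 k] with θ h
      rw [h]; exact (hp k).share_mem θ
    · filter_upwards [hz1 k, hz2 k i, (hp k).mem i, (hp k).var_le i] with θ h1 h2 h3 h4
      have : share (z k).1 i θ = share (φ k) i θ := by unfold share; rw [h1]
      rw [h2, this]
      exact Set.smul_mem_smul_set ⟨h3, Set.mem_iInter₂.2 fun c hc => h4.trans (hc k hnk)⟩
  have hymem : ∀ n, y n ∈ tailConstraints μ 𝒳 q n := fun n =>
    convexHull_min (by rintro _ ⟨k, hk, rfl⟩; exact hzmem n k hk)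
      (convex_tailConstraints hcv q n) (hy n)
  have hS : ∀ᵐ θ ∂μ, y₀.1 θ ∈ Set.Icc (0 : ℝ) 1 := by
    filter_upwards [hlim1, ae_all_iff.2 fun n => (hymem n).1] with θ h1 h2
    exact isClosed_Icc.mem_of_tendsto h1 (Eventually.of_forall h2)
  -- Truncation changes the limit only on a null set and puts the share in [0, 1] everywhere. Where
  -- a firm has share 0, the convention 0⁻¹ = 0 assigns it the feasible product 0.
  set φ' : ℝ → ℝ := fun θ => max 0 (min 1 (y₀.1 θ)) with hφ'
  set X' : Fin 2 → ℝ → L2 P := fun i θ => (share φ' i θ)⁻¹ • y₀.2 i θ with hX'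
  have hφmem : ∀ θ, φ' θ ∈ Set.Icc (0 : ℝ) 1 := fun θ =>
    ⟨le_max_left _ _, max_le zero_le_one (min_le_left _ _)⟩
  have hφeq : ∀ᵐ θ ∂μ, φ' θ = y₀.1 θ := by
    filter_upwards [hS] with θ h
    simp only [hφ']
    rw [min_eq_right h.2, max_eq_right h.1]
  have hφmeas : Measurable φ' :=
    measurable_const.max (measurable_const.min (Lp.stronglyMeasurable y₀.1).measurable)
  have hshare : ∀ i, ∀ᵐ θ ∂μ, Tendsto (fun n => share (y n).1 i θ) atTop (𝓝 (share φ' i θ)) := by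
    intro i
    filter_upwards [hlim1, hφeq] with θ h1 h2
    unfold share
    split_ifs
    · rw [h2]; exact h1
    · rw [h2]; exact h1.const_sub 1
  have hpt : ∀ i, ∀ᵐ θ ∂μ, (share φ' i θ = 0 → y₀.2 i θ = 0) ∧
      (share φ' i θ ≠ 0 → X' i θ ∈ 𝒳 i ∧ var (X' i θ) ≤ Q θ) := by
    intro i
    filter_upwards [hshare i, hlim2 i, ae_all_iff.2 fun n => (hymem n).2 i,
      ae_notMem_countable hac hN] with θ h1 h2 h3 h4
    exact mem_of_tendsto_share_smul (hcl i) (hR i) (hlim θ h4) h1 h2 h3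
  have hsmul : ∀ i, ∀ᵐ θ ∂μ, share φ' i θ • X' i θ = y₀.2 i θ := by
    intro i
    filter_upwards [hpt i] with θ h
    by_cases hz : share φ' i θ = 0
    · rw [hz, zero_smul, h.1 hz]
    · simp only [hX']
      rw [smul_smul, mul_inv_cancel₀ hz, one_smul]
  have hplan : IsPlan μ 𝒳 B Q φ' X' := by
    refine ⟨hQ, hQ0, hQB, hφmeas, hφmem, fun i => ?_, fun i => ?_, fun i => ?_⟩
    · exact (measurable_share hφmeas i).inv.stronglyMeasurable.smul
        (Lp.stronglyMeasurable (y₀.2 i))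
    · filter_upwards [hpt i] with θ h
      by_cases hz : share φ' i θ = 0
      · have : X' i θ = 0 := by simp only [hX']; rw [hz, inv_zero, zero_smul]
        rw [this]; exact h0 i
      · exact (h.2 hz).1
    · filter_upwards [hpt i] with θ h
      by_cases hz : share φ' i θ = 0
      · have : X' i θ = 0 := by simp only [hX']; rw [hz, inv_zero, zero_smul]
        rw [this, var_zero]; exact hQ0 θ
      · exact (h.2 hz).2
  refine ⟨φ', X', hplan, fun s hs => ?_⟩
  set pos : Lp ℝ 2 μ × (Fin 2 → Lp (L2 P) 2 μ) → Fin 2 → L2 P := fun w i =>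
    W i - centerL (∫ θ, w.2 i θ ∂μ) with hpos
  have hposz : ∀ n i, pos (z n) i = planPosition μ W (φ n) (X n) i := by
    intro n i
    simp only [hpos, planPosition]
    rw [integral_congr_ae (hz2 n i)]
  have hposy₀ : ∀ i, pos y₀ i = planPosition μ W φ' X' i := by
    intro i
    simp only [hpos, planPosition]
    rw [integral_congr_ae (hsmul i)]
  have hint : ∀ (w : Lp (L2 P) 2 μ), Integrable w μ := fun w =>
    (Lp.memLp w).integrable (by norm_num)
  have hposconv : ∀ s : ℝ, Convex ℝ {w | ρ 0 (pos w 0) + ρ 1 (pos w 1) ≤ s} := by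
    intro s v hv w hw t u ht hu htu
    have := convex_sum_risk_le hbot hconv s (x := pos v) hv (y := pos w) hw ht hu htu
    have e : pos (t • v + u • w) = t • pos v + u • pos w := by
      funext i
      have h1 : ∫ θ, (t • v + u • w).2 i θ ∂μ = t • ∫ θ, v.2 i θ ∂μ + u • ∫ θ, w.2 i θ ∂μ := by
        rw [← integral_smul, ← integral_smul, ← integral_add (f := fun θ => t • v.2 i θ)
          (g := fun θ => u • w.2 i θ) ((hint _).smul t) ((hint _).smul u)]
        refine integral_congr_ae ?_
        filter_upwards [Lp.coeFn_add (t • v.2 i) (u • w.2 i), Lp.coeFn_smul t (v.2 i),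
          Lp.coeFn_smul u (w.2 i)] with θ h1 h2 h3
        simp only [Prod.snd_add, Prod.smul_snd, Pi.add_apply, Pi.smul_apply]
        rw [h1, Pi.add_apply, h2, h3]
        rfl
      simp only [hpos, Pi.add_apply, Pi.smul_apply]
      rw [h1, map_add, map_smul, map_smul, smul_sub, smul_sub]
      have : W i = t • W i + u • W i := by rw [← add_smul, htu, one_smul]
      nth_rewrite 1 [this]
      abel
    rw [Set.mem_ofPred_eq, e]
    exact this
  obtain ⟨m, hm⟩ := eventually_atTop.1 hs
  have hyrisk : ∀ n, m ≤ n → ρ 0 (pos (y n) 0) + ρ 1 (pos (y n) 1) ≤ s := by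
    intro n hn
    refine convexHull_min ?_ (hposconv s) (hy n)
    rintro _ ⟨k, hk, rfl⟩
    rw [Set.mem_ofPred_eq, hposz, hposz]
    exact hm k (hn.trans hk)
  have hposlim : ∀ i, Tendsto (fun n => pos (y n) i) atTop (𝓝 (pos y₀ i)) := by
    intro i
    refine tendsto_const_nhds.sub ((centerL.continuous.tendsto _).comp ?_)
    refine tendsto_integral_of_dominated_convergence (fun _ => R)
      (fun n => Lp.aestronglyMeasurable _) (integrable_const _) (fun n => ?_) (hlim2 i)
    filter_upwards [(hymem n).1, (hymem n).2 i] with θ h1 h2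
    obtain ⟨x, hx, hxe⟩ := Set.mem_smul_set.1 h2
    rw [← hxe]
    exact norm_smul_le_of_mem (share_nonneg h1 i) (share_le_one h1 i) (hR i x hx.1)
  have := sum_risk_le_of_tendsto hfatou (Y := fun n => pos (y n)) (Y₀ := pos y₀) hposlim
    (s := s) (eventually_atTop.2 ⟨m, hyrisk⟩)
  rw [hposy₀, hposy₀] at this
  exact this

/-- Existence of an optimal plan. -/
theorem exists_optimal_plan {a : ℝ} (ha : 0 < a) (hμ : μ (Set.Icc a 1)ᶜ = 0)
    {𝒳 : Fin 2 → Set (L2 P)} (hcl : ∀ i, IsClosed (𝒳 i))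
    (hcv : ∀ i, Convex ℝ (𝒳 i)) (h0 : ∀ i, (0 : L2 P) ∈ 𝒳 i) {R : ℝ}
    (hR : ∀ i, ∀ x ∈ 𝒳 i, ‖x‖ ≤ R) (hac : μ ≪ volume)
    {ρ : Fin 2 → L2 P → EReal} (hbot : ∀ i X, ρ i X ≠ ⊥) (hconv : ∀ i, IsConvexRisk (ρ i))
    (hfatou : ∀ i, HasFatouProperty (ρ i)) (W : Fin 2 → L2 P) {B : ℝ} (hB : 0 ≤ B) :
    ∃ (q φ : ℝ → ℝ) (X : Fin 2 → ℝ → L2 P), IsPlan μ 𝒳 B q φ X ∧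
      ∀ q' φ' X', IsPlan μ 𝒳 B q' φ' X' →
        planRisk μ ρ W φ X + (planCost μ q : EReal) ≤
          planRisk μ ρ W φ' X' + (planCost μ q' : EReal) := by
  set V : Set EReal := {v | ∃ q φ X, IsPlan μ 𝒳 B q φ X ∧
    v = planRisk μ ρ W φ X + (planCost μ q : EReal)} with hV
  have hzero : IsPlan μ 𝒳 B (fun _ => 0) (fun _ => 0) (fun _ _ => 0) :=
    ⟨antitone_const, fun _ => le_rfl, fun _ => hB, measurable_const, fun _ => by simp,
      fun _ => stronglyMeasurable_const, fun i => ae_of_all _ fun _ => h0 i,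
      fun _ => ae_of_all _ fun _ => var_zero.le⟩
  obtain ⟨u, -, hulim, hu⟩ := exists_seq_tendsto_sInf (S := V) ⟨_, _, _, _, hzero, rfl⟩
    (OrderBot.bddBelow V)
  choose q φ X hp hu using hu
  obtain ⟨σ, Q, N, hσ, hQ, hQ0, hQB, hN, hlim⟩ := exists_subseq_tendsto_antitone q
    (fun n => (hp n).antitone) (fun n => (hp n).nonneg) (fun n => (hp n).le_bound)
  obtain ⟨φ', X', hp', hrisk⟩ := exists_limit_plan hcl hcv h0 hR hac hbot hconv hfatou W
    (fun n => hp (σ n)) hQ hQ0 hQB hN hlim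
  have hcost := tendsto_planCost ha hμ hac (fun n => (hp (σ n)).antitone)
    (fun n => (hp (σ n)).nonneg) (fun n => (hp (σ n)).le_bound) hN hlim
  refine ⟨Q, φ', X', hp', fun q₁ φ₁ X₁ hp₁ => ?_⟩
  refine le_trans ?_ (sInf_le (show _ ∈ V from ⟨q₁, φ₁, X₁, hp₁, rfl⟩))
  by_contra! hlt
  -- Two levels s < s' are placed between the infimum and the value of the limit plan: values
  -- eventually drop below s, and the gap s' - s absorbs the error in the convergence of costs.
  obtain ⟨s, hs1, hs2⟩ := EReal.lt_iff_exists_real_btwn.1 hlt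
  obtain ⟨s', hs1', hs2'⟩ := EReal.lt_iff_exists_real_btwn.1 hs2
  have hss : s < s' := by exact_mod_cast hs1'
  have hev : ∀ᶠ n in atTop, planRisk μ ρ W (φ (σ n)) (X (σ n)) ≤
      ((s' - planCost μ Q : ℝ) : EReal) := by
    filter_upwards [(hulim.comp hσ.tendsto_atTop).eventually (gt_mem_nhds hs1),
      hcost.eventually (lt_mem_nhds (show planCost μ Q - (s' - s) < planCost μ Q by linarith))]
      with n h1 h2
    rw [Function.comp_apply, hu] at h1
    have h3 : planRisk μ ρ W (φ (σ n)) (X (σ n)) ≤ (s : EReal) - (planCost μ (q (σ n)) : ℝ) :=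
      (EReal.le_sub_iff_add_le (by simp) (by simp)).2 h1.le
    refine h3.trans ?_
    rw [← EReal.coe_sub]
    exact_mod_cast (by linarith)
  have := hrisk _ hev
  have h4 : planRisk μ ρ W φ' X' + (planCost μ Q : EReal) ≤ s' := by
    refine (add_le_add_left this _).trans ?_
    rw [← EReal.coe_add]
    exact_mod_cast (by linarith)
  exact absurd (h4.trans_lt hs2') (lt_irrefl _)

end Limit

/-! ### Monotone transport for atomless measures on the line -/

section Transport

variable {μ : Measure ℝ} [IsFiniteMeasure μ]

theorem continuous_measureReal_Iic [NullSingletonClass μ] : Continuous fun x => μ.real (Set.Iic x) := by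
  have : (fun x => μ.real (Set.Iic x)) =
      fun x => ∫ θ, (Set.Iic x).indicator (fun _ => (1 : ℝ)) θ ∂μ := by
    ext x; rw [integral_indicator_const _ measurableSet_Iic]; simp
  rw [this, continuous_iff_continuousAt]
  intro x
  refine continuousAt_of_dominated (bound := fun _ => 1) ?_ ?_ (integrable_const _) ?_
  · exact Eventually.of_forall fun y =>
      (measurable_const.indicator measurableSet_Iic).aestronglyMeasurable
  · refine Eventually.of_forall fun y => ae_of_all _ fun θ => ?_
    rw [Set.indicator_apply]; split_ifs <;> simp
  · filter_upwards [measure_eq_zero_iff_ae_notMem.1 (measure_singleton (μ := μ) x)] with θ hθ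
    rcases lt_or_gt_of_ne (show θ ≠ x from hθ) with h | h
    · refine continuousAt_const.congr (f := fun _ => (1 : ℝ)) ?_
      filter_upwards [lt_mem_nhds h] with y hy
      rw [Set.indicator_of_mem (Set.mem_Iic.2 hy.le)]
    · refine continuousAt_const.congr (f := fun _ => (0 : ℝ)) ?_
      filter_upwards [gt_mem_nhds h] with y hy
      rw [Set.indicator_of_notMem (by simpa using hy)]

theorem monotone_measureReal_Iic : Monotone fun x => μ.real (Set.Iic x) := fun _ _ h =>
  measureReal_mono (Set.Iic_subset_Iic.2 h)

theorem tendsto_measureReal_Iic_atBot :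
    Tendsto (fun x => μ.real (Set.Iic x)) atBot (𝓝 0) := by
  have h := tendsto_measure_iInter_atBot (μ := μ) (s := fun x : ℝ => Set.Iic x)
    (fun x => measurableSet_Iic.nullMeasurableSet) (fun _ _ h => Set.Iic_subset_Iic.2 h)
    ⟨0, measure_ne_top μ _⟩
  have hempty : ⋂ x : ℝ, Set.Iic x = ∅ := by
    refine Set.eq_empty_of_forall_notMem fun y hy => ?_
    have := Set.mem_iInter.1 hy (y - 1)
    rw [Set.mem_Iic] at this
    linarith
  rw [hempty, measure_empty] at h
  have h2 := (ENNReal.tendsto_toReal ENNReal.zero_ne_top).comp h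
  rw [ENNReal.toReal_zero] at h2
  exact h2

theorem tendsto_measureReal_Iic_atTop :
    Tendsto (fun x => μ.real (Set.Iic x)) atTop (𝓝 (μ.real Set.univ)) :=
  (ENNReal.tendsto_toReal (measure_ne_top μ _)).comp (tendsto_measure_Iic_atTop μ)

/-- A quantile is at most `x` iff the level is at most the distribution function at `x`. -/
theorem sInf_le_iff_of_level {ν : Measure ℝ} [IsFiniteMeasure ν] [NullSingletonClass ν] {y : ℝ}
    (h0 : 0 < y) (hM : y < ν.real Set.univ) (x : ℝ) :
    sInf {t | y ≤ ν.real (Set.Iic t)} ≤ x ↔ y ≤ ν.real (Set.Iic x) := by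
  have hne : {t | y ≤ ν.real (Set.Iic t)}.Nonempty := by
    obtain ⟨t, ht⟩ := ((tendsto_measureReal_Iic_atTop (μ := ν)).eventually
      (lt_mem_nhds hM)).exists
    exact ⟨t, ht.le⟩
  obtain ⟨b, hb⟩ := ((tendsto_measureReal_Iic_atBot (μ := ν)).eventually (gt_mem_nhds h0)).exists
  have hbdd : BddBelow {t | y ≤ ν.real (Set.Iic t)} := by
    refine ⟨b, fun t ht => ?_⟩
    by_contra! hlt
    exact absurd (hb.trans_le ht) (not_lt.2 (monotone_measureReal_Iic hlt.le))
  have hcl : IsClosed {t | y ≤ ν.real (Set.Iic t)} :=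
    isClosed_le continuous_const continuous_measureReal_Iic
  refine ⟨fun h => ?_, fun h => csInf_le hbdd h⟩
  exact (hcl.csInf_mem hne hbdd : y ≤ _).trans (monotone_measureReal_Iic h)

/-- For atomless μ the distribution function pushes μ to the uniform measure on [0, μ(ℝ)]. For
interior levels the set is a half-line ending at the quantile; the top level, where a quantile may
fail to exist, follows by approximation from below. -/
theorem measureReal_level_lt [NullSingletonClass μ] {y : ℝ} (h0 : 0 ≤ y)
    (hM : y ≤ μ.real Set.univ) : μ.real {θ | μ.real (Set.Iic θ) < y} = y := by
  have hbelow : ∀ z, 0 < z → z < μ.real Set.univ →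
      μ.real {θ | μ.real (Set.Iic θ) < z} = z := by
    intro z hz0 hzM
    have hset : {θ | μ.real (Set.Iic θ) < z} = Set.Iio (sInf {t | z ≤ μ.real (Set.Iic t)}) := by
      ext θ
      rw [Set.mem_ofPred_eq, Set.mem_Iio, ← not_le, ← not_le, sInf_le_iff_of_level hz0 hzM]
    set s := sInf {t | z ≤ μ.real (Set.Iic t)} with hs
    have hge : z ≤ μ.real (Set.Iic s) := (sInf_le_iff_of_level hz0 hzM s).1 le_rfl
    have hle : μ.real (Set.Iic s) ≤ z := by
      have hl : Tendsto (fun x => μ.real (Set.Iic x)) (𝓝[<] s) (𝓝 (μ.real (Set.Iic s))) :=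
        (continuous_measureReal_Iic.tendsto s).mono_left nhdsWithin_le_nhds
      refine le_of_tendsto hl ?_
      filter_upwards [self_mem_nhdsWithin] with x hx
      have : x ∈ {θ | μ.real (Set.Iic θ) < z} := by rw [hset]; exact hx
      exact this.le
    rw [hset, measureReal_congr (Iio_ae_eq_Iic (μ := μ) (a := s))]
    exact le_antisymm hle hge
  rcases h0.eq_or_lt with rfl | h0
  · have : {θ | μ.real (Set.Iic θ) < 0} = ∅ := by
      ext θ; simp
    rw [this, measureReal_empty]
  rcases hM.eq_or_lt with rfl | hM
  · refine le_antisymm (measureReal_mono (Set.subset_univ _)) ?_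
    refine le_of_forall_lt_imp_le_of_dense fun z hz => ?_
    rcases le_or_gt z 0 with hz0 | hz0
    · exact hz0.trans measureReal_nonneg
    · rw [← hbelow z hz0 hz]
      exact measureReal_mono fun θ hθ => lt_trans hθ hz
  · exact hbelow y h0 hM

theorem measureReal_level_le [NullSingletonClass μ] {y : ℝ} (h0 : 0 ≤ y)
    (hM : y ≤ μ.real Set.univ) : μ.real {θ | μ.real (Set.Iic θ) ≤ y} = y := by
  refine le_antisymm ?_ ?_
  · rcases hM.eq_or_lt with h | hM
    · rw [h]; exact measureReal_mono (Set.subset_univ _)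
    · refine le_of_forall_gt_imp_ge_of_dense fun z hz => ?_
      rcases le_or_gt z (μ.real Set.univ) with h | h
      · rw [← measureReal_level_lt (h0.trans hz.le) h]
        exact measureReal_mono fun θ hθ => lt_of_le_of_lt hθ hz
      · exact (measureReal_mono (Set.subset_univ _)).trans h.le
  · conv_lhs => rw [← measureReal_level_lt h0 hM]
    exact measureReal_mono fun θ (hθ : μ.real (Set.Iic θ) < y) => hθ.le

theorem measurable_measureReal_Iic : Measurable fun x => μ.real (Set.Iic x) :=
  (monotone_measureReal_Iic (μ := μ)).measurable

theorem measure_level_eq [NullSingletonClass μ] (y : ℝ) : μ {θ | μ.real (Set.Iic θ) = y} = 0 := by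
  by_cases hy : 0 ≤ y ∧ y ≤ μ.real Set.univ
  · have h : {θ | μ.real (Set.Iic θ) = y} =
        {θ | μ.real (Set.Iic θ) ≤ y} \ {θ | μ.real (Set.Iic θ) < y} := by
      ext θ; simp [le_antisymm_iff]
    have hsub : {θ | μ.real (Set.Iic θ) < y} ⊆ {θ | μ.real (Set.Iic θ) ≤ y} :=
      fun θ (hθ : μ.real (Set.Iic θ) < y) => hθ.le
    rw [← measureReal_eq_zero_iff, h, measureReal_sdiff hsub
      (measurableSet_lt measurable_measureReal_Iic measurable_const),
      measureReal_level_lt hy.1 hy.2, measureReal_level_le hy.1 hy.2, sub_self]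
  · have : {θ | μ.real (Set.Iic θ) = y} = ∅ := by
      ext θ
      simp only [Set.mem_ofPred_eq, Set.mem_empty_iff_false, iff_false]
      rintro rfl
      exact hy ⟨measureReal_nonneg, measureReal_mono (Set.subset_univ _)⟩
    rw [this, measure_empty]

/-- Monotone transport to the right: mass of a smaller measure `ν ≤ μ` is collected in an initial
segment. -/
theorem exists_transport {ν : Measure ℝ} (hν : ν ≤ μ) [NullSingletonClass μ] [IsFiniteMeasure ν]
    [NullSingletonClass ν] :
    ∃ T : ℝ → ℝ, Measurable T ∧
      (μ.restrict {θ | μ.real (Set.Iic θ) < ν.real Set.univ}).map T = ν ∧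
      ∀ᵐ θ ∂μ.restrict {θ | μ.real (Set.Iic θ) < ν.real Set.univ}, θ ≤ T θ := by
  set F : ℝ → ℝ := fun x => μ.real (Set.Iic x) with hF
  set G : ℝ → ℝ := fun x => ν.real (Set.Iic x) with hG
  set m := ν.real Set.univ with hm
  have hmM : m ≤ μ.real Set.univ :=
    ENNReal.toReal_mono (measure_ne_top μ _) (hν _)
  have hGF : ∀ x, G x ≤ F x := fun x => ENNReal.toReal_mono (measure_ne_top μ _) (hν _)
  have hFm : Measurable F := measurable_measureReal_Iic
  have hA : MeasurableSet {θ | F θ < m} := measurableSet_lt hFm measurable_const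
  have hC : MeasurableSet {θ | 0 < F θ ∧ F θ < m} :=
    (measurableSet_lt measurable_const hFm).inter hA
  classical
  -- T is the quantile function of ν composed with the distribution function of μ. The value 0 is
  -- used off the levels in (0, m); within the initial segment this concerns only a null set.
  set T : ℝ → ℝ := fun θ => if 0 < F θ ∧ F θ < m then sInf {t | F θ ≤ G t} else 0 with hT
  have hTiff : ∀ θ, 0 < F θ ∧ F θ < m → ∀ x, T θ ≤ x ↔ F θ ≤ G x := by
    intro θ hθ x
    simp only [hT]
    rw [if_pos hθ]
    exact sInf_le_iff_of_level hθ.1 hθ.2 x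
  have hTm : Measurable T := by
    refine measurable_of_Iic fun x => ?_
    have : T ⁻¹' Set.Iic x = ({θ | 0 < F θ ∧ F θ < m} ∩ {θ | F θ ≤ G x}) ∪
        ({θ | 0 < F θ ∧ F θ < m}ᶜ ∩ {_θ | (0 : ℝ) ≤ x}) := by
      ext θ
      by_cases h : 0 < F θ ∧ F θ < m
      · have := hTiff θ h x
        simp [h, this]
      · have h0 : T θ = 0 := by simp only [hT]; rw [if_neg h]
        simp only [Set.mem_preimage, Set.mem_Iic, h0, Set.mem_union, Set.mem_inter_iff,
          Set.mem_compl_iff, Set.mem_ofPred_eq, h, not_false_eq_true, false_and, true_and,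
          false_or]
    rw [this]
    exact (hC.inter (measurableSet_le hFm measurable_const)).union
      (hC.compl.inter (MeasurableSet.const _))
  have hpos : ∀ᵐ θ ∂μ, 0 < F θ := by
    filter_upwards [measure_eq_zero_iff_ae_notMem.1 (measure_level_eq (μ := μ) 0)] with θ hθ
    exact lt_of_le_of_ne measureReal_nonneg (Ne.symm hθ)
  refine ⟨T, hTm, ?_, ?_⟩
  · refine Measure.ext_of_Iic _ _ fun x => ?_
    rw [Measure.map_apply hTm measurableSet_Iic, Measure.restrict_apply (hTm measurableSet_Iic)]
    have hGm : G x ≤ m := measureReal_mono (Set.subset_univ _)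
    have h1 : (T ⁻¹' Set.Iic x ∩ {θ | F θ < m} : Set ℝ) =ᵐ[μ] {θ | F θ ≤ G x} := by
      filter_upwards [hpos, measure_eq_zero_iff_ae_notMem.1 (measure_level_eq (μ := μ) m)]
        with θ hθ hθm
      refine propext ⟨fun h => (hTiff θ ⟨hθ, h.2⟩ x).1 h.1, fun h => ?_⟩
      have hlt : F θ < m := lt_of_le_of_ne (le_trans h hGm) hθm
      exact ⟨(hTiff θ ⟨hθ, hlt⟩ x).2 h, hlt⟩
    rw [measure_congr h1]
    have h2 := measureReal_level_le (μ := μ) (y := G x) measureReal_nonneg (hGm.trans hmM)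
    exact (ENNReal.toReal_eq_toReal_iff' (measure_ne_top _ _) (measure_ne_top _ _)).1 h2
  · rw [ae_restrict_iff' hA]
    -- If T θ < r < θ, then F θ ≤ G r ≤ F r ≤ F θ, so F θ is one of the countably many values F r,
    -- each attained on a null set only.
    have hall : ∀ᵐ θ ∂μ, ∀ r : ℚ, F θ ≠ F r :=
      ae_all_iff.2 fun r => measure_eq_zero_iff_ae_notMem.1 (measure_level_eq (μ := μ) (F r))
    filter_upwards [hpos, hall] with θ hθ hr hθm
    by_contra! hlt
    obtain ⟨r, hr1, hr2⟩ := exists_rat_btwn hlt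
    refine hr r (le_antisymm ?_ (monotone_measureReal_Iic hr2.le))
    exact ((hTiff θ ⟨hθ, hθm⟩ r).1 hr1.le).trans (hGF r)

end Transport

/-! ### Weighted averages and strict monotonicity of the cost -/

section Improvement

variable {Ω : Type*} [MeasurableSpace Ω] {P : Measure Ω} [IsProbabilityMeasure P]
  {μ : Measure ℝ} [IsFiniteMeasure μ]

theorem integrable_of_mem_Icc {w : ℝ → ℝ} (hw : Measurable w) (h01 : ∀ θ, w θ ∈ Set.Icc (0 : ℝ) 1) :
    Integrable w μ :=
  Integrable.of_bound hw.aestronglyMeasurable 1 (ae_of_all _ fun θ => by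
    rw [Real.norm_eq_abs, abs_of_nonneg (h01 θ).1]; exact (h01 θ).2)

theorem integrable_smul_of_mem_Icc {w : ℝ → ℝ} (hw : Measurable w)
    (h01 : ∀ θ, w θ ∈ Set.Icc (0 : ℝ) 1) {X : ℝ → L2 P} (hX : StronglyMeasurable X) {R : ℝ}
    (hR : ∀ᵐ θ ∂μ, ‖X θ‖ ≤ R) : Integrable (fun θ => w θ • X θ) μ := by
  refine Integrable.of_bound (hw.aestronglyMeasurable.smul hX.aestronglyMeasurable) R ?_
  filter_upwards [hR] with θ h
  exact norm_smul_le_of_mem (h01 θ).1 (h01 θ).2 h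

/-- The measure with a density bounded by one. -/
def weighted (μ : Measure ℝ) (w : ℝ → ℝ) : Measure ℝ := μ.withDensity fun θ => ENNReal.ofReal (w θ)

theorem weighted_le {w : ℝ → ℝ} (h01 : ∀ θ, w θ ∈ Set.Icc (0 : ℝ) 1) : weighted μ w ≤ μ := by
  conv_rhs => rw [← withDensity_one (μ := μ)]
  exact withDensity_mono (ae_of_all _ fun θ => by
    simpa using ENNReal.ofReal_le_one.2 (h01 θ).2)

theorem isFiniteMeasure_weighted {w : ℝ → ℝ} (h01 : ∀ θ, w θ ∈ Set.Icc (0 : ℝ) 1) :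
    IsFiniteMeasure (weighted μ w) := isFiniteMeasure_of_le μ (weighted_le h01)

theorem integral_weighted {E : Type*} [NormedAddCommGroup E] [NormedSpace ℝ E] {w : ℝ → ℝ}
    (hw : Measurable w) (h01 : ∀ θ, w θ ∈ Set.Icc (0 : ℝ) 1) (f : ℝ → E) :
    ∫ θ, f θ ∂weighted μ w = ∫ θ, w θ • f θ ∂μ := by
  rw [weighted, integral_withDensity_eq_integral_toReal_smul hw.ennreal_ofReal
    (ae_of_all _ fun θ => ENNReal.ofReal_lt_top)]
  simp only [ENNReal.toReal_ofReal (h01 _).1]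

theorem ae_weighted_iff {w : ℝ → ℝ} (hw : Measurable w) (h01 : ∀ θ, w θ ∈ Set.Icc (0 : ℝ) 1)
    {p : ℝ → Prop} : (∀ᵐ θ ∂weighted μ w, p θ) ↔ ∀ᵐ θ ∂μ, w θ ≠ 0 → p θ := by
  rw [weighted, ae_withDensity_iff hw.ennreal_ofReal]
  refine eventually_congr (ae_of_all _ fun θ => ?_)
  rw [ne_eq, ENNReal.ofReal_eq_zero, ne_eq, (h01 θ).1.ge_iff_eq']

theorem weighted_real_univ {w : ℝ → ℝ} (hw : Measurable w)
    (h01 : ∀ θ, w θ ∈ Set.Icc (0 : ℝ) 1) : (weighted μ w).real Set.univ = ∫ θ, w θ ∂μ := by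
  have := isFiniteMeasure_weighted (μ := μ) h01
  have h := integral_weighted (μ := μ) hw h01 fun _ => (1 : ℝ)
  simpa using h

/-- Weighted averages stay in closed convex sets. -/
theorem weighted_average_mem {w : ℝ → ℝ} (hw : Measurable w)
    (h01 : ∀ θ, w θ ∈ Set.Icc (0 : ℝ) 1) (hpos : ∫ θ, w θ ∂μ ≠ 0) {X : ℝ → L2 P}
    (hX : StronglyMeasurable X) {R : ℝ} (hR : ∀ᵐ θ ∂μ, ‖X θ‖ ≤ R) {K : Set (L2 P)}
    (hK : Convex ℝ K) (hcl : IsClosed K) (hmem : ∀ᵐ θ ∂μ, w θ ≠ 0 → X θ ∈ K) :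
    (∫ θ, w θ ∂μ)⁻¹ • ∫ θ, w θ • X θ ∂μ ∈ K := by
  have hfin := isFiniteMeasure_weighted (μ := μ) h01
  have hne : NeZero (weighted μ w) := ⟨fun h => hpos (by
    rw [← weighted_real_univ hw h01, h]; simp)⟩
  have hint : Integrable X (weighted μ w) :=
    Integrable.of_bound hX.aestronglyMeasurable R
      ((ae_weighted_iff hw h01).2 (hR.mono fun θ h _ => h))
  have := hK.average_mem hcl ((ae_weighted_iff hw h01).2 hmem) hint
  rwa [average_eq, weighted_real_univ hw h01, integral_weighted hw h01] at this

/-- Lowering q cannot increase the surplus on types up to 1, and the term θ q drops by at least a (q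
- q'), which is where a > 0 enters. -/
theorem planCost_lt {a : ℝ} (ha : 0 < a) (hμ : μ (Set.Icc a 1)ᶜ = 0) {q q' : ℝ → ℝ} {B : ℝ}
    (hq : Antitone q) (hq0 : ∀ x, 0 ≤ q x) (hqB : ∀ x, q x ≤ B)
    (hq' : Antitone q') (hq0' : ∀ x, 0 ≤ q' x) (hqB' : ∀ x, q' x ≤ B)
    (hle : ∀ θ, q' θ ≤ q θ) (hlt : μ {θ | q' θ < q θ} ≠ 0) : planCost μ q' < planCost μ q := by
  have i1 := integrable_cost ha hμ hq hq0 hqB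
  have i2 := integrable_cost ha hμ hq' hq0' hqB'
  rw [← sub_pos, planCost, planCost, ← integral_sub i1 i2]
  have hsur : ∀ θ ≤ 1, surplus q' θ ≤ surplus q θ := fun θ hθ =>
    intervalIntegral.integral_mono_on hθ (intervalIntegrable_of_antitone hq' _ _)
      (intervalIntegrable_of_antitone hq _ _) fun x _ => hle x
  have hgap : ∀ᵐ θ ∂μ, a * (q θ - q' θ) ≤
      surplus q θ + θ * q θ - (surplus q' θ + θ * q' θ) := by
    filter_upwards [ae_mem_Icc hμ] with θ hθ
    nlinarith [hsur θ hθ.2, mul_nonneg (sub_nonneg.2 hθ.1) (sub_nonneg.2 (hle θ))]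
  rw [integral_pos_iff_support_of_nonneg_ae]
  · refine pos_iff_ne_zero.2 fun h0 => hlt ?_
    refine measure_mono_null_ae ?_ h0
    filter_upwards [hgap] with θ h hθ
    have hθ : q' θ < q θ := hθ
    exact ne_of_gt (lt_of_lt_of_le (mul_pos ha (sub_pos.2 hθ)) h)
  · filter_upwards [hgap] with θ h
    exact (mul_nonneg ha.le (sub_nonneg.2 (hle θ))).trans h
  · exact i1.sub i2

theorem measurable_var_comp {X : ℝ → L2 P} (hX : StronglyMeasurable X) :
    Measurable fun θ => var (X θ) :=
  (continuous_var.comp_stronglyMeasurable hX).measurable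

end Improvement

/-! ### Rearrangement: the variance constraint binds -/

section Tightness

variable {Ω : Type*} [MeasurableSpace Ω] {P : Measure Ω} [IsProbabilityMeasure P]
  {μ : Measure ℝ} [IsFiniteMeasure μ]

theorem integral_add_add {E : Type*} [NormedAddCommGroup E] [NormedSpace ℝ E] {f g k : ℝ → E}
    (hf : Integrable f μ) (hg : Integrable g μ) (hk : Integrable k μ) :
    ∫ θ, f θ + g θ + k θ ∂μ = ∫ θ, f θ ∂μ + ∫ θ, g θ ∂μ + ∫ θ, k θ ∂μ := by
  rw [← integral_add hf hg]
  exact integral_add (hf.add hg) hk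

theorem share_add (φ : ℝ → ℝ) (θ : ℝ) : share φ 0 θ + share φ 1 θ = 1 := by
  simp [share]

/-- If the low variance products sold to the types in `{c < q}` are moved to the end of this
segment, and averaged there, then the aggregate position does not change, and `q` can be lowered. -/
theorem IsPlan.exists_improvement {𝒳 : Fin 2 → Set (L2 P)} {B : ℝ} {q φ : ℝ → ℝ}
    {X : Fin 2 → ℝ → L2 P} (hp : IsPlan μ 𝒳 B q φ X) {a : ℝ} (ha : 0 < a)
    (hμ : μ (Set.Icc a 1)ᶜ = 0) (hac : μ ≪ volume)
    (hcl : ∀ i, IsClosed (𝒳 i)) (hcv : ∀ i, Convex ℝ (𝒳 i)) (h0 : ∀ i, (0 : L2 P) ∈ 𝒳 i) {R : ℝ}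
    (hR : ∀ i, ∀ x ∈ 𝒳 i, ‖x‖ ≤ R) {c : ℝ} {i₀ : Fin 2}
    (hc : μ {θ | share φ i₀ θ ≠ 0 ∧ var (X i₀ θ) < c ∧ c < q θ} ≠ 0) :
    ∃ q' φ' X', IsPlan μ 𝒳 B q' φ' X' ∧
      (∀ i, ∫ θ, share φ' i θ • X' i θ ∂μ = ∫ θ, share φ i θ • X i θ ∂μ) ∧
      planCost μ q' < planCost μ q := by
  classical
  have hna : NullSingletonClass μ := ⟨fun x => hac (measure_singleton x)⟩
  have hc0 : 0 ≤ c := by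
    obtain ⟨θ, -, h, -⟩ := nonempty_of_measure_ne_zero hc
    exact (var_nonneg _).trans h.le
  have hqm : Measurable q := hp.antitone.measurable
  have hvm : ∀ i, Measurable fun θ => var (X i θ) := fun i =>
    measurable_var_comp (hp.stronglyMeasurable i)
  have hsm : ∀ i, Measurable (share φ i) := measurable_share hp.measurable
  have hs0 : ∀ i θ, 0 ≤ share φ i θ := fun i θ => share_nonneg (hp.share_mem θ) i
  have hs1 : ∀ i θ, share φ i θ ≤ 1 := fun i θ => share_le_one (hp.share_mem θ) i
  have hXR : ∀ i, ∀ᵐ θ ∂μ, ‖X i θ‖ ≤ R := fun i => (hp.mem i).mono fun θ h => hR i _ h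
  have hDm : MeasurableSet {θ | c < q θ} := measurableSet_lt measurable_const hqm
  -- On the initial segment {c < q}, the sales of each firm are split into those of variance at
  -- least c (density g) and those below c (density l).
  set g : Fin 2 → ℝ → ℝ := fun i θ => if c ≤ var (X i θ) ∧ c < q θ then share φ i θ else 0 with hg
  set l : Fin 2 → ℝ → ℝ := fun i θ => if var (X i θ) < c ∧ c < q θ then share φ i θ else 0 with hl
  have hgm : ∀ i, Measurable (g i) := fun i =>
    Measurable.ite ((measurableSet_le measurable_const (hvm i)).inter hDm) (hsm i) measurable_const
  have hlm : ∀ i, Measurable (l i) := fun i =>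
    Measurable.ite ((measurableSet_lt (hvm i) measurable_const).inter hDm) (hsm i) measurable_const
  have hg0 : ∀ i θ, 0 ≤ g i θ := fun i θ => by
    simp only [hg]; split_ifs; exacts [hs0 i θ, le_rfl]
  have hl0 : ∀ i θ, 0 ≤ l i θ := fun i θ => by
    simp only [hl]; split_ifs; exacts [hs0 i θ, le_rfl]
  have hsplit : ∀ i θ, g i θ + l i θ = if c < q θ then share φ i θ else 0 := fun i θ => by
    simp only [hg, hl]
    by_cases h1 : c < q θ <;> by_cases h2 : c ≤ var (X i θ)
    · simp [h1, h2, not_lt.2 h2]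
    · simp [h1, h2, not_le.1 h2]
    · simp [h1]
    · simp [h1]
  have hgl1 : ∀ i θ, g i θ + l i θ ≤ 1 := fun i θ => by
    rw [hsplit]; split_ifs; exacts [hs1 i θ, zero_le_one]
  have hg01 : ∀ i θ, g i θ ∈ Set.Icc (0 : ℝ) 1 := fun i θ =>
    ⟨hg0 i θ, by linarith [hgl1 i θ, hl0 i θ]⟩
  have hl01 : ∀ i θ, l i θ ∈ Set.Icc (0 : ℝ) 1 := fun i θ =>
    ⟨hl0 i θ, by linarith [hgl1 i θ, hg0 i θ]⟩
  set h : ℝ → ℝ := fun θ => g 0 θ + g 1 θ with hh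
  have htot : ∀ θ, h θ + l 0 θ + l 1 θ = Set.indicator {θ | c < q θ} (fun _ => (1 : ℝ)) θ := by
    intro θ
    have e0 := hsplit 0 θ
    have e1 := hsplit 1 θ
    have e2 := share_add φ θ
    rw [Set.indicator_apply]
    simp only [hh, Set.mem_ofPred_eq]
    split_ifs at e0 e1 ⊢ <;> linarith
  have hh01 : ∀ θ, h θ ∈ Set.Icc (0 : ℝ) 1 := fun θ => by
    refine ⟨add_nonneg (hg0 0 θ) (hg0 1 θ), ?_⟩
    have e := htot θ
    rw [Set.indicator_apply] at e
    split_ifs at e <;> linarith [hl0 0 θ, hl0 1 θ]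
  have hhm : Measurable h := (hgm 0).add (hgm 1)
  set ν := weighted μ h with hν
  have hνμ : ν ≤ μ := weighted_le hh01
  have hνfin : IsFiniteMeasure ν := isFiniteMeasure_weighted hh01
  have hνna : NullSingletonClass ν :=
    ⟨fun x => le_antisymm ((hνμ _).trans (measure_singleton (μ := μ) x).le) bot_le⟩
  obtain ⟨T, hTm, hTmap, hTge⟩ := exists_transport hνμ
  set mH := ν.real Set.univ with hmH
  have hmH' : mH = ∫ θ, h θ ∂μ := weighted_real_univ hhm hh01
  set m : Fin 2 → ℝ := fun i => ∫ θ, l i θ ∂μ with hm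
  have hli : ∀ i, Integrable (l i) μ := fun i => integrable_of_mem_Icc (hlm i) (hl01 i)
  have hm0 : ∀ i, 0 ≤ m i := fun i => integral_nonneg (hl0 i)
  have hmpos : 0 < m i₀ := by
    refine (integral_pos_iff_support_of_nonneg (hl0 i₀) (hli i₀)).2 (pos_iff_ne_zero.2 fun hz => ?_)
    refine hc (measure_mono_null (fun θ hθ => ?_) hz)
    rw [Function.mem_support]
    simp only [hl]
    rw [if_pos ⟨hθ.2.1, hθ.2.2⟩]
    exact hθ.1
  have hmL : 0 < m 0 + m 1 := by
    have h0 := hm0 0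
    have h1 := hm0 1
    fin_cases i₀
    · exact add_pos_of_pos_of_nonneg hmpos h1
    · exact add_pos_of_nonneg_of_pos h0 hmpos
  have hμD : μ.real {θ | c < q θ} = mH + (m 0 + m 1) := by
    have e : ∫ θ, Set.indicator {θ | c < q θ} (fun _ => (1 : ℝ)) θ ∂μ = mH + (m 0 + m 1) := by
      rw [hmH', ← integral_congr_ae (ae_of_all _ htot),
        integral_add_add (integrable_of_mem_Icc hhm hh01) (hli 0) (hli 1), add_assoc]
    rw [integral_indicator_const _ hDm] at e
    simpa using e
  set A : Set ℝ := {θ | μ.real (Set.Iic θ) < mH} with hA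
  have hAm : MeasurableSet A := measurableSet_lt measurable_measureReal_Iic measurable_const
  have hmHM : mH ≤ μ.real Set.univ := ENNReal.toReal_mono (measure_ne_top μ _) (hνμ _)
  have hμA : μ.real A = mH := measureReal_level_lt measureReal_nonneg hmHM
  have hAlow : ∀ θ ∈ A, ∀ θ' ≤ θ, θ' ∈ A := fun θ (hθ : _ < _) θ' hle =>
    (monotone_measureReal_Iic (μ := μ) hle).trans_lt hθ
  -- Both sets are closed to the left, hence nested; A has strictly less mass, the deficit being the
  -- low variance mass m 0 + m 1.
  have hAD : A ⊆ {θ | c < q θ} := by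
    intro θ hθ
    by_contra hθD
    have hθD : ¬ c < q θ := hθD
    have : {θ | c < q θ} ⊆ A := fun θ' (hθ' : c < q θ') => by
      refine hAlow θ hθ θ' (le_of_not_gt fun hlt => hθD (hθ'.trans_le (hp.antitone hlt.le)))
    have := measureReal_mono (μ := μ) this
    rw [hμA, hμD] at this
    linarith
  have hpull : ∀ {p : ℝ → Prop}, (∀ᵐ θ ∂ν, p θ) → ∀ᵐ θ ∂μ, θ ∈ A → p (T θ) := by
    intro p hpn
    rw [← hTmap] at hpn
    exact (ae_restrict_iff' hAm).1 (ae_of_ae_map hTm.aemeasurable hpn)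
  have hac' : ∀ {p : ℝ → Prop}, (∀ᵐ θ ∂μ, p θ) → ∀ᵐ θ ∂ν, p θ := fun hpμ =>
    (Measure.absolutelyContinuous_of_le hνμ).ae_le hpμ
  have hTh : ∀ᵐ θ ∂μ, θ ∈ A → h (T θ) ≠ 0 :=
    hpull ((ae_weighted_iff hhm hh01).2 (ae_of_all _ fun _ => id))
  have hTge' : ∀ᵐ θ ∂μ, θ ∈ A → θ ≤ T θ := (ae_restrict_iff' hAm).1 hTge
  set xbar : Fin 2 → L2 P := fun i => (m i)⁻¹ • ∫ θ, l i θ • X i θ ∂μ with hxbar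
  have hxbar_mem : ∀ i, xbar i ∈ 𝒳 i ∩ {x | var x ≤ c} := by
    intro i
    by_cases hz : m i = 0
    · have : xbar i = 0 := by simp only [hxbar]; rw [hz, inv_zero, zero_smul]
      rw [this]
      exact ⟨h0 i, var_zero.trans_le hc0⟩
    · refine weighted_average_mem (hlm i) (hl01 i) hz (hp.stronglyMeasurable i) (hXR i)
        ((hcv i).inter (convex_var_le c)) ((hcl i).inter (isClosed_var_le c)) ?_
      filter_upwards [hp.mem i] with θ h1 h2
      refine ⟨h1, ?_⟩
      by_contra hlt
      refine h2 ?_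
      simp only [hl]
      exact if_neg fun h3 => hlt h3.1.le
  -- Types in A receive what was sold at T θ, in the same proportions between firms. The rest of {c
  -- < q} receives the averaged low variance products in proportions m 0 : m 1, so q can be cut to c
  -- there.
  set q' : ℝ → ℝ := fun θ => if θ ∈ A then q θ else min (q θ) c with hq'
  set φ' : ℝ → ℝ := fun θ => if θ ∈ A then g 0 (T θ) / h (T θ) else
    if c < q θ then m 0 / (m 0 + m 1) else φ θ with hφ'
  set X' : Fin 2 → ℝ → L2 P := fun i θ => if θ ∈ A then X i (T θ) else
    if c < q θ then xbar i else X i θ with hX'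
  have hq'le : ∀ θ, q' θ ≤ q θ := fun θ => by
    simp only [hq']; split_ifs; exacts [le_rfl, min_le_left _ _]
  have hplan : IsPlan μ 𝒳 B q' φ' X' := by
    refine ⟨fun x y hxy => ?_, fun θ => ?_, fun θ => (hq'le θ).trans (hp.le_bound θ), ?_,
      fun θ => ?_, fun i => ?_, fun i => ?_, fun i => ?_⟩
    · simp only [hq']
      by_cases hy : y ∈ A
      · rw [if_pos hy, if_pos (hAlow y hy x hxy)]; exact hp.antitone hxy
      · rw [if_neg hy]
        split_ifs
        · exact (min_le_left _ _).trans (hp.antitone hxy)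
        · exact min_le_min_right _ (hp.antitone hxy)
    · simp only [hq']; split_ifs; exacts [hp.nonneg θ, le_min (hp.nonneg θ) hc0]
    · exact Measurable.ite hAm (((hgm 0).comp hTm).div (hhm.comp hTm))
        (Measurable.ite hDm measurable_const hp.measurable)
    · simp only [hφ']
      split_ifs
      · exact ⟨div_nonneg (hg0 _ _) (hh01 _).1,
          div_le_one_of_le₀ (le_add_of_nonneg_right (hg0 _ _)) (hh01 _).1⟩
      · exact ⟨div_nonneg (hm0 _) hmL.le,
          div_le_one_of_le₀ (le_add_of_nonneg_right (hm0 _)) hmL.le⟩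
      · exact hp.share_mem θ
    · exact StronglyMeasurable.ite hAm ((hp.stronglyMeasurable i).comp_measurable hTm)
        (StronglyMeasurable.ite hDm stronglyMeasurable_const (hp.stronglyMeasurable i))
    · filter_upwards [hp.mem i, hpull (hac' (hp.mem i))] with θ h1 h2
      simp only [hX']
      split_ifs with h3 h4
      exacts [h2 h3, (hxbar_mem i).1, h1]
    · filter_upwards [hp.var_le i, hpull (hac' (hp.var_le i)), hTge'] with θ h1 h2 h5
      simp only [hX', hq']
      split_ifs with h3 h4
      -- Since θ ≤ T θ and q is decreasing, a product that respected the bound at T θ respects it at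
      -- θ.
      · exact (h2 h3).trans (hp.antitone (h5 h3))
      · exact le_min ((hxbar_mem i).2.trans h4.le) (hxbar_mem i).2
      · rw [min_eq_left (not_lt.1 h4)]; exact h1
  refine ⟨q', φ', X', hplan, fun i => ?_, ?_⟩
  · have hshareA : ∀ᵐ θ ∂μ, θ ∈ A → share φ' i θ = g i (T θ) / h (T θ) := by
      filter_upwards [hTh] with θ h1 h2
      have e : φ' θ = g 0 (T θ) / h (T θ) := by simp only [hφ']; rw [if_pos h2]
      fin_cases i
      · exact e
      · change 1 - φ' θ = _
        rw [e, eq_div_iff (h1 h2), sub_mul, div_mul_cancel₀ _ (h1 h2)]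
        simp only [hh]
        change 1 * (g 0 (T θ) + g 1 (T θ)) - g 0 (T θ) = g 1 (T θ)
        ring
    have hshareE : ∀ θ, θ ∉ A → c < q θ → share φ' i θ = m i / (m 0 + m 1) := by
      intro θ h1 h2
      have e : φ' θ = m 0 / (m 0 + m 1) := by simp only [hφ']; rw [if_neg h1, if_pos h2]
      fin_cases i
      · exact e
      · change 1 - φ' θ = _
        rw [e, eq_div_iff hmL.ne', sub_mul, div_mul_cancel₀ _ hmL.ne']
        change 1 * (m 0 + m 1) - m 0 = m 1
        ring
    set E : Set ℝ := {θ | c < q θ} \ A with hE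
    have hEm : MeasurableSet E := hDm.diff hAm
    have hμE : μ.real E = m 0 + m 1 := by
      rw [hE, measureReal_sdiff hAD hAm, hμD, hμA]; ring
    have hnew : ∀ᵐ θ ∂μ, share φ' i θ • X' i θ =
        A.indicator (fun θ => (g i (T θ) / h (T θ)) • X i (T θ)) θ +
          E.indicator (fun _ => (m i / (m 0 + m 1)) • xbar i) θ +
          {θ | c < q θ}ᶜ.indicator (fun θ => share φ i θ • X i θ) θ := by
      filter_upwards [hshareA] with θ h1
      by_cases hθA : θ ∈ A
      · have hD : θ ∈ {θ | c < q θ} := hAD hθA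
        rw [Set.indicator_of_mem hθA, Set.indicator_of_notMem (fun hx => hx.2 hθA),
          Set.indicator_of_notMem (Set.notMem_compl_iff.2 (show θ ∈ {θ | c < q θ} from hD)), h1 hθA]
        simp only [hX']
        rw [if_pos hθA, add_zero, add_zero]
      · by_cases hD : c < q θ
        · rw [Set.indicator_of_notMem hθA, Set.indicator_of_mem (show θ ∈ E from ⟨hD, hθA⟩),
            Set.indicator_of_notMem (Set.notMem_compl_iff.2 (show θ ∈ {θ | c < q θ} from hD)), hshareE θ hθA hD]
          simp only [hX']
          rw [if_neg hθA, if_pos hD, add_zero, zero_add]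
        · have e : share φ' i θ = share φ i θ := by
            have : φ' θ = φ θ := by simp only [hφ']; rw [if_neg hθA, if_neg hD]
            unfold share; rw [this]
          rw [Set.indicator_of_notMem hθA, Set.indicator_of_notMem (fun hx => hD hx.1),
            Set.indicator_of_mem (show θ ∈ {θ | c < q θ}ᶜ from hD), e]
          simp only [hX']
          rw [if_neg hθA, if_neg hD, zero_add, zero_add]
    have hold : ∀ θ, share φ i θ • X i θ = g i θ • X i θ + l i θ • X i θ +
          {θ | c < q θ}ᶜ.indicator (fun θ => share φ i θ • X i θ) θ := by
      intro θ
      rw [← add_smul, hsplit]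
      by_cases hD : c < q θ
      · rw [if_pos hD, Set.indicator_of_notMem (Set.notMem_compl_iff.2 (show θ ∈ {θ | c < q θ} from hD)), add_zero]
      · rw [if_neg hD, Set.indicator_of_mem (show θ ∈ {θ | c < q θ}ᶜ from hD), zero_smul,
          zero_add]
    have hgi : Integrable (fun θ => g i θ • X i θ) μ :=
      integrable_smul_of_mem_Icc (hgm i) (hg01 i) (hp.stronglyMeasurable i) (hXR i)
    have hlX : Integrable (fun θ => l i θ • X i θ) μ :=
      integrable_smul_of_mem_Icc (hlm i) (hl01 i) (hp.stronglyMeasurable i) (hXR i)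
    have hsX : Integrable (fun θ => share φ i θ • X i θ) μ :=
      integrable_smul_of_mem_Icc (hsm i) (fun θ => ⟨hs0 i θ, hs1 i θ⟩) (hp.stronglyMeasurable i)
        (hXR i)
    have hratio : ∀ θ, g i θ / h θ ∈ Set.Icc (0 : ℝ) 1 := fun θ => by
      refine ⟨div_nonneg (hg0 _ _) (hh01 _).1, div_le_one_of_le₀ ?_ (hh01 _).1⟩
      fin_cases i
      · exact le_add_of_nonneg_right (hg0 _ _)
      · exact le_add_of_nonneg_left (hg0 _ _)
    have hrX : StronglyMeasurable fun θ => (g i θ / h θ) • X i θ :=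
      ((hgm i).div hhm).stronglyMeasurable.smul (hp.stronglyMeasurable i)
    have hA_int : Integrable (A.indicator fun θ => (g i (T θ) / h (T θ)) • X i (T θ)) μ := by
      rw [integrable_indicator_iff hAm]
      refine Integrable.of_bound (hrX.comp_measurable hTm).aestronglyMeasurable R ?_
      rw [ae_restrict_iff' hAm]
      filter_upwards [hpull (hac' (hXR i))] with θ h1 h2
      exact norm_smul_le_of_mem (hratio _).1 (hratio _).2 (h1 h2)
    -- Change of variables along T turns μ on A into the measure with density h, and h cancels the
    -- denominator of the share.
    have hA_eq : ∫ θ, A.indicator (fun θ => (g i (T θ) / h (T θ)) • X i (T θ)) θ ∂μ =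
        ∫ θ, g i θ • X i θ ∂μ := by
      rw [integral_indicator hAm, ← integral_map (μ := μ.restrict A) hTm.aemeasurable
        hrX.aestronglyMeasurable, hTmap, integral_weighted hhm hh01]
      refine integral_congr_ae (ae_of_all _ fun θ => ?_)
      change h θ • (g i θ / h θ) • X i θ = g i θ • X i θ
      rw [smul_smul]
      by_cases hz : h θ = 0
      · have hgz : g i θ = 0 := by
          have := hg0 0 θ
          have := hg0 1 θ
          have hz' : g 0 θ + g 1 θ = 0 := hz
          fin_cases i
          · change g 0 θ = 0; linarith
          · change g 1 θ = 0; linarith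
        rw [hz, hgz, zero_mul]
      · rw [mul_div_cancel₀ _ hz]
    have hE_eq : ∫ θ, E.indicator (fun _ => (m i / (m 0 + m 1)) • xbar i) θ ∂μ =
        ∫ θ, l i θ • X i θ ∂μ := by
      rw [integral_indicator_const _ hEm, hμE, smul_smul, mul_div_cancel₀ _ hmL.ne']
      simp only [hxbar]
      by_cases hz : m i = 0
      · rw [hz, zero_smul]
        have hl_ae : l i =ᵐ[μ] 0 := (integral_eq_zero_iff_of_nonneg (hl0 i) (hli i)).1 hz
        symm
        refine (integral_congr_ae ?_).trans (integral_zero ℝ (L2 P))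
        filter_upwards [hl_ae] with θ hθ
        rw [hθ, Pi.zero_apply, zero_smul]
      · rw [smul_smul, mul_inv_cancel₀ hz, one_smul]
    have hE_int : Integrable (E.indicator fun _ => (m i / (m 0 + m 1)) • xbar i) μ :=
      (integrable_const _).indicator hEm
    rw [integral_congr_ae hnew, integral_congr_ae (ae_of_all _ hold),
      integral_add_add hA_int hE_int (hsX.indicator hDm.compl), hA_eq, hE_eq,
      integral_add_add hgi hlX (hsX.indicator hDm.compl)]
  · refine planCost_lt ha hμ hp.antitone hp.nonneg hp.le_bound hplan.antitone hplan.nonneg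
      hplan.le_bound hq'le ?_
    intro hz
    have hsub : {θ | c < q θ} \ A ⊆ {θ | q' θ < q θ} := by
      rintro θ ⟨hD, hθ⟩
      have hD : c < q θ := hD
      change q' θ < q θ
      simp only [hq']
      rw [if_neg hθ, min_eq_right hD.le]
      exact hD
    have := measure_mono_null hsub hz
    rw [← measureReal_eq_zero_iff, measureReal_sdiff hAD hAm, hμD, hμA] at this
    linarith

/-- A plan is optimal if it minimizes aggregate risk. -/
def IsOptimalPlan (μ : Measure ℝ) (𝒳 : Fin 2 → Set (L2 P)) (ρ : Fin 2 → L2 P → EReal)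
    (W : Fin 2 → L2 P) (B : ℝ) (q φ : ℝ → ℝ) (X : Fin 2 → ℝ → L2 P) : Prop :=
  IsPlan μ 𝒳 B q φ X ∧ ∀ q' φ' X', IsPlan μ 𝒳 B q' φ' X' →
    planRisk μ ρ W φ X + (planCost μ q : EReal) ≤ planRisk μ ρ W φ' X' + (planCost μ q' : EReal)

theorem planRisk_congr {ρ : Fin 2 → L2 P → EReal} {W : Fin 2 → L2 P} {φ φ' : ℝ → ℝ}
    {X X' : Fin 2 → ℝ → L2 P}
    (h : ∀ i, ∫ θ, share φ' i θ • X' i θ ∂μ = ∫ θ, share φ i θ • X i θ ∂μ) :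
    planRisk μ ρ W φ' X' = planRisk μ ρ W φ X := by
  simp only [planRisk, planPosition, h]

/-- The variance constraint binds in optimal plans. -/
theorem IsOptimalPlan.var_eq {𝒳 : Fin 2 → Set (L2 P)} {ρ : Fin 2 → L2 P → EReal}
    {W : Fin 2 → L2 P} {B : ℝ} {q φ : ℝ → ℝ} {X : Fin 2 → ℝ → L2 P}
    (hp : IsOptimalPlan μ 𝒳 ρ W B q φ X) {a : ℝ} (ha : 0 < a)
    (hμ : μ (Set.Icc a 1)ᶜ = 0) (hac : μ ≪ volume)
    (hcl : ∀ i, IsClosed (𝒳 i)) (hcv : ∀ i, Convex ℝ (𝒳 i)) (h0 : ∀ i, (0 : L2 P) ∈ 𝒳 i) {R : ℝ}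
    (hR : ∀ i, ∀ x ∈ 𝒳 i, ‖x‖ ≤ R) (hbot : planRisk μ ρ W φ X ≠ ⊥)
    (htop : planRisk μ ρ W φ X ≠ ⊤) (i : Fin 2) :
    ∀ᵐ θ ∂μ, share φ i θ ≠ 0 → var (X i θ) = q θ := by
  -- Rational levels suffice to detect var < q, so countably many null sets cover the slack types.
  have hall : ∀ r : ℚ, μ {θ | share φ i θ ≠ 0 ∧ var (X i θ) < r ∧ r < q θ} = 0 := by
    intro r
    by_contra hne
    obtain ⟨q', φ', X', hp', hint, hlt⟩ :=
      hp.1.exists_improvement ha hμ hac hcl hcv h0 hR hne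
    have := hp.2 q' φ' X' hp'
    rw [planRisk_congr hint] at this
    lift planRisk μ ρ W φ X to ℝ using ⟨htop, hbot⟩ with t
    have h2 : t + planCost μ q ≤ t + planCost μ q' := by exact_mod_cast this
    linarith
  filter_upwards [hp.1.var_le i, ae_all_iff.2 fun r => measure_eq_zero_iff_ae_notMem.1 (hall r)]
    with θ h1 h2 h3
  by_contra hne
  obtain ⟨r, hr1, hr2⟩ := exists_rat_btwn (lt_of_le_of_ne h1 hne)
  exact h2 r ⟨h3, hr1, hr2⟩

end Tightness

/-! ### Averaging the products sold on a set of types -/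

section Endpoint

variable {Ω : Type*} [MeasurableSpace Ω] {P : Measure Ω} [IsProbabilityMeasure P]
  {μ : Measure ℝ} [IsFiniteMeasure μ]

theorem exists_subset_measureReal_eq [NullSingletonClass μ] {E : Set ℝ} (hE : MeasurableSet E)
    {y : ℝ} (h0 : 0 ≤ y) (hy : y ≤ μ.real E) : ∃ A ⊆ E, MeasurableSet A ∧ μ.real A = y := by
  have h1 : y ≤ (μ.restrict E).real Set.univ := by
    rwa [measureReal_restrict_apply_univ]
  have hm : MeasurableSet {θ | (μ.restrict E).real (Set.Iic θ) < y} :=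
    measurableSet_lt measurable_measureReal_Iic measurable_const
  refine ⟨{θ | (μ.restrict E).real (Set.Iic θ) < y} ∩ E, Set.inter_subset_right, hm.inter hE, ?_⟩
  rw [← measureReal_restrict_apply hm]
  exact measureReal_level_lt h0 h1

/-- With equal masses, the average over the union of two disjoint sets is the midpoint of the two
averages, as the parallelogram law requires. -/
theorem exists_equal_mass [NullSingletonClass μ] {E E' : Set ℝ} (hE : MeasurableSet E)
    (hE' : MeasurableSet E') (h : 0 < μ.real E) (h' : 0 < μ.real E') :
    ∃ A ⊆ E, ∃ A' ⊆ E', MeasurableSet A ∧ MeasurableSet A' ∧ 0 < μ.real A ∧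
      μ.real A' = μ.real A := by
  obtain ⟨A, hA, hAm, hAe⟩ := exists_subset_measureReal_eq hE (le_min h.le h'.le) (min_le_left _ _)
  obtain ⟨A', hA', hAm', hAe'⟩ :=
    exists_subset_measureReal_eq hE' (le_min h.le h'.le) (min_le_right _ _)
  exact ⟨A, hA, A', hA', hAm, hAm', by rw [hAe]; exact lt_min h h', by rw [hAe, hAe']⟩

theorem indicator_mem_Icc {w : ℝ → ℝ} (h01 : ∀ θ, w θ ∈ Set.Icc (0 : ℝ) 1) (A : Set ℝ) (θ : ℝ) :
    A.indicator w θ ∈ Set.Icc (0 : ℝ) 1 := by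
  classical
  rw [Set.indicator_apply]
  split_ifs
  · exact h01 θ
  · simp

theorem weighted_real_apply {w : ℝ → ℝ} (hw : Measurable w)
    (h01 : ∀ θ, w θ ∈ Set.Icc (0 : ℝ) 1) {A : Set ℝ} (hA : MeasurableSet A) :
    (weighted μ w).real A = ∫ θ, A.indicator w θ ∂μ := by
  have := isFiniteMeasure_weighted (μ := μ) h01
  have h := integral_weighted (μ := μ) hw h01 (A.indicator fun _ => (1 : ℝ))
  rw [integral_indicator_const _ hA] at h
  rw [smul_eq_mul, mul_one] at h
  rw [h]
  refine integral_congr_ae (ae_of_all _ fun θ => ?_)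
  classical
  simp [Set.indicator_apply]

/-- Averaging products over a set of types preserves the position of the firm; in optimal plans the
variance of the average must exceed the lower bounds of `q` on this set. -/
theorem IsOptimalPlan.le_var_average {𝒳 : Fin 2 → Set (L2 P)} {ρ : Fin 2 → L2 P → EReal}
    {W : Fin 2 → L2 P} {B : ℝ} {q φ : ℝ → ℝ} {X : Fin 2 → ℝ → L2 P}
    (hp : IsOptimalPlan μ 𝒳 ρ W B q φ X) {a : ℝ} (ha : 0 < a)
    (hμ : μ (Set.Icc a 1)ᶜ = 0) (hac : μ ≪ volume)
    (hcl : ∀ i, IsClosed (𝒳 i)) (hcv : ∀ i, Convex ℝ (𝒳 i)) (h0 : ∀ i, (0 : L2 P) ∈ 𝒳 i) {R : ℝ}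
    (hR : ∀ i, ∀ x ∈ 𝒳 i, ‖x‖ ≤ R) (hbot : planRisk μ ρ W φ X ≠ ⊥)
    (htop : planRisk μ ρ W φ X ≠ ⊤) (i : Fin 2) {S : Set ℝ} (hS : MeasurableSet S) {c : ℝ}
    (hc : ∀ θ ∈ S, c < q θ) (hpos : ∫ θ, S.indicator (share φ i) θ ∂μ ≠ 0) :
    c ≤ var ((∫ θ, S.indicator (share φ i) θ ∂μ)⁻¹ •
      ∫ θ, S.indicator (share φ i) θ • X i θ ∂μ) := by
  classical
  have hsm : Measurable (share φ i) := measurable_share hp.1.measurable i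
  have hs01 : ∀ θ, share φ i θ ∈ Set.Icc (0 : ℝ) 1 := fun θ =>
    ⟨share_nonneg (hp.1.share_mem θ) i, share_le_one (hp.1.share_mem θ) i⟩
  have hXR : ∀ᵐ θ ∂μ, ‖X i θ‖ ≤ R := (hp.1.mem i).mono fun θ h => hR i _ h
  set x : L2 P := (∫ θ, S.indicator (share φ i) θ ∂μ)⁻¹ •
      ∫ θ, S.indicator (share φ i) θ • X i θ ∂μ with hx
  have hmem : x ∈ 𝒳 i := weighted_average_mem (hsm.indicator hS) (indicator_mem_Icc hs01 S) hpos
    (hp.1.stronglyMeasurable i) hXR (hcv i) (hcl i) ((hp.1.mem i).mono fun θ h _ => h)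
  by_contra! hlt
  -- If the average had variance below c, selling it on S would respect the bound q there and change
  -- neither risk nor cost. The new plan would again be optimal, yet slack on S, contradicting
  -- `IsOptimalPlan.var_eq`.
  set X' : Fin 2 → ℝ → L2 P := fun j θ => if j = i then (if θ ∈ S then x else X j θ) else X j θ
    with hX'
  have hplan : IsPlan μ 𝒳 B q φ X' := by
    refine ⟨hp.1.antitone, hp.1.nonneg, hp.1.le_bound, hp.1.measurable, hp.1.share_mem,
      fun j => ?_, fun j => ?_, fun j => ?_⟩
    · by_cases hj : j = i
      · simp only [hX', hj, if_true]
        exact StronglyMeasurable.ite hS stronglyMeasurable_const (hp.1.stronglyMeasurable i)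
      · simp only [hX', hj, if_false]
        exact hp.1.stronglyMeasurable j
    · filter_upwards [hp.1.mem j] with θ h
      simp only [hX']
      split_ifs with h1 h2
      · rw [h1]; exact hmem
      · exact h
      · exact h
    · filter_upwards [hp.1.var_le j] with θ h
      simp only [hX']
      split_ifs with h1 h2
      · exact (hlt.trans (hc θ h2)).le
      · exact h
      · exact h
  have hSi : Integrable (fun θ => S.indicator (share φ i) θ • X i θ) μ :=
    integrable_smul_of_mem_Icc (hsm.indicator hS) (indicator_mem_Icc hs01 S)
      (hp.1.stronglyMeasurable i) hXR
  have hSci : Integrable (fun θ => Sᶜ.indicator (share φ i) θ • X i θ) μ :=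
    integrable_smul_of_mem_Icc (hsm.indicator hS.compl) (indicator_mem_Icc hs01 Sᶜ)
      (hp.1.stronglyMeasurable i) hXR
  have hint : ∀ j, ∫ θ, share φ j θ • X' j θ ∂μ = ∫ θ, share φ j θ • X j θ ∂μ := by
    intro j
    by_cases hj : j = i
    · subst hj
      have e1 : ∀ θ, share φ j θ • X' j θ =
          S.indicator (share φ j) θ • x + Sᶜ.indicator (share φ j) θ • X j θ := fun θ => by
        simp only [hX', if_true]
        by_cases hθ : θ ∈ S <;> simp [hθ]
      have e2 : ∀ θ, share φ j θ • X j θ =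
          S.indicator (share φ j) θ • X j θ + Sᶜ.indicator (share φ j) θ • X j θ := fun θ => by
        by_cases hθ : θ ∈ S <;> simp [hθ]
      have hwi : Integrable (S.indicator (share φ j)) μ :=
        integrable_of_mem_Icc (hsm.indicator hS) (indicator_mem_Icc hs01 S)
      rw [integral_congr_ae (ae_of_all _ e1), integral_congr_ae (ae_of_all _ e2),
        integral_add (hwi.smul_const x) hSci, integral_add hSi hSci, integral_smul_const, hx,
        smul_smul, mul_inv_cancel₀ hpos, one_smul]
    · simp only [hX', hj, if_false]
  have hrisk := planRisk_congr (ρ := ρ) (W := W) hint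
  have hopt : IsOptimalPlan μ 𝒳 ρ W B q φ X' :=
    ⟨hplan, fun q' φ' Y hY => by rw [hrisk]; exact hp.2 q' φ' Y hY⟩
  have htight := hopt.var_eq ha hμ hac hcl hcv h0 hR (by rwa [hrisk]) (by rwa [hrisk]) i
  refine hpos ((integral_congr_ae ?_).trans (integral_zero ℝ ℝ))
  filter_upwards [htight] with θ h
  by_cases hθ : θ ∈ S
  · rw [Set.indicator_of_mem hθ]
    by_contra hne
    have := h hne
    simp only [hX', if_true, hθ] at this
    exact absurd (hlt.trans (hc θ hθ)) (by rw [this]; exact lt_irrefl _)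
  · rw [Set.indicator_of_notMem hθ]

end Endpoint

/-! ### Attaining the largest variance sold by a firm -/

section EndpointProduct

variable {Ω : Type*} [MeasurableSpace Ω] {P : Measure Ω} [IsProbabilityMeasure P]
  {μ : Measure ℝ} [IsFiniteMeasure μ]

/-- A sequence with bounded norms whose centred variables form a Cauchy sequence has a convergent
subsequence. -/
theorem exists_subseq_tendsto_of_cauchySeq_centerL {x : ℕ → L2 P} {R : ℝ} (hR : ∀ n, ‖x n‖ ≤ R)
    (hx : CauchySeq fun n => centerL (x n)) :
    ∃ (σ : ℕ → ℕ) (x₀ : L2 P), StrictMono σ ∧ Tendsto (fun n => x (σ n)) atTop (𝓝 x₀) := by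
  obtain ⟨z, hz⟩ := cauchySeq_tendsto_of_complete hx
  have hmean : ∀ n, mean (x n) ∈ Set.Icc (-R) R := fun n => by
    rw [Set.mem_Icc, ← abs_le, mean_eq_inner]
    refine (abs_real_inner_le_norm _ _).trans ?_
    rw [norm_const_one, one_mul]
    exact hR n
  -- Centring loses only the mean, a bounded real number, so compactness of an interval recovers it.
  obtain ⟨t, -, σ, hσ, ht⟩ := isCompact_Icc.tendsto_subseq hmean
  refine ⟨σ, z + t • Lp.const (2 : ℝ≥0∞) P (1 : ℝ), hσ, ?_⟩
  have h1 := (hz.comp hσ.tendsto_atTop).add (ht.smul_const (Lp.const (2 : ℝ≥0∞) P (1 : ℝ)))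
  refine h1.congr fun n => ?_
  simp only [Function.comp_apply]
  rw [centerL_apply, centered_eq, sub_add_cancel]

/-- The range of a strongly measurable map is separable, so countably many δ-balls cover it and one
of them has a preimage of positive mass in N. -/
theorem exists_ball_preimage {X : ℝ → L2 P} (hX : StronglyMeasurable X) {N : Set ℝ}
    (hN : μ N ≠ 0) {δ : ℝ} (hδ : 0 < δ) :
    ∃ x₀ : L2 P, μ (N ∩ {θ | dist (X θ) x₀ < δ}) ≠ 0 := by
  obtain ⟨c, hc, hcX⟩ := hX.isSeparable_range
  by_contra! hall
  refine hN (measure_mono_null (t := ⋃ x ∈ c, N ∩ {θ | dist (X θ) x < δ}) (fun θ hθ => ?_)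
    ((measure_biUnion_null_iff hc).2 fun x _ => hall x))
  obtain ⟨x, hx, hd⟩ := Metric.mem_closure_iff.1 (hcX ⟨θ, rfl⟩) δ hδ
  exact Set.mem_biUnion hx ⟨hθ, hd⟩

theorem norm_sq_centerL_sub (x y : L2 P) :
    ‖centerL (x - y)‖ ^ 2 = 2 * var x + 2 * var y - 4 * var ((2⁻¹ : ℝ) • (x + y)) := by
  have h := parallelogram_law_with_norm ℝ (centerL x) (centerL y)
  rw [var_smul, var_eq_norm_sq, var_eq_norm_sq, var_eq_norm_sq, map_add, map_sub]
  nlinarith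

theorem cauchySeq_of_norm_sub_le {E : Type*} [NormedAddCommGroup E] {u : ℕ → E} {b : ℕ → ℝ}
    (hb : Tendsto b atTop (𝓝 0)) (h : ∀ n m, n ≤ m → ‖u n - u m‖ ≤ b n) : CauchySeq u :=
  cauchySeq_of_le_tendsto_0' b (fun n m hnm => by rw [dist_eq_norm]; exact h n m hnm) hb

/-- In optimal plans, the products with variance close to the supremum that are sold by a firm
converge: the supremum is attained in the feasible set. -/
theorem IsOptimalPlan.exists_var_ge {𝒳 : Fin 2 → Set (L2 P)} {ρ : Fin 2 → L2 P → EReal}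
    {W : Fin 2 → L2 P} {B : ℝ} {q φ : ℝ → ℝ} {X : Fin 2 → ℝ → L2 P}
    (hp : IsOptimalPlan μ 𝒳 ρ W B q φ X) {a : ℝ} (ha : 0 < a)
    (hμ : μ (Set.Icc a 1)ᶜ = 0) (hac : μ ≪ volume)
    (hcl : ∀ i, IsClosed (𝒳 i)) (hcv : ∀ i, Convex ℝ (𝒳 i)) (h0 : ∀ i, (0 : L2 P) ∈ 𝒳 i) {R : ℝ}
    (hR : ∀ i, ∀ x ∈ 𝒳 i, ‖x‖ ≤ R) (hbot : planRisk μ ρ W φ X ≠ ⊥)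
    (htop : planRisk μ ρ W φ X ≠ ⊤) (i : Fin 2) :
    ∃ x ∈ 𝒳 i, ∀ᵐ θ ∂μ, share φ i θ ≠ 0 → q θ ≤ var x := by
  have hna : NullSingletonClass μ := ⟨fun x => hac (measure_singleton x)⟩
  have hsm : Measurable (share φ i) := measurable_share hp.1.measurable i
  have hs01 : ∀ θ, share φ i θ ∈ Set.Icc (0 : ℝ) 1 := fun θ =>
    ⟨share_nonneg (hp.1.share_mem θ) i, share_le_one (hp.1.share_mem θ) i⟩
  have hXm := hp.1.stronglyMeasurable i
  have hXR : ∀ᵐ θ ∂μ, ‖X i θ‖ ≤ R := (hp.1.mem i).mono fun θ h => hR i _ h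
  have hqm : Measurable q := hp.1.antitone.measurable
  have htight := hp.var_eq ha hμ hac hcl hcv h0 hR hbot htop i
  set ν := weighted μ (share φ i) with hν
  have hνμ : ν ≤ μ := weighted_le hs01
  have hνfin : IsFiniteMeasure ν := isFiniteMeasure_weighted hs01
  have hνna : NullSingletonClass ν :=
    ⟨fun x => le_antisymm ((hνμ _).trans (measure_singleton (μ := μ) x).le) bot_le⟩
  have hνae : ∀ {p : ℝ → Prop}, (∀ᵐ θ ∂ν, p θ) ↔ ∀ᵐ θ ∂μ, share φ i θ ≠ 0 → p θ :=
    ae_weighted_iff hsm hs01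
  by_cases hν0 : ν = 0
  · refine ⟨0, h0 i, hνae.1 ?_⟩
    rw [hν0]; simp
  have hne : NeBot (ae ν) := ae_neBot.2 hν0
  have hqb : IsBoundedUnder (· ≤ ·) (ae ν) q := isBoundedUnder_of ⟨B, hp.1.le_bound⟩
  have hqc : IsCoboundedUnder (· ≤ ·) (ae ν) q :=
    (isBoundedUnder_of ⟨0, hp.1.nonneg⟩ : IsBoundedUnder (· ≥ ·) (ae ν) q).isCoboundedUnder_le
  -- The supremum is taken only over types served by firm i. Around it, each E k has positive mass
  -- and carries products of firm i that are within 2 δ k of a single feasible x k.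
  set Q : ℝ := essSup q ν with hQ
  have hqQ : ∀ᵐ θ ∂ν, q θ ≤ Q := ae_le_essSup hqb
  have hlow : ∀ r < Q, ν {θ | r < q θ} ≠ 0 := by
    intro r hr hz
    refine absurd (essSup_le_of_ae_le (μ := ν) (f := q) r ?_ hqc) (not_le.2 hr)
    filter_upwards [measure_eq_zero_iff_ae_notMem.1 hz] with θ hθ
    exact not_lt.1 hθ
  have hνX : ∀ᵐ θ ∂ν, X i θ ∈ 𝒳 i := hνae.2 ((hp.1.mem i).mono fun θ h _ => h)
  have hνt : ∀ᵐ θ ∂ν, var (X i θ) = q θ := hνae.2 htight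
  set δ : ℕ → ℝ := fun k => 1 / ((k : ℝ) + 1) with hδ
  have hδ0 : ∀ k, 0 < δ k := fun k => by positivity
  have hδlim : Tendsto δ atTop (𝓝 0) := tendsto_one_div_add_atTop_nhds_zero_nat
  have hδanti : ∀ k j, k ≤ j → δ j ≤ δ k := fun k j h =>
    one_div_le_one_div_of_le (by positivity) (by exact_mod_cast Nat.succ_le_succ h)
  have hex : ∀ k, ∃ (E : Set ℝ) (x : L2 P), MeasurableSet E ∧ 0 < ν.real E ∧
      (∀ θ ∈ E, Q - δ k < q θ) ∧ (∀ θ ∈ E, ‖X i θ - x‖ ≤ 2 * δ k) ∧ x ∈ 𝒳 i ∧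
      Q - δ k < var x ∧ var x ≤ Q := by
    intro k
    have h1 := hlow (Q - δ k) (by linarith [hδ0 k])
    obtain ⟨x₀, hx₀⟩ := exists_ball_preimage hXm h1 (hδ0 k)
    have hfreq : ∃ᵐ θ ∂ν, θ ∈ {θ | Q - δ k < q θ} ∩ {θ | dist (X i θ) x₀ < δ k} :=
      frequently_ae_mem_iff.2 hx₀
    obtain ⟨θ, hθ, h2, h3, h4⟩ := (hfreq.and_eventually (hνX.and (hνt.and hqQ))).exists
    refine ⟨_, X i θ, (measurableSet_lt measurable_const hqm).inter
      (measurableSet_lt (hXm.dist stronglyMeasurable_const).measurable measurable_const),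
      ENNReal.toReal_pos hx₀ (measure_ne_top _ _), fun η hη => hη.1, fun η hη => ?_, h2, ?_, ?_⟩
    · rw [← dist_eq_norm]
      have e1 : dist (X i η) x₀ < δ k := hη.2
      have e2 : dist (X i θ) x₀ < δ k := hθ.2
      linarith [dist_triangle_right (X i η) (X i θ) x₀]
    · rw [h3]; exact hθ.1
    · rw [h3]; exact h4
  choose E x hEm hEpos hEq hEx hxmem hxlow hxQ using hex
  have havg : ∀ k, ∀ A ⊆ E k, MeasurableSet A → 0 < ν.real A →
      ‖(∫ θ, A.indicator (share φ i) θ ∂μ)⁻¹ •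
        ∫ θ, A.indicator (share φ i) θ • X i θ ∂μ - x k‖ ≤ 2 * δ k ∧
      var ((∫ θ, A.indicator (share φ i) θ ∂μ)⁻¹ •
        ∫ θ, A.indicator (share φ i) θ • X i θ ∂μ) ≤ Q := by
    intro k A hA hAm hApos
    rw [hν, weighted_real_apply hsm hs01 hAm] at hApos
    have hK := weighted_average_mem (hsm.indicator hAm) (indicator_mem_Icc hs01 A) hApos.ne' hXm hXR
      (K := Metric.closedBall (x k) (2 * δ k) ∩ {y | var y ≤ Q})
      ((convex_closedBall _ _).inter (convex_var_le Q))
      (Metric.isClosed_closedBall.inter (isClosed_var_le Q)) (by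
        filter_upwards [hνae.1 hνt, hνae.1 hqQ] with θ h1 h2 h3
        have hθA : θ ∈ A := by
          by_contra hn; exact h3 (Set.indicator_of_notMem hn _)
        rw [Set.indicator_of_mem hθA] at h3
        refine ⟨?_, ?_⟩
        · rw [Metric.mem_closedBall, dist_eq_norm]; exact hEx k θ (hA hθA)
        · change var (X i θ) ≤ Q
          rw [h1 h3]; exact h2 h3)
    refine ⟨?_, hK.2⟩
    rw [← dist_eq_norm]; exact hK.1
  have hcauchy : ∀ k j, k ≤ j →
      ‖centerL (x k) - centerL (x j)‖ ≤ 4 * δ k + √(4 * δ k) := by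
    intro k j hkj
    have hδkj := hδanti k j hkj
    rw [← map_sub]
    -- For disjoint sets, averages y and z over equal masses have variance at most Q, while their
    -- midpoint has variance at least Q - δ k by optimality. The parallelogram law gives ‖centerL (y
    -- - z)‖² ≤ 4 δ k.
    by_cases hdisj : Disjoint (E k) (E j)
    · obtain ⟨A, hA, A', hA', hAm, hAm', hApos, hAA'⟩ :=
        exists_equal_mass (hEm k) (hEm j) (hEpos k) (hEpos j)
      have hApos' : 0 < ν.real A' := by rw [hAA']; exact hApos
      obtain ⟨hy1, hy2⟩ := havg k A hA hAm hApos
      obtain ⟨hz1, hz2⟩ := havg j A' hA' hAm' hApos'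
      have hmA : ν.real A = ∫ θ, A.indicator (share φ i) θ ∂μ := weighted_real_apply hsm hs01 hAm
      have hmA' : ν.real A' = ∫ θ, A'.indicator (share φ i) θ ∂μ :=
        weighted_real_apply hsm hs01 hAm'
      set y := (∫ θ, A.indicator (share φ i) θ ∂μ)⁻¹ •
        ∫ θ, A.indicator (share φ i) θ • X i θ ∂μ with hy
      set z := (∫ θ, A'.indicator (share φ i) θ ∂μ)⁻¹ •
        ∫ θ, A'.indicator (share φ i) θ • X i θ ∂μ with hz
      have hdAA' : Disjoint A A' := hdisj.mono hA hA'
      have hind : (A ∪ A').indicator (share φ i) =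
          fun θ => A.indicator (share φ i) θ + A'.indicator (share φ i) θ :=
        Set.indicator_union_of_disjoint hdAA' _
      have hiA : ∀ S, MeasurableSet S → Integrable (S.indicator (share φ i)) μ := fun S hS =>
        integrable_of_mem_Icc (hsm.indicator hS) (indicator_mem_Icc hs01 S)
      have hiAX : ∀ S, MeasurableSet S →
          Integrable (fun θ => S.indicator (share φ i) θ • X i θ) μ := fun S hS =>
        integrable_smul_of_mem_Icc (hsm.indicator hS) (indicator_mem_Icc hs01 S) hXm hXR
      have hI1 : ∫ θ, (A ∪ A').indicator (share φ i) θ ∂μ = 2 * ν.real A := by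
        rw [hind, integral_add (hiA A hAm) (hiA A' hAm'), ← hmA, ← hmA', hAA']; ring
      have hI2 : ∫ θ, (A ∪ A').indicator (share φ i) θ • X i θ ∂μ =
          ∫ θ, A.indicator (share φ i) θ • X i θ ∂μ +
            ∫ θ, A'.indicator (share φ i) θ • X i θ ∂μ := by
        rw [← integral_add (hiAX A hAm) (hiAX A' hAm'), hind]
        simp only [add_smul]
      have hmid : Q - δ k ≤ var ((2⁻¹ : ℝ) • (y + z)) := by
        have h := hp.le_var_average ha hμ hac hcl hcv h0 hR hbot htop i (hAm.union hAm')
          (c := Q - δ k) (fun θ hθ => ?_) (by rw [hI1]; positivity)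
        · rw [hI1, hI2] at h
          rw [hy, hz, ← hmA, ← hmA', hAA', ← smul_add, smul_smul, ← mul_inv]
          exact h
        · rcases hθ with h | h
          · exact hEq k θ (hA h)
          · linarith [hEq j θ (hA' h)]
      have hsq : ‖centerL (y - z)‖ ^ 2 ≤ 4 * δ k := by
        rw [norm_sq_centerL_sub]; linarith
      have h1 : ‖centerL (y - z)‖ ≤ √(4 * δ k) := Real.le_sqrt_of_sq_le hsq
      have h2 := norm_centerL_le (y - x k)
      have h3 := norm_centerL_le (z - x j)
      have e : centerL (x k - x j) =
          centerL (y - z) - centerL (y - x k) + centerL (z - x j) := by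
        simp only [map_sub]; abel
      rw [e]
      have h4 := norm_add_le (centerL (y - z) - centerL (y - x k)) (centerL (z - x j))
      have h5 := norm_sub_le (centerL (y - z)) (centerL (y - x k))
      linarith
    -- A common type links x k and x j directly through its own product.
    · obtain ⟨θ, hθk, hθj⟩ := Set.not_disjoint_iff.1 hdisj
      have h1 := hEx k θ hθk
      have h2 := hEx j θ hθj
      have h3 := norm_centerL_le (x k - x j)
      have h4 := norm_sub_le (X i θ - x j) (X i θ - x k)
      have e : X i θ - x j - (X i θ - x k) = x k - x j := by abel
      rw [e] at h4
      have h5 := Real.sqrt_nonneg (4 * δ k)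
      linarith
  have hblim : Tendsto (fun k => 4 * δ k + √(4 * δ k)) atTop (𝓝 0) := by
    have h1 : Tendsto (fun k => 4 * δ k) atTop (𝓝 0) := by simpa using hδlim.const_mul 4
    simpa using h1.add h1.sqrt
  obtain ⟨σ, x₀, hσ, hlim⟩ := exists_subseq_tendsto_of_cauchySeq_centerL
    (fun k => hR i _ (hxmem k)) (cauchySeq_of_norm_sub_le hblim hcauchy)
  refine ⟨x₀, (hcl i).mem_of_tendsto hlim (Eventually.of_forall fun n => hxmem _), ?_⟩
  have hvar : Q ≤ var x₀ := by
    have h1 : Tendsto (fun n => Q - δ (σ n)) atTop (𝓝 (Q - 0)) :=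
      tendsto_const_nhds.sub (hδlim.comp hσ.tendsto_atTop)
    rw [sub_zero] at h1
    exact le_of_tendsto_of_tendsto' h1 ((continuous_var.tendsto x₀).comp hlim)
      fun n => (hxlow _).le
  exact hνae.1 (hqQ.mono fun θ h => h.trans hvar)

end EndpointProduct

/-! ### Admissible catalogues in terms of effective shares -/

section Admissible

variable {Ω : Type*} [MeasurableSpace Ω] {P : Measure Ω} [IsProbabilityMeasure P]
  {μ : Measure ℝ} [IsFiniteMeasure μ] {a : ℝ}

theorem IsAdmissible.indirectUtility_eq {𝒳 : Set (L2 P)} {C : Catalogue P}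
    (h : IsAdmissible a μ 𝒳 C) {θ : ℝ} (hθ : θ ∈ Set.Icc a 1) :
    indirectUtility a C θ = utility θ (C.product θ) - C.price θ := by
  have hne : Nonempty (Set.Icc a 1) := ⟨⟨θ, hθ⟩⟩
  refine le_antisymm (ciSup_le fun t => h.incentive_compatible θ hθ t t.2) ?_
  exact le_ciSup (f := fun t : Set.Icc a 1 => utility θ (C.product t) - C.price t)
    ⟨utility θ (C.product θ) - C.price θ, by
      rintro _ ⟨t, rfl⟩; exact h.incentive_compatible θ hθ t t.2⟩ ⟨θ, hθ⟩

theorem IsAdmissible.indirectUtility_nonneg {𝒳 : Set (L2 P)} {C : Catalogue P}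
    (h : IsAdmissible a μ 𝒳 C) {θ : ℝ} (hθ : θ ∈ Set.Icc a 1) : 0 ≤ indirectUtility a C θ := by
  rw [h.indirectUtility_eq hθ]; exact h.individually_rational θ hθ

/-- The tangent line inequality for the indirect utility. -/
theorem IsAdmissible.tangent_le {𝒳 : Set (L2 P)} {C : Catalogue P}
    (h : IsAdmissible a μ 𝒳 C) {θ t : ℝ} (hθ : θ ∈ Set.Icc a 1) (ht : t ∈ Set.Icc a 1) :
    indirectUtility a C t + (t - θ) * var (C.product t) ≤ indirectUtility a C θ := by
  rw [h.indirectUtility_eq hθ, h.indirectUtility_eq ht]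
  have := h.incentive_compatible θ hθ t ht
  unfold utility at this ⊢
  linarith

theorem IsAdmissible.antitoneOn {𝒳 : Set (L2 P)} {C : Catalogue P}
    (h : IsAdmissible a μ 𝒳 C) : AntitoneOn (indirectUtility a C) (Set.Icc a 1) := by
  intro t ht θ hθ htθ
  have := h.tangent_le ht hθ
  nlinarith [mul_nonneg (sub_nonneg.2 htθ) (var_nonneg (C.product θ))]

/-- Projection to the set of types. -/
def clamp (a θ : ℝ) : ℝ := max a (min θ 1)

theorem clamp_mem (ha1 : a ≤ 1) (θ : ℝ) : clamp a θ ∈ Set.Icc a 1 :=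
  ⟨le_max_left _ _, max_le ha1 (min_le_right _ _)⟩

theorem clamp_eq {θ : ℝ} (hθ : θ ∈ Set.Icc a 1) : clamp a θ = θ := by
  rw [clamp, min_eq_left hθ.2, max_eq_right hθ.1]

theorem monotone_clamp : Monotone (clamp a) := fun _ _ h =>
  max_le_max le_rfl (min_le_min_right _ h)

theorem antitone_comp_clamp (ha1 : a ≤ 1) {f : ℝ → ℝ} (hf : AntitoneOn f (Set.Icc a 1)) :
    Antitone fun θ => f (clamp a θ) := fun _ _ h =>
  hf (clamp_mem ha1 _) (clamp_mem ha1 _) (monotone_clamp h)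

/-- Indirect utilities are known to be monotone only on [a, 1]; composing with `clamp` makes them
monotone, hence measurable, on the whole line. -/
theorem measurableSet_segment (ha1 : a ≤ 1) {𝒳 : Fin 2 → Set (L2 P)} {C : Fin 2 → Catalogue P}
    (h : ∀ i, IsAdmissible a μ (𝒳 i) (C i)) (i : Fin 2) : MeasurableSet (segment a C i) := by
  have : segment a C i = Set.Icc a 1 ∩ {θ | indirectUtility a (C i.rev) (clamp a θ) <
      indirectUtility a (C i) (clamp a θ)} := by
    ext θ
    refine and_congr_right fun hθ => ?_
    rw [Set.mem_ofPred_eq, clamp_eq hθ]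
  rw [this]
  exact measurableSet_Icc.inter (measurableSet_lt
    (antitone_comp_clamp ha1 (h _).antitoneOn).measurable
    (antitone_comp_clamp ha1 (h _).antitoneOn).measurable)

theorem measurableSet_tieSet (ha1 : a ≤ 1) {𝒳 : Fin 2 → Set (L2 P)} {C : Fin 2 → Catalogue P}
    (h : ∀ i, IsAdmissible a μ (𝒳 i) (C i)) : MeasurableSet (tieSet a C) := by
  have : tieSet a C = Set.Icc a 1 ∩ {θ | indirectUtility a (C 0) (clamp a θ) =
      indirectUtility a (C 1) (clamp a θ)} := by
    ext θ
    refine and_congr_right fun hθ => ?_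
    rw [Set.mem_ofPred_eq, clamp_eq hθ]
  rw [this]
  exact measurableSet_Icc.inter (measurableSet_eq_fun
    (antitone_comp_clamp ha1 (h _).antitoneOn).measurable
    (antitone_comp_clamp ha1 (h _).antitoneOn).measurable)

open scoped Classical in
/-- The proportion of agents of each type that contract with the first firm. -/
def effShare (a : ℝ) (C : Fin 2 → Catalogue P) (f : ℝ → ℝ) (θ : ℝ) : ℝ :=
  if θ ∈ segment a C 0 then 1 else if θ ∈ tieSet a C then f θ else 0

theorem trichotomy (C : Fin 2 → Catalogue P) {θ : ℝ} (hθ : θ ∈ Set.Icc a 1) :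
    θ ∈ segment a C 0 ∨ θ ∈ segment a C 1 ∨ θ ∈ tieSet a C := by
  rcases lt_trichotomy (indirectUtility a (C 1) θ) (indirectUtility a (C 0) θ) with h | h | h
  · exact Or.inl ⟨hθ, h⟩
  · exact Or.inr (Or.inr ⟨hθ, h.symm⟩)
  · exact Or.inr (Or.inl ⟨hθ, h⟩)

theorem segment_rev_notMem {C : Fin 2 → Catalogue P} {θ : ℝ} {i : Fin 2}
    (h : θ ∈ segment a C i) : θ ∉ segment a C i.rev := by
  intro h'
  have h1 := h.2
  have h2 := h'.2
  rw [Fin.rev_rev] at h2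
  exact lt_asymm h1 h2

theorem segment_notMem_tieSet {C : Fin 2 → Catalogue P} {θ : ℝ} {i : Fin 2}
    (h : θ ∈ segment a C i) : θ ∉ tieSet a C := by
  intro h'
  have h1 := h.2
  have h2 := h'.2
  fin_cases i
  · exact h1.ne h2.symm
  · exact h1.ne h2

theorem share_effShare_of_segment {C : Fin 2 → Catalogue P} {f : ℝ → ℝ} {θ : ℝ} {i : Fin 2}
    (h : θ ∈ segment a C i) : share (effShare a C f) i θ = 1 := by
  obtain rfl | rfl : i = 0 ∨ i = 1 := by omega
  · exact if_pos h
  · have h1 := segment_rev_notMem h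
    rw [show Fin.rev (1 : Fin 2) = 0 from rfl] at h1
    have : effShare a C f θ = 0 := by
      rw [effShare, if_neg h1, if_neg (segment_notMem_tieSet h)]
    change 1 - effShare a C f θ = 1
    rw [this, sub_zero]

theorem share_effShare_of_segment_rev {C : Fin 2 → Catalogue P} {f : ℝ → ℝ} {θ : ℝ} {i : Fin 2}
    (h : θ ∈ segment a C i.rev) : share (effShare a C f) i θ = 0 := by
  have h1 : share (effShare a C f) i.rev θ = 1 := share_effShare_of_segment h
  have h2 := share_add (effShare a C f) θ
  revert h1
  fin_cases i
  · intro h1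
    have h1 : share (effShare a C f) 1 θ = 1 := h1
    change share (effShare a C f) 0 θ = 0
    linarith
  · intro h1
    have h1 : share (effShare a C f) 0 θ = 1 := h1
    change share (effShare a C f) 1 θ = 0
    linarith

theorem share_effShare_of_tieSet {C : Fin 2 → Catalogue P} {f : ℝ → ℝ} {θ : ℝ} (i : Fin 2)
    (h : θ ∈ tieSet a C) : share (effShare a C f) i θ = share f i θ := by
  have h1 : θ ∉ segment a C 0 := fun h' => segment_notMem_tieSet h' h
  have : effShare a C f θ = f θ := by rw [effShare, if_neg h1, if_pos h]
  unfold share; rw [this]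

theorem share_effShare_smul {E : Type*} [AddCommGroup E] [Module ℝ E] {C : Fin 2 → Catalogue P}
    {f : ℝ → ℝ} {θ : ℝ} (hθ : θ ∈ Set.Icc a 1) (i : Fin 2) (g : ℝ → E) :
    share (effShare a C f) i θ • g θ =
      (segment a C i).indicator g θ + (tieSet a C).indicator (fun θ => share f i θ • g θ) θ := by
  by_cases h1 : θ ∈ segment a C i
  · rw [Set.indicator_of_mem h1, Set.indicator_of_notMem (segment_notMem_tieSet h1),
      share_effShare_of_segment h1, one_smul, add_zero]
  by_cases h2 : θ ∈ tieSet a C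
  · rw [Set.indicator_of_notMem h1, Set.indicator_of_mem h2, share_effShare_of_tieSet i h2,
      zero_add]
  · have h3 : θ ∈ segment a C i.rev := by
      rcases trichotomy C hθ with h | h | h
      · fin_cases i
        · exact absurd h h1
        · exact h
      · fin_cases i
        · exact h
        · exact absurd h h1
      · exact absurd h h2
    rw [Set.indicator_of_notMem h1, Set.indicator_of_notMem h2, share_effShare_of_segment_rev h3,
      zero_smul, add_zero]

theorem measurable_effShare (ha1 : a ≤ 1) {𝒳 : Fin 2 → Set (L2 P)} {C : Fin 2 → Catalogue P}
    (h : ∀ i, IsAdmissible a μ (𝒳 i) (C i)) {f : ℝ → ℝ} (hf : Measurable f) :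
    Measurable (effShare a C f) := by
  classical
  unfold effShare
  exact Measurable.ite (measurableSet_segment ha1 h 0) measurable_const
    (Measurable.ite (measurableSet_tieSet ha1 h) hf measurable_const)

theorem effShare_mem (C : Fin 2 → Catalogue P) {f : ℝ → ℝ} (hf : IsTieBreakingRule a f) (θ : ℝ) :
    effShare a C f θ ∈ Set.Icc (0 : ℝ) 1 := by
  rw [effShare]
  split_ifs with h1 h2
  · simp
  · exact hf.2 θ h2.1
  · simp

theorem integrable_bounded_smul {E : Type*} [NormedAddCommGroup E] [NormedSpace ℝ E] {w : ℝ → ℝ}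
    (hw : Measurable w) (h01 : ∀ᵐ θ ∂μ, w θ ∈ Set.Icc (0 : ℝ) 1) {g : ℝ → E}
    (hg : Integrable g μ) : Integrable (fun θ => w θ • g θ) μ := by
  refine hg.bdd_smul 1 hw.aestronglyMeasurable ?_
  filter_upwards [h01] with θ h
  rw [Real.norm_eq_abs, abs_of_nonneg h.1]
  exact h.2

theorem IsTieBreakingRule.share_mem {f : ℝ → ℝ} (hf : IsTieBreakingRule a f) (i : Fin 2) {θ : ℝ}
    (hθ : θ ∈ Set.Icc a 1) : share f i θ ∈ Set.Icc (0 : ℝ) 1 :=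
  ⟨share_nonneg (hf.2 θ hθ) i, share_le_one (hf.2 θ hθ) i⟩

/-- Integrals over the customers of a firm, in terms of the effective shares. -/
theorem integral_share_effShare {E : Type*} [NormedAddCommGroup E] [NormedSpace ℝ E] (ha1 : a ≤ 1)
    (hμ : μ (Set.Icc a 1)ᶜ = 0) {𝒳 : Fin 2 → Set (L2 P)} {C : Fin 2 → Catalogue P}
    (h : ∀ i, IsAdmissible a μ (𝒳 i) (C i)) {f : ℝ → ℝ} (hf : IsTieBreakingRule a f) (i : Fin 2)
    {g : ℝ → E} (hg : Integrable g μ) :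
    ∫ θ, share (effShare a C f) i θ • g θ ∂μ =
      ∫ θ in segment a C i, g θ ∂μ + ∫ θ in tieSet a C, share f i θ • g θ ∂μ := by
  have hsg : Integrable (fun θ => share f i θ • g θ) μ :=
    integrable_bounded_smul (measurable_share hf.1 i)
      ((ae_mem_Icc hμ).mono fun θ hθ => hf.share_mem i hθ) hg
  rw [← integral_indicator (measurableSet_segment ha1 h i),
    ← integral_indicator (measurableSet_tieSet ha1 h),
    ← integral_add (hg.indicator (measurableSet_segment ha1 h i))
      (hsg.indicator (measurableSet_tieSet ha1 h))]
  refine integral_congr_ae ?_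
  filter_upwards [ae_mem_Icc hμ] with θ hθ
  exact share_effShare_smul hθ i g

theorem IsAdmissible.integrable_product {𝒳 : Set (L2 P)} {C : Catalogue P}
    (h : IsAdmissible a μ 𝒳 C) (hμ : μ (Set.Icc a 1)ᶜ = 0) {R : ℝ} (hR : ∀ x ∈ 𝒳, ‖x‖ ≤ R) :
    Integrable C.product μ :=
  Integrable.of_bound h.measurable_product R
    ((ae_mem_Icc hμ).mono fun θ hθ => hR _ (h.product_mem θ hθ))

theorem IsAdmissible.integrable_indirectUtility {𝒳 : Set (L2 P)} {C : Catalogue P}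
    (h : IsAdmissible a μ 𝒳 C) (ha1 : a ≤ 1) (hμ : μ (Set.Icc a 1)ᶜ = 0) :
    Integrable (indirectUtility a C) μ := by
  have hbd : Integrable (fun θ => indirectUtility a C (clamp a θ)) μ := by
    refine Integrable.of_bound
      (antitone_comp_clamp ha1 h.antitoneOn).measurable.aestronglyMeasurable
      (indirectUtility a C a) (ae_of_all _ fun θ => ?_)
    have hm := clamp_mem ha1 θ
    rw [Real.norm_eq_abs, abs_of_nonneg (h.indirectUtility_nonneg hm)]
    exact h.antitoneOn ⟨le_rfl, ha1⟩ hm hm.1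
  refine hbd.congr ?_
  filter_upwards [ae_mem_Icc hμ] with θ hθ
  rw [clamp_eq hθ]

theorem IsAdmissible.integrable_var {𝒳 : Set (L2 P)} {C : Catalogue P}
    (h : IsAdmissible a μ 𝒳 C) (ha : 0 < a) (hμ : μ (Set.Icc a 1)ᶜ = 0) {R : ℝ}
    (hR : ∀ x ∈ 𝒳, ‖x‖ ≤ R) : Integrable (fun θ => θ * var (C.product θ)) μ := by
  refine Integrable.of_bound (measurable_id.aestronglyMeasurable.mul
    (continuous_var.comp_aestronglyMeasurable h.measurable_product)) (R ^ 2) ?_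
  filter_upwards [ae_mem_Icc hμ] with θ hθ
  have h1 := var_le_norm_sq (C.product θ)
  have h2 := hR _ (h.product_mem θ hθ)
  have h3 : ‖C.product θ‖ ^ 2 ≤ R ^ 2 := pow_le_pow_left₀ (norm_nonneg _) h2 2
  have h4 := var_nonneg (C.product θ)
  rw [Real.norm_eq_abs, abs_of_nonneg (mul_nonneg (ha.le.trans hθ.1) h4)]
  nlinarith [hθ.1, hθ.2]

/-- Minus the income from a type served by the catalogue. -/
def typeCost (a : ℝ) (C : Catalogue P) (θ : ℝ) : ℝ :=
  θ * var (C.product θ) + indirectUtility a C θ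

theorem IsAdmissible.integrable_typeCost {𝒳 : Set (L2 P)} {C : Catalogue P}
    (h : IsAdmissible a μ 𝒳 C) (ha : 0 < a) (ha1 : a ≤ 1) (hμ : μ (Set.Icc a 1)ᶜ = 0) {R : ℝ}
    (hR : ∀ x ∈ 𝒳, ‖x‖ ≤ R) : Integrable (typeCost a C) μ :=
  (h.integrable_var ha hμ hR).add (h.integrable_indirectUtility ha1 hμ)

/-- The derivative of the indirect utility is minus the variance almost everywhere, so the integrand
is `-typeCost`; segment and ties merge into one weight. -/
theorem income_eq (ha : 0 < a) (ha1 : a ≤ 1) (hμ : μ (Set.Icc a 1)ᶜ = 0)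
    {𝒳 : Fin 2 → Set (L2 P)} {R : ℝ} (hR : ∀ i, ∀ x ∈ 𝒳 i, ‖x‖ ≤ R)
    {C : Fin 2 → Catalogue P} (h : ∀ i, IsAdmissible a μ (𝒳 i) (C i)) {f : ℝ → ℝ}
    (hf : IsTieBreakingRule a f) (i : Fin 2) :
    income a μ C f i = -∫ θ, share (effShare a C f) i θ * typeCost a (C i) θ ∂μ := by
  have hi := (h i).integrable_typeCost ha ha1 hμ (hR i)
  have hder : ∀ᵐ θ ∂μ, θ * deriv (indirectUtility a (C i)) θ - indirectUtility a (C i) θ =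
      -typeCost a (C i) θ := by
    filter_upwards [(h i).variance_eq] with θ hθ
    rw [hθ.deriv, typeCost]; ring
  have e := integral_share_effShare ha1 hμ h hf i hi.neg
  rw [← integral_neg, income]
  have e1 : ∫ θ, -(share (effShare a C f) i θ * typeCost a (C i) θ) ∂μ =
      ∫ θ, share (effShare a C f) i θ • (-typeCost a (C i)) θ ∂μ := by
    refine integral_congr_ae (ae_of_all _ fun θ => ?_)
    simp
  rw [e1, e]
  congr 1
  · exact integral_congr_ae (ae_restrict_of_ae hder)
  · refine integral_congr_ae (ae_restrict_of_ae (hder.mono fun θ hθ => ?_))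
    dsimp only
    rw [hθ, smul_eq_mul, mul_comm, Pi.neg_apply]

/-- Centring is continuous and linear, so it commutes with the integral. -/
theorem risk_eq (ha1 : a ≤ 1) (hμ : μ (Set.Icc a 1)ᶜ = 0)
    {𝒳 : Fin 2 → Set (L2 P)} {R : ℝ} (hR : ∀ i, ∀ x ∈ 𝒳 i, ‖x‖ ≤ R)
    {C : Fin 2 → Catalogue P} (h : ∀ i, IsAdmissible a μ (𝒳 i) (C i)) {f : ℝ → ℝ}
    (hf : IsTieBreakingRule a f) (ρ : Fin 2 → L2 P → EReal) (W : Fin 2 → L2 P) (i : Fin 2) :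
    risk a μ ρ W C f i =
      ρ i (planPosition μ W (effShare a C f) (fun i => (C i).product) i) := by
  have hi := (h i).integrable_product hμ (hR i)
  have hsi : Integrable (fun θ => share (effShare a C f) i θ • (C i).product θ) μ :=
    integrable_bounded_smul (measurable_share (measurable_effShare ha1 h hf.1) i)
      (ae_of_all _ fun θ => ⟨share_nonneg (effShare_mem C hf θ) i,
        share_le_one (effShare_mem C hf θ) i⟩) hi
  have e := integral_share_effShare ha1 hμ h hf i (centerL.integrable_comp hi)
  rw [risk, planPosition, sub_sub, ← centerL.integral_comp_comm hsi]
  simp only [map_smul]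
  rw [e]
  simp only [centerL_apply]

/-- Aggregate risk of catalogues in terms of the effective shares. -/
theorem aggregateRisk_eq (ha : 0 < a) (ha1 : a ≤ 1) (hμ : μ (Set.Icc a 1)ᶜ = 0)
    {𝒳 : Fin 2 → Set (L2 P)} {R : ℝ} (hR : ∀ i, ∀ x ∈ 𝒳 i, ‖x‖ ≤ R)
    {C : Fin 2 → Catalogue P} (h : ∀ i, IsAdmissible a μ (𝒳 i) (C i)) {f : ℝ → ℝ}
    (hf : IsTieBreakingRule a f) (ρ : Fin 2 → L2 P → EReal) (W : Fin 2 → L2 P) :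
    aggregateRisk a μ ρ W C f =
      planRisk μ ρ W (effShare a C f) (fun i => (C i).product) +
        ((∫ θ, (share (effShare a C f) 0 θ * typeCost a (C 0) θ +
          share (effShare a C f) 1 θ * typeCost a (C 1) θ) ∂μ : ℝ) : EReal) := by
  have hi : ∀ i, Integrable (fun θ => share (effShare a C f) i θ * typeCost a (C i) θ) μ :=
    fun i => integrable_bounded_smul (measurable_share (measurable_effShare ha1 h hf.1) i)
      (ae_of_all _ fun θ => ⟨share_nonneg (effShare_mem C hf θ) i,
        share_le_one (effShare_mem C hf θ) i⟩) ((h i).integrable_typeCost ha ha1 hμ (hR i))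
  rw [integral_add (hi 0) (hi 1), aggregateRisk, assessment, assessment,
    income_eq ha ha1 hμ hR h hf, income_eq ha ha1 hμ hR h hf, risk_eq ha1 hμ hR h hf,
    risk_eq ha1 hμ hR h hf, planRisk, sub_eq_add_neg, sub_eq_add_neg, add_add_add_comm,
    ← EReal.coe_neg, ← EReal.coe_neg, neg_neg, neg_neg, EReal.coe_add]

end Admissible

/-! ### From tight plans to catalogues -/

section Construction

variable {Ω : Type*} [MeasurableSpace Ω] {P : Measure Ω} [IsProbabilityMeasure P]
  {μ : Measure ℝ} [IsFiniteMeasure μ] {a : ℝ}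

theorem surplus_sub {q : ℝ → ℝ} (hq : Antitone q) (θ t : ℝ) :
    surplus q θ - surplus q t = ∫ s in θ..t, q s := by
  rw [sub_eq_iff_eq_add]
  exact (intervalIntegral.integral_add_adjacent_intervals
    (intervalIntegrable_of_antitone hq θ t) (intervalIntegrable_of_antitone hq t 1)).symm

theorem mul_le_integral_of_antitone {q : ℝ → ℝ} (hq : Antitone q) (θ t : ℝ) :
    (t - θ) * q t ≤ ∫ s in θ..t, q s := by
  rcases le_total θ t with h | h
  · have := intervalIntegral.integral_mono_on (f := fun _ => q t) h intervalIntegrable_const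
      (intervalIntegrable_of_antitone hq θ t) fun x hx => hq hx.2
    simpa using this
  · have := intervalIntegral.integral_mono_on (g := fun _ => q t) h
      (intervalIntegrable_of_antitone hq t θ) intervalIntegrable_const fun x hx => hq hx.1
    rw [intervalIntegral.integral_symm]
    rw [intervalIntegral.integral_const, smul_eq_mul] at this
    linarith

/-- The surplus is convex with slope -q. This inequality is exactly incentive compatibility for a
catalogue whose variances are q and whose indirect utility is the surplus. -/
theorem surplus_tangent_le {q : ℝ → ℝ} (hq : Antitone q) (θ t : ℝ) :
    surplus q t + (t - θ) * q t ≤ surplus q θ := by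
  linarith [surplus_sub hq θ t, mul_le_integral_of_antitone hq θ t]

theorem surplus_nonneg {q : ℝ → ℝ} (h0 : ∀ x, 0 ≤ q x) {θ : ℝ} (hθ : θ ≤ 1) :
    0 ≤ surplus q θ := intervalIntegral.integral_nonneg hθ fun x _ => h0 x

theorem hasDerivAt_surplus {q : ℝ → ℝ} (hq : Antitone q) {θ : ℝ} (h : ContinuousAt q θ) :
    HasDerivAt (surplus q) (-q θ) θ :=
  intervalIntegral.integral_hasDerivAt_left (intervalIntegrable_of_antitone hq _ _)
    (hq.measurable.stronglyMeasurable.stronglyMeasurableAtFilter) h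

/-- The surplus at θ sees q only to the right of θ, where q is already below the cap. -/
theorem surplus_min {q : ℝ → ℝ} (hq : Antitone q) {c θ : ℝ} (hθ : θ ≤ 1) (h : q θ ≤ c) :
    surplus (fun s => min (q s) c) θ = surplus q θ := by
  refine intervalIntegral.integral_congr fun s hs => ?_
  rw [Set.uIcc_of_le hθ] at hs
  exact min_eq_left ((hq hs.1).trans h)

theorem surplus_min_le {q : ℝ → ℝ} (hq : Antitone q) (c : ℝ) {θ : ℝ} (hθ : θ ≤ 1) :
    surplus (fun s => min (q s) c) θ ≤ surplus q θ :=
  intervalIntegral.integral_mono_on hθ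
    (intervalIntegrable_of_antitone (fun _ _ h => min_le_min_right _ (hq h)) _ _)
    (intervalIntegrable_of_antitone hq _ _) fun _ _ => min_le_left _ _

open scoped Classical in
/-- The products of a catalogue with variances `min q (var x)`: `X θ` where it has this variance,
and otherwise a multiple of `x`. -/
def planProduct (𝒳 : Set (L2 P)) (q : ℝ → ℝ) (X : ℝ → L2 P) (x : L2 P) (θ : ℝ) : L2 P :=
  if X θ ∈ 𝒳 ∧ var (X θ) = min (q θ) (var x) then X θ else √(min (q θ) (var x) / var x) • x

/-- The catalogue with the products `planProduct`, and prices such that the indirect utility is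
the surplus. -/
def planCatalogue (𝒳 : Set (L2 P)) (q : ℝ → ℝ) (X : ℝ → L2 P) (x : L2 P) : Catalogue P where
  product := planProduct 𝒳 q X x
  price θ := mean (planProduct 𝒳 q X x θ) - θ * min (q θ) (var x) -
    surplus (fun s => min (q s) (var x)) θ

variable {𝒳 : Set (L2 P)} {q : ℝ → ℝ} {X : ℝ → L2 P} {x : L2 P}

theorem var_planProduct (hq0 : ∀ θ, 0 ≤ q θ) (θ : ℝ) :
    var (planProduct 𝒳 q X x θ) = min (q θ) (var x) := by
  have hm : 0 ≤ min (q θ) (var x) := le_min (hq0 θ) (var_nonneg x)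
  rw [planProduct]
  split_ifs with h
  · exact h.2
  · rw [var_smul, Real.sq_sqrt (div_nonneg hm (var_nonneg x))]
    -- Lean sets the quotient to 0 when var x = 0, which is harmless: the required variance is then
    -- 0 as well.
    by_cases hz : var x = 0
    · rw [hz] at hm ⊢
      rw [mul_zero]
      exact le_antisymm hm (min_le_right _ _)
    · exact div_mul_cancel₀ _ hz

theorem planProduct_mem (hcv : Convex ℝ 𝒳) (h0 : (0 : L2 P) ∈ 𝒳) (hx : x ∈ 𝒳) (θ : ℝ) :
    planProduct 𝒳 q X x θ ∈ 𝒳 := by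
  rw [planProduct]
  split_ifs with h
  · exact h.1
  · refine hcv.smul_mem_of_zero_mem h0 hx ⟨Real.sqrt_nonneg _, ?_⟩
    refine Real.sqrt_le_iff.2 ⟨zero_le_one, ?_⟩
    rw [one_pow]
    exact div_le_one_of_le₀ (min_le_right _ _) (var_nonneg x)

theorem stronglyMeasurable_planProduct (hcl : IsClosed 𝒳) (hq : Antitone q)
    (hX : StronglyMeasurable X) : StronglyMeasurable (planProduct 𝒳 q X x) := by
  classical
  have hmin : Measurable fun θ => min (q θ) (var x) := hq.measurable.min measurable_const
  have hset : MeasurableSet {θ | X θ ∈ 𝒳 ∧ var (X θ) = min (q θ) (var x)} := by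
    refine MeasurableSet.inter ?_ (measurableSet_eq_fun (measurable_var_comp hX) hmin)
    borelize (L2 P)
    exact hX.measurable hcl.measurableSet
  refine StronglyMeasurable.ite hset hX ?_
  exact (hmin.div_const _).sqrt.stronglyMeasurable.smul stronglyMeasurable_const

theorem utility_planCatalogue (hq0 : ∀ θ, 0 ≤ q θ) (θ t : ℝ) :
    utility θ ((planCatalogue 𝒳 q X x).product t) - (planCatalogue 𝒳 q X x).price t =
      surplus (fun s => min (q s) (var x)) t + (t - θ) * min (q t) (var x) := by
  simp only [planCatalogue, utility, var_planProduct hq0]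
  ring

theorem antitone_min (hq : Antitone q) (c : ℝ) : Antitone fun s => min (q s) c :=
  fun _ _ h => min_le_min_right _ (hq h)

theorem isAdmissible_planCatalogue (hac : μ ≪ volume) (hμ : μ (Set.Icc a 1)ᶜ = 0)
    (hcl : IsClosed 𝒳) (hcv : Convex ℝ 𝒳)
    (h0 : (0 : L2 P) ∈ 𝒳) (hx : x ∈ 𝒳) (hq : Antitone q) (hq0 : ∀ θ, 0 ≤ q θ)
    (hX : StronglyMeasurable X) :
    IsAdmissible a μ 𝒳 (planCatalogue 𝒳 q X x) ∧
      ∀ θ ∈ Set.Icc a 1, indirectUtility a (planCatalogue 𝒳 q X x) θ =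
        surplus (fun s => min (q s) (var x)) θ := by
  have hmin := antitone_min hq (var x)
  have hle : ∀ θ t, utility θ ((planCatalogue 𝒳 q X x).product t) -
      (planCatalogue 𝒳 q X x).price t ≤ surplus (fun s => min (q s) (var x)) θ := by
    intro θ t
    rw [utility_planCatalogue hq0]
    exact surplus_tangent_le hmin θ t
  have heq : ∀ θ, utility θ ((planCatalogue 𝒳 q X x).product θ) -
      (planCatalogue 𝒳 q X x).price θ = surplus (fun s => min (q s) (var x)) θ := by
    intro θ
    rw [utility_planCatalogue hq0]; ring
  have hv : ∀ θ ∈ Set.Icc a 1, indirectUtility a (planCatalogue 𝒳 q X x) θ =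
      surplus (fun s => min (q s) (var x)) θ := by
    intro θ hθ
    have hne : Nonempty (Set.Icc a 1) := ⟨⟨θ, hθ⟩⟩
    refine le_antisymm (ciSup_le fun t => hle θ t) ?_
    rw [← heq θ]
    exact le_ciSup (f := fun t : Set.Icc a 1 => utility θ ((planCatalogue 𝒳 q X x).product t) -
      (planCatalogue 𝒳 q X x).price t)
      ⟨surplus (fun s => min (q s) (var x)) θ, by rintro _ ⟨t, rfl⟩; exact hle θ t⟩ ⟨θ, hθ⟩
  refine ⟨⟨fun θ _ => planProduct_mem hcv h0 hx θ,
    (stronglyMeasurable_planProduct hcl hq hX).aestronglyMeasurable,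
    fun θ _ t _ => by rw [heq]; exact hle θ t,
    fun θ hθ => by rw [heq]; exact surplus_nonneg (fun s => le_min (hq0 s) (var_nonneg x)) hθ.2,
    ?_⟩, hv⟩
  -- The derivative is two-sided, whereas the indirect utility equals the surplus only on [a, 1];
  -- hence the endpoints are discarded along with the jumps of q.
  have hcount : ({a, 1} ∪ {θ | ¬ ContinuousAt (fun s => min (q s) (var x)) θ}).Countable :=
    (Set.toFinite _).countable.union hmin.countable_not_continuousAt
  filter_upwards [ae_notMem_countable hac hcount, ae_mem_Icc hμ] with θ hθ hm
  rw [Set.mem_union, not_or] at hθ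
  obtain ⟨h1, h2⟩ := hθ
  have h2 : ContinuousAt (fun s => min (q s) (var x)) θ := not_not.1 h2
  have ha : a < θ := lt_of_le_of_ne hm.1 fun h => h1 (Or.inl h.symm)
  have hb : θ < 1 := lt_of_le_of_ne hm.2 fun h => h1 (Or.inr h)
  have hd := hasDerivAt_surplus hmin h2
  have e : var ((planCatalogue 𝒳 q X x).product θ) = min (q θ) (var x) := var_planProduct hq0 θ
  rw [e]
  refine hd.congr_of_eventuallyEq ?_
  filter_upwards [Ioo_mem_nhds ha hb] with s hs
  exact hv s ⟨hs.1.le, hs.2.le⟩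

/-- A plan with binding variance constraint whose variances are attained by both firms is
implemented by a pair of admissible catalogues. -/
theorem IsPlan.exists_catalogues {𝒳 : Fin 2 → Set (L2 P)} {B : ℝ} {q φ : ℝ → ℝ}
    {X : Fin 2 → ℝ → L2 P} (hp : IsPlan μ 𝒳 B q φ X) (ha : 0 < a) (ha1 : a ≤ 1)
    (hμ : μ (Set.Icc a 1)ᶜ = 0) (hac : μ ≪ volume)
    (hcl : ∀ i, IsClosed (𝒳 i)) (hcv : ∀ i, Convex ℝ (𝒳 i)) (h0 : ∀ i, (0 : L2 P) ∈ 𝒳 i) {R : ℝ}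
    (hR : ∀ i, ∀ x ∈ 𝒳 i, ‖x‖ ≤ R)
    (htight : ∀ i, ∀ᵐ θ ∂μ, share φ i θ ≠ 0 → var (X i θ) = q θ) {x : Fin 2 → L2 P}
    (hx : ∀ i, x i ∈ 𝒳 i) (hxq : ∀ i, ∀ᵐ θ ∂μ, share φ i θ ≠ 0 → q θ ≤ var (x i))
    (ρ : Fin 2 → L2 P → EReal) (W : Fin 2 → L2 P) :
    ∃ (C : Fin 2 → Catalogue P), (∀ i, IsAdmissible a μ (𝒳 i) (C i)) ∧ IsTieBreakingRule a φ ∧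
      aggregateRisk a μ ρ W C φ = planRisk μ ρ W φ X + (planCost μ q : EReal) := by
  set C : Fin 2 → Catalogue P := fun i => planCatalogue (𝒳 i) q (X i) (x i) with hC
  have hadm := fun i => isAdmissible_planCatalogue (a := a) hac hμ (hcl i) (hcv i) (h0 i) (hx i)
    hp.antitone hp.nonneg (hp.stronglyMeasurable i)
  have hCa : ∀ i, IsAdmissible a μ (𝒳 i) (C i) := fun i => (hadm i).1
  have hCv : ∀ i, ∀ θ ∈ Set.Icc a 1, indirectUtility a (C i) θ =
      surplus (fun s => min (q s) (var (x i))) θ := fun i => (hadm i).2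
  have htb : IsTieBreakingRule a φ := ⟨hp.measurable, fun θ _ => hp.share_mem θ⟩
  -- Where firm i sells, the cap var (x i) is inactive, so its catalogue offers the product of the
  -- plan and the full surplus.
  have hactive : ∀ i, ∀ᵐ θ ∂μ, share φ i θ ≠ 0 → (C i).product θ = X i θ ∧
      indirectUtility a (C i) θ = surplus q θ ∧ var ((C i).product θ) = q θ := by
    intro i
    filter_upwards [htight i, hxq i, hp.mem i, ae_mem_Icc hμ] with θ h1 h2 h3 hθ hs
    have e : min (q θ) (var (x i)) = q θ := min_eq_left (h2 hs)
    have e1 : (C i).product θ = X i θ := if_pos ⟨h3, by rw [e]; exact h1 hs⟩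
    refine ⟨e1, ?_, by rw [e1]; exact h1 hs⟩
    rw [hCv i θ hθ, surplus_min hp.antitone hθ.2 (h2 hs)]
  have hle : ∀ i, ∀ θ ∈ Set.Icc a 1, indirectUtility a (C i) θ ≤ surplus q θ := fun i θ hθ => by
    rw [hCv i θ hθ]; exact surplus_min_le hp.antitone _ hθ.2
  -- A firm with positive share attains the maximal surplus and cannot be strictly beaten. On strict
  -- segments the planned share is therefore already 0 or 1, and on ties φ itself decides.
  have heff : ∀ᵐ θ ∂μ, effShare a C φ θ = φ θ := by
    filter_upwards [ae_mem_Icc hμ, hactive 0, hactive 1] with θ hθ h1 h2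
    rcases trichotomy C hθ with h | h | h
    · have hz : share φ 1 θ = 0 := by
        by_contra hne
        exact absurd (h.2.trans_le (hle 0 θ hθ)) (by
          rw [show Fin.rev (0 : Fin 2) = 1 from rfl, (h2 hne).2.1]; exact lt_irrefl _)
      have h3 : share (effShare a C φ) 0 θ = 1 := share_effShare_of_segment h
      have h4 := share_add φ θ
      change effShare a C φ θ = 1 at h3
      change φ θ + share φ 1 θ = 1 at h4
      linarith
    · have hz : share φ 0 θ = 0 := by
        by_contra hne
        exact absurd (h.2.trans_le (hle 1 θ hθ)) (by
          rw [show Fin.rev (1 : Fin 2) = 0 from rfl, (h1 hne).2.1]; exact lt_irrefl _)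
      have h3 : share (effShare a C φ) 0 θ = 0 := share_effShare_of_segment_rev h
      change effShare a C φ θ = 0 at h3
      change φ θ = 0 at hz
      rw [h3, hz]
    · exact share_effShare_of_tieSet 0 h
  have hshare : ∀ᵐ θ ∂μ, ∀ i, share (effShare a C φ) i θ = share φ i θ := by
    filter_upwards [heff] with θ h i
    unfold share; rw [h]
  refine ⟨C, hCa, htb, ?_⟩
  rw [aggregateRisk_eq ha ha1 hμ hR hCa htb]
  congr 1
  · refine planRisk_congr fun i => ?_
    refine integral_congr_ae ?_
    filter_upwards [hshare, hactive i] with θ h1 h2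
    rw [h1]
    by_cases hz : share φ i θ = 0
    · rw [hz, zero_smul, zero_smul]
    · rw [(h2 hz).1]
  · congr 1
    refine integral_congr_ae ?_
    filter_upwards [hshare, hactive 0, hactive 1] with θ h1 h2 h3
    have hterm : ∀ i, (share φ i θ ≠ 0 → (C i).product θ = X i θ ∧
        indirectUtility a (C i) θ = surplus q θ ∧ var ((C i).product θ) = q θ) →
        share φ i θ * typeCost a (C i) θ = share φ i θ * (surplus q θ + θ * q θ) := by
      intro i h
      by_cases hz : share φ i θ = 0
      · rw [hz, zero_mul, zero_mul]
      · rw [typeCost, (h hz).2.1, (h hz).2.2, add_comm]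
    rw [h1, h1, hterm 0 h2, hterm 1 h3, ← add_mul, share_add, one_mul]

end Construction

/-! ### From catalogues to plans -/

section LowerBound

variable {Ω : Type*} [MeasurableSpace Ω] {P : Measure Ω} [IsProbabilityMeasure P]
  {μ : Measure ℝ} [IsFiniteMeasure μ] {a : ℝ}

/-- A function with tangent slopes `-q` is recovered by integrating `q`. -/
theorem surplus_le_of_tangent {v q : ℝ → ℝ} (hq : Antitone q)
    (h : ∀ θ ∈ Set.Icc a 1, ∀ t ∈ Set.Icc a 1, v t + (t - θ) * q t ≤ v θ) {θ : ℝ}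
    (hθ : θ ∈ Set.Icc a 1) : surplus q θ ≤ v θ - v 1 := by
  set L := 1 - θ with hL
  have hL0 : 0 ≤ L := sub_nonneg.2 hθ.2
  have hbound : ∀ n : ℕ, surplus q θ - (v θ - v 1) ≤ L * (q θ - q 1) * (1 / ((n : ℝ) + 1)) := by
    intro n
    set N : ℝ := (n : ℝ) + 1 with hN
    have hN0 : 0 < N := by positivity
    set t : ℕ → ℝ := fun k => θ + L * (k / N) with ht
    have ht0 : t 0 = θ := by simp [ht]
    have htN : t (n + 1) = 1 := by
      simp only [ht]
      push_cast
      rw [div_self hN0.ne', hL]; ring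
    have hmem : ∀ k ≤ n + 1, t k ∈ Set.Icc a 1 := by
      intro k hk
      have h1 : (k : ℝ) / N ≤ 1 := by
        rw [div_le_one hN0, hN]; exact_mod_cast hk
      have h2 : 0 ≤ (k : ℝ) / N := by positivity
      constructor
      · simp only [ht]; nlinarith [hθ.1]
      · simp only [ht]; nlinarith [hθ.2]
    have hstep : ∀ k, t (k + 1) - t k = L * (1 / N) := by
      intro k
      simp only [ht]
      push_cast
      ring
    -- On a uniform partition, each step bounds the drop of the surplus by the left value of q and
    -- that of v from below by the right value. The errors telescope to L (q θ - q 1) / N.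
    have hind : ∀ k ≤ n + 1, (surplus q θ - surplus q (t k)) - (v θ - v (t k)) ≤
        L * (1 / N) * (q θ - q (t k)) := by
      intro k
      induction k with
      | zero => intro _; rw [ht0]; simp
      | succ k ih =>
        intro hk
        have e1 := ih (by omega)
        have e2 := h (t k) (hmem k (by omega)) (t (k + 1)) (hmem (k + 1) hk)
        have e3 := surplus_tangent_le hq (t (k + 1)) (t k)
        have e4 := hstep k
        have e5 : t k - t (k + 1) = -(L * (1 / N)) := by linarith
        rw [e4] at e2
        rw [e5] at e3
        nlinarith
    have e := hind (n + 1) le_rfl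
    have hs1 : surplus q 1 = 0 := intervalIntegral.integral_same
    rw [htN, hs1] at e
    calc surplus q θ - (v θ - v 1) ≤ L * (1 / N) * (q θ - q 1) := by linarith
      _ = L * (q θ - q 1) * (1 / N) := by ring
  have hlim : Tendsto (fun n : ℕ => L * (q θ - q 1) * (1 / ((n : ℝ) + 1))) atTop (𝓝 0) := by
    simpa using tendsto_one_div_add_atTop_nhds_zero_nat.const_mul (L * (q θ - q 1))
  linarith [ge_of_tendsto' hlim hbound]

/-- The larger of the two indirect utilities. -/
def maxUtility (a : ℝ) (C : Fin 2 → Catalogue P) (θ : ℝ) : ℝ :=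
  max (indirectUtility a (C 0) θ) (indirectUtility a (C 1) θ)

open scoped Classical in
/-- The variance of a product chosen by the agents. -/
def activeVar (a : ℝ) (C : Fin 2 → Catalogue P) (θ : ℝ) : ℝ :=
  if indirectUtility a (C 1) θ ≤ indirectUtility a (C 0) θ then var ((C 0).product θ)
  else var ((C 1).product θ)

theorem le_maxUtility (C : Fin 2 → Catalogue P) (i : Fin 2) (θ : ℝ) :
    indirectUtility a (C i) θ ≤ maxUtility a C θ := by
  fin_cases i
  · exact le_max_left _ _
  · exact le_max_right _ _

theorem exists_activeVar_eq (C : Fin 2 → Catalogue P) (θ : ℝ) :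
    ∃ i, activeVar a C θ = var ((C i).product θ) ∧
      indirectUtility a (C i) θ = maxUtility a C θ := by
  by_cases h : indirectUtility a (C 1) θ ≤ indirectUtility a (C 0) θ
  · exact ⟨0, if_pos h, (max_eq_left h).symm⟩
  · exact ⟨1, if_neg h, (max_eq_right (not_le.1 h).le).symm⟩

variable {𝒳 : Fin 2 → Set (L2 P)} {C : Fin 2 → Catalogue P}

theorem maxUtility_tangent (h : ∀ i, IsAdmissible a μ (𝒳 i) (C i)) {θ t : ℝ}
    (hθ : θ ∈ Set.Icc a 1) (ht : t ∈ Set.Icc a 1) {i : Fin 2}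
    (hi : indirectUtility a (C i) t = maxUtility a C t) :
    maxUtility a C t + (t - θ) * var ((C i).product t) ≤ maxUtility a C θ := by
  rw [← hi]
  exact ((h i).tangent_le hθ ht).trans (le_maxUtility C i θ)

/-- The variances of products chosen by the agents decrease. -/
theorem var_le_var_of_active (h : ∀ i, IsAdmissible a μ (𝒳 i) (C i)) {θ t : ℝ}
    (hθ : θ ∈ Set.Icc a 1) (ht : t ∈ Set.Icc a 1) (htθ : t < θ) {i j : Fin 2}
    (hi : indirectUtility a (C i) t = maxUtility a C t)
    (hj : indirectUtility a (C j) θ = maxUtility a C θ) :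
    var ((C j).product θ) ≤ var ((C i).product t) := by
  have h1 := maxUtility_tangent h hθ ht hi
  have h2 := maxUtility_tangent h ht hθ hj
  have : (θ - t) * var ((C j).product θ) ≤ (θ - t) * var ((C i).product t) := by linarith
  exact le_of_mul_le_mul_left this (sub_pos.2 htθ)

theorem antitoneOn_activeVar (h : ∀ i, IsAdmissible a μ (𝒳 i) (C i)) :
    AntitoneOn (activeVar a C) (Set.Icc a 1) := by
  intro t ht θ hθ htθ
  rcases htθ.eq_or_lt with rfl | hlt
  · exact le_rfl
  obtain ⟨i, hi, hi'⟩ := exists_activeVar_eq (a := a) C t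
  obtain ⟨j, hj, hj'⟩ := exists_activeVar_eq (a := a) C θ
  rw [hi, hj]
  exact var_le_var_of_active h hθ ht hlt hi' hj'

/-- Outside a countable set all products chosen by the agents have the same variance. -/
theorem ae_var_eq_activeVar (h : ∀ i, IsAdmissible a μ (𝒳 i) (C i)) (ha1 : a ≤ 1)
    (hμ : μ (Set.Icc a 1)ᶜ = 0) (hac : μ ≪ volume) :
    ∀ᵐ θ ∂μ, ∀ i, indirectUtility a (C i) θ = maxUtility a C θ →
      var ((C i).product θ) = activeVar a C (clamp a θ) := by
  have hanti := antitone_comp_clamp ha1 (antitoneOn_activeVar h)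
  have hcount : ({a, 1} ∪ {θ | ¬ ContinuousAt (fun s => activeVar a C (clamp a s)) θ}).Countable :=
    (Set.toFinite _).countable.union hanti.countable_not_continuousAt
  filter_upwards [ae_notMem_countable hac hcount, ae_mem_Icc hμ] with θ hθ hm i hi
  rw [Set.mem_union, not_or] at hθ
  obtain ⟨h1, h2⟩ := hθ
  have h2 : ContinuousAt (fun s => activeVar a C (clamp a s)) θ := not_not.1 h2
  have hlt : a < θ := lt_of_le_of_ne hm.1 fun h => h1 (Or.inl h.symm)
  have hgt : θ < 1 := lt_of_le_of_ne hm.2 fun h => h1 (Or.inr h)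
  -- Chosen variances decrease in the type, whichever firm is chosen; at a continuity point, choices
  -- just to the left and right squeeze every optimal choice at θ.
  refine le_antisymm ?_ ?_
  · refine ge_of_tendsto (h2.tendsto.mono_left (nhdsWithin_le_nhds (s := Set.Iio θ))) ?_
    filter_upwards [Ioo_mem_nhdsLT hlt] with t ht
    have htm : t ∈ Set.Icc a 1 := ⟨ht.1.le, ht.2.le.trans hm.2⟩
    obtain ⟨j, hj, hj'⟩ := exists_activeVar_eq (a := a) C t
    rw [clamp_eq htm, hj]
    exact var_le_var_of_active h hm htm ht.2 hj' hi
  · refine le_of_tendsto (h2.tendsto.mono_left (nhdsWithin_le_nhds (s := Set.Ioi θ))) ?_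
    filter_upwards [Ioo_mem_nhdsGT hgt] with t ht
    have htm : t ∈ Set.Icc a 1 := ⟨hm.1.trans ht.1.le, ht.2.le⟩
    obtain ⟨j, hj, hj'⟩ := exists_activeVar_eq (a := a) C t
    rw [clamp_eq htm, hj]
    exact var_le_var_of_active h htm hm ht.1 hi hj'

theorem indirectUtility_eq_max_of_share_ne_zero {f : ℝ → ℝ} {θ : ℝ} (hθ : θ ∈ Set.Icc a 1)
    {i : Fin 2} (hs : share (effShare a C f) i θ ≠ 0) :
    indirectUtility a (C i) θ = maxUtility a C θ := by
  have hnot : θ ∉ segment a C i.rev := fun h => hs (share_effShare_of_segment_rev h)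
  have hge : indirectUtility a (C i.rev) θ ≤ indirectUtility a (C i) θ := by
    by_contra! hlt
    exact hnot ⟨hθ, by rw [Fin.rev_rev]; exact hlt⟩
  refine le_antisymm (le_maxUtility C i θ) ?_
  obtain rfl | rfl : i = 0 ∨ i = 1 := by omega
  · exact max_le le_rfl hge
  · exact max_le hge le_rfl

/-- Every pair of admissible catalogues gives a plan with at most the same aggregate risk. -/
theorem exists_plan_le_aggregateRisk (ha : 0 < a) (ha1 : a ≤ 1)
    (hμ : μ (Set.Icc a 1)ᶜ = 0) (hac : μ ≪ volume) (h0 : ∀ i, (0 : L2 P) ∈ 𝒳 i) {R : ℝ}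
    (hR : ∀ i, ∀ x ∈ 𝒳 i, ‖x‖ ≤ R) (h : ∀ i, IsAdmissible a μ (𝒳 i) (C i)) {f : ℝ → ℝ}
    (hf : IsTieBreakingRule a f) (ρ : Fin 2 → L2 P → EReal) (W : Fin 2 → L2 P) :
    ∃ q φ X, IsPlan μ 𝒳 (R ^ 2) q φ X ∧
      planRisk μ ρ W φ X + (planCost μ q : EReal) ≤ aggregateRisk a μ ρ W C f := by
  classical
  set q : ℝ → ℝ := fun θ => activeVar a C (clamp a θ) with hq
  set φ := effShare a C f with hφ
  -- Products that nobody buys may have variance above q, so they are replaced by 0; a strongly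
  -- measurable representative is used for the others.
  set X : Fin 2 → ℝ → L2 P := fun i θ =>
    if share φ i θ ≠ 0 then (h i).measurable_product.mk _ θ else 0 with hX
  have hφm : Measurable φ := measurable_effShare ha1 h hf.1
  have hqanti : Antitone q := antitone_comp_clamp ha1 (antitoneOn_activeVar h)
  have hq0 : ∀ θ, 0 ≤ q θ := fun θ => by
    obtain ⟨i, hi, -⟩ := exists_activeVar_eq (a := a) C (clamp a θ)
    simp only [hq]; rw [hi]; exact var_nonneg _
  have hqR : ∀ θ, q θ ≤ R ^ 2 := fun θ => by
    obtain ⟨i, hi, -⟩ := exists_activeVar_eq (a := a) C (clamp a θ)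
    simp only [hq]
    rw [hi]
    exact (var_le_norm_sq _).trans (pow_le_pow_left₀ (norm_nonneg _)
      (hR i _ ((h i).product_mem _ (clamp_mem ha1 θ))) 2)
  have hmk : ∀ i, ∀ᵐ θ ∂μ, share φ i θ ≠ 0 → X i θ = (C i).product θ := fun i => by
    filter_upwards [(h i).measurable_product.ae_eq_mk] with θ h1 h2
    simp only [hX]
    rw [if_pos h2, h1]
  have hact : ∀ᵐ θ ∂μ, ∀ i, share φ i θ ≠ 0 → var ((C i).product θ) = q θ ∧
      indirectUtility a (C i) θ = maxUtility a C θ := by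
    filter_upwards [ae_var_eq_activeVar h ha1 hμ hac, ae_mem_Icc hμ] with θ h1 hθ i hs
    have h2 := indirectUtility_eq_max_of_share_ne_zero hθ hs
    exact ⟨h1 i h2, h2⟩
  have hplan : IsPlan μ 𝒳 (R ^ 2) q φ X := by
    refine ⟨hqanti, hq0, hqR, hφm, effShare_mem C hf, fun i => ?_, fun i => ?_, fun i => ?_⟩
    · exact StronglyMeasurable.ite
        ((measurable_share hφm i) (measurableSet_singleton (0 : ℝ)).compl)
        (h i).measurable_product.stronglyMeasurable_mk stronglyMeasurable_const
    · filter_upwards [hmk i, ae_mem_Icc hμ] with θ h1 hθ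
      by_cases hs : share φ i θ = 0
      · simp only [hX]
        rw [if_neg (not_not.2 hs)]
        exact h0 i
      · rw [h1 hs]; exact (h i).product_mem θ hθ
    · filter_upwards [hmk i, hact] with θ h1 h2
      by_cases hs : share φ i θ = 0
      · simp only [hX]
        rw [if_neg (not_not.2 hs), var_zero]
        exact hq0 θ
      · rw [h1 hs]; exact (h2 i hs).1.le
  refine ⟨q, φ, X, hplan, ?_⟩
  rw [aggregateRisk_eq ha ha1 hμ hR h hf]
  have hrisk : planRisk μ ρ W φ X = planRisk μ ρ W φ (fun i => (C i).product) := by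
    refine planRisk_congr fun i => integral_congr_ae ?_
    filter_upwards [hmk i] with θ h1
    by_cases hs : share φ i θ = 0
    · rw [hs, zero_smul, zero_smul]
    · rw [h1 hs]
  rw [hrisk]
  refine add_le_add le_rfl (EReal.coe_le_coe_iff.2 ?_)
  have hi : ∀ i, Integrable (fun θ => share φ i θ * typeCost a (C i) θ) μ :=
    fun i => integrable_bounded_smul (measurable_share hφm i)
      (ae_of_all _ fun θ => ⟨share_nonneg (effShare_mem C hf θ) i,
        share_le_one (effShare_mem C hf θ) i⟩) ((h i).integrable_typeCost ha ha1 hμ (hR i))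
  refine integral_mono_ae (integrable_cost ha hμ hqanti hq0 hqR) ((hi 0).add (hi 1)) ?_
  filter_upwards [hact, ae_mem_Icc hμ] with θ h1 hθ
  have hterm : ∀ i, share φ i θ * typeCost a (C i) θ =
      share φ i θ * (θ * q θ + maxUtility a C θ) := by
    intro i
    by_cases hs : share φ i θ = 0
    · rw [hs, zero_mul, zero_mul]
    · rw [typeCost, (h1 i hs).1, (h1 i hs).2]
  rw [hterm, hterm, ← add_mul, share_add, one_mul, add_comm]
  have h1m : (1 : ℝ) ∈ Set.Icc a 1 := ⟨ha1, le_rfl⟩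
  have hsur := surplus_le_of_tangent (v := maxUtility a C) hqanti (fun θ hθ t ht => by
    obtain ⟨i, hi, hi'⟩ := exists_activeVar_eq (a := a) C t
    simp only [hq]
    rw [clamp_eq ht, hi]
    exact maxUtility_tangent h hθ ht hi') hθ
  -- Individual rationality at the type 1 makes the surplus a lower bound for the maximal utility,
  -- so the plan pays the agents no more than the catalogues do.
  have hv1 : 0 ≤ maxUtility a C 1 :=
    ((h 0).indirectUtility_nonneg h1m).trans (le_maxUtility C 0 1)
  linarith

end LowerBound

/-! ### The planner's minimum and the transfers -/

section Main

variable {Ω : Type*} [MeasurableSpace Ω] {P : Measure Ω} [IsProbabilityMeasure P]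
  {μ : Measure ℝ} [IsFiniteMeasure μ] {a : ℝ}

theorem sub_coe_ne_bot {x : EReal} (hx : x ≠ ⊥) (t : ℝ) : x - (t : EReal) ≠ ⊥ := by
  rw [sub_eq_add_neg, ← EReal.coe_neg]
  exact EReal.add_ne_bot_iff.2 ⟨hx, EReal.coe_ne_bot _⟩

theorem planCost_zero : planCost μ (fun _ => 0) = 0 := by
  simp [planCost, surplus]

theorem planRisk_zero (ρ : Fin 2 → L2 P → EReal) (W : Fin 2 → L2 P) (φ : ℝ → ℝ) :
    planRisk μ ρ W φ (fun _ _ => 0) = ρ 0 (W 0) + ρ 1 (W 1) := by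
  simp [planRisk, planPosition]

/-- The aggregate risk is minimized by a pair of admissible catalogues and a tie-breaking rule. -/
theorem exists_minimizer (ha : 0 < a) (ha1 : a ≤ 1) (hμ : μ (Set.Icc a 1)ᶜ = 0)
    (hac : μ ≪ volume) {𝒳 : Fin 2 → Set (L2 P)} (hcl : ∀ i, IsClosed (𝒳 i))
    (hcv : ∀ i, Convex ℝ (𝒳 i)) (hbd : ∀ i, Bornology.IsBounded (𝒳 i))
    (h0 : ∀ i, (0 : L2 P) ∈ 𝒳 i) {ρ : Fin 2 → L2 P → EReal} (hbot : ∀ i X, ρ i X ≠ ⊥)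
    (hconv : ∀ i, IsConvexRisk (ρ i)) (hfatou : ∀ i, HasFatouProperty (ρ i)) (W : Fin 2 → L2 P)
    (hW : ∀ i, ρ i (W i) ≠ ⊤) :
    ∃ (C : Fin 2 → Catalogue P) (f : ℝ → ℝ), (∀ i, IsAdmissible a μ (𝒳 i) (C i)) ∧
      IsTieBreakingRule a f ∧ plannerValue a μ 𝒳 ρ W = aggregateRisk a μ ρ W C f ∧
      aggregateRisk a μ ρ W C f ≤ ρ 0 (W 0) + ρ 1 (W 1) := by
  obtain ⟨R₀, hR₀⟩ := (hbd 0).exists_norm_le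
  obtain ⟨R₁, hR₁⟩ := (hbd 1).exists_norm_le
  have hR : ∀ i, ∀ x ∈ 𝒳 i, ‖x‖ ≤ max R₀ R₁ := by
    intro i x hx
    obtain rfl | rfl : i = 0 ∨ i = 1 := by omega
    · exact (hR₀ x hx).trans (le_max_left _ _)
    · exact (hR₁ x hx).trans (le_max_right _ _)
  set R := max R₀ R₁
  obtain ⟨q, φ, X, hp⟩ : ∃ q φ X, IsOptimalPlan μ 𝒳 ρ W (R ^ 2) q φ X :=
    exists_optimal_plan ha hμ hcl hcv h0 hR hac hbot hconv hfatou W (sq_nonneg R)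
  have hle : planRisk μ ρ W φ X + (planCost μ q : EReal) ≤ ρ 0 (W 0) + ρ 1 (W 1) := by
    -- In the plan without trade, the firms keep their endowments. Comparison with it bounds the
    -- optimum and makes its risk finite, as the tightness arguments require.
    have hzero : IsPlan μ 𝒳 (R ^ 2) (fun _ => 0) (fun _ => 0) (fun _ _ => 0) :=
      ⟨antitone_const, fun _ => le_rfl, fun _ => sq_nonneg R, measurable_const, fun _ => by simp,
        fun _ => stronglyMeasurable_const, fun i => ae_of_all _ fun _ => h0 i,
        fun _ => ae_of_all _ fun _ => var_zero.le⟩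
    have := hp.2 _ _ _ hzero
    rwa [planCost_zero, planRisk_zero, EReal.coe_zero, add_zero] at this
  have hrbot : planRisk μ ρ W φ X ≠ ⊥ := EReal.add_ne_bot_iff.2 ⟨hbot _ _, hbot _ _⟩
  have hrtop : planRisk μ ρ W φ X ≠ ⊤ := by
    intro h
    rw [h, EReal.top_add_coe, top_le_iff] at hle
    exact EReal.add_ne_top (hW 0) (hW 1) hle
  have htight := hp.var_eq ha hμ hac hcl hcv h0 hR hrbot hrtop
  choose x hx hxq using hp.exists_var_ge ha hμ hac hcl hcv h0 hR hrbot hrtop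
  obtain ⟨C, hC, hf, hCe⟩ :=
    hp.1.exists_catalogues ha ha1 hμ hac hcl hcv h0 hR htight hx hxq ρ W
  -- The catalogues attain the relaxed minimum, which bounds every competitor from below, so the two
  -- infima coincide.
  refine ⟨C, φ, hC, hf, le_antisymm (sInf_le ⟨C, φ, hC, hf, rfl⟩) (le_sInf ?_), hCe ▸ hle⟩
  rintro _ ⟨C', f', hC', hf', rfl⟩
  obtain ⟨q', φ', X', hp', hle'⟩ := exists_plan_le_aggregateRisk ha ha1 hμ hac h0 hR hC' hf' ρ W
  rw [hCe]
  exact (hp.2 q' φ' X' hp').trans hle'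

end Main

end OTC

end

theorem mainTheorem3 {Ω : Type*} [MeasurableSpace Ω]
    (P : MeasureTheory.Measure Ω) [MeasureTheory.IsProbabilityMeasure P]
    -- types `[a, 1]` and their distribution
    (a : ℝ) (ha : 0 < a) (ha1 : a < 1)
    (μ : MeasureTheory.Measure ℝ) [MeasureTheory.IsFiniteMeasure μ]
    (hμ_supp : μ (Set.Icc a 1)ᶜ = 0) (hμ_ac : μ.AbsolutelyContinuous MeasureTheory.volume)
    -- financially feasible sets
    (𝒳 : Fin 2 → Set (OTC.L2 P))
    (h𝒳_closed : ∀ i, IsClosed (𝒳 i)) (h𝒳_convex : ∀ i, Convex ℝ (𝒳 i))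
    (h𝒳_bdd : ∀ i, Bornology.IsBounded (𝒳 i)) (h𝒳_zero : ∀ i, (0 : OTC.L2 P) ∈ 𝒳 i)
    -- risk measures
    (ρ : Fin 2 → OTC.L2 P → EReal)
    (hρ : ∀ i, OTC.IsMonetaryRiskMeasure (ρ i)) (hρ_convex : ∀ i, OTC.IsConvexRisk (ρ i))
    (hρ_law : ∀ i, OTC.IsLawInvariant (ρ i)) (hρ_fatou : ∀ i, OTC.HasFatouProperty (ρ i))
    -- initial endowments, with finite initial risk
    (W : Fin 2 → OTC.L2 P) (hW : ∀ i, ρ i (W i) ≠ ⊤) :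
    ∃ (C : Fin 2 → OTC.Catalogue P) (f : ℝ → ℝ) (T r r₁ r₂ : ℝ),
      OTC.IsTransferEfficient a μ 𝒳 ρ W C f T ∧
      0 ≤ r ∧
      OTC.aggregateRisk a μ ρ W C f = ρ 0 (W 0) + ρ 1 (W 1) - (r : EReal) ∧
      r₂ - r₁ = r ∧ T ∈ Set.Icc r₁ r₂ ∧
      ∀ T' : ℝ, OTC.IsTransferEfficient a μ 𝒳 ρ W C f T' ↔ T' ∈ Set.Icc r₁ r₂ := by
  have hbot : ∀ i X, ρ i X ≠ ⊥ := fun i => (hρ i).ne_bot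
  obtain ⟨C, f, hC, hf, hopt, hle⟩ := OTC.exists_minimizer ha ha1.le hμ_supp hμ_ac h𝒳_closed
    h𝒳_convex h𝒳_bdd h𝒳_zero hbot hρ_convex hρ_fatou W hW
  have hAbot : ∀ i, OTC.assessment a μ ρ W C f i ≠ ⊥ := fun i =>
    OTC.sub_coe_ne_bot (hbot _ _) _
  have hsum : OTC.aggregateRisk a μ ρ W C f ≠ ⊤ := fun h =>
    EReal.add_ne_top (hW 0) (hW 1) (top_le_iff.1 (h ▸ hle))
  have hA0 : OTC.assessment a μ ρ W C f 0 ≠ ⊤ := fun h => hsum (by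
    rw [OTC.aggregateRisk, h, EReal.top_add_of_ne_bot (hAbot 1)])
  have hA1 : OTC.assessment a μ ρ W C f 1 ≠ ⊤ := fun h => hsum (by
    rw [OTC.aggregateRisk, h, EReal.add_top_of_ne_bot (hAbot 0)])
  obtain ⟨A₀, hA₀⟩ : ∃ x : ℝ, OTC.assessment a μ ρ W C f 0 = x :=
    ⟨_, (EReal.coe_toReal hA0 (hAbot 0)).symm⟩
  obtain ⟨A₁, hA₁⟩ : ∃ x : ℝ, OTC.assessment a μ ρ W C f 1 = x :=
    ⟨_, (EReal.coe_toReal hA1 (hAbot 1)).symm⟩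
  obtain ⟨w₀, hw₀⟩ : ∃ x : ℝ, ρ 0 (W 0) = x := ⟨_, (EReal.coe_toReal (hW 0) (hbot 0 _)).symm⟩
  obtain ⟨w₁, hw₁⟩ : ∃ x : ℝ, ρ 1 (W 1) = x := ⟨_, (EReal.coe_toReal (hW 1) (hbot 1 _)).symm⟩
  have hagg : OTC.aggregateRisk a μ ρ W C f = ((A₀ + A₁ : ℝ) : EReal) := by
    rw [OTC.aggregateRisk, hA₀, hA₁, EReal.coe_add]
  have hAw : A₀ + A₁ ≤ w₀ + w₁ := by
    rw [hagg, hw₀, hw₁, ← EReal.coe_add] at hle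
    exact EReal.coe_le_coe_iff.1 hle
  -- All four quantities are finite, so the rationality constraints are real inequalities bounding T
  -- on either side.
  have hiff : ∀ T : ℝ, OTC.IsTransferEfficient a μ 𝒳 ρ W C f T ↔
      T ∈ Set.Icc (A₀ - w₀) (w₁ - A₁) := by
    intro T
    have e0 : OTC.assessment a μ ρ W C f 0 - (T : EReal) ≤ ρ 0 (W 0) ↔ A₀ - T ≤ w₀ := by
      rw [hA₀, hw₀, ← EReal.coe_sub, EReal.coe_le_coe_iff]
    have e1 : OTC.assessment a μ ρ W C f 1 + (T : EReal) ≤ ρ 1 (W 1) ↔ A₁ + T ≤ w₁ := by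
      rw [hA₁, hw₁, ← EReal.coe_add, EReal.coe_le_coe_iff]
    constructor
    · intro h
      have h0 := e0.1 h.rational_fst
      have h1 := e1.1 h.rational_snd
      exact ⟨by linarith, by linarith⟩
    · intro h
      exact ⟨hC, hf, hopt, e0.2 (by linarith [h.1]), e1.2 (by linarith [h.2])⟩
  -- The left endpoint serves as the transfer; the interval is nonempty because trade does not
  -- increase aggregate risk, and its length is the rent.
  have hmem : A₀ - w₀ ∈ Set.Icc (A₀ - w₀) (w₁ - A₁) := ⟨le_rfl, by linarith⟩
  refine ⟨C, f, A₀ - w₀, w₁ - A₁ - (A₀ - w₀), A₀ - w₀, w₁ - A₁, (hiff _).2 hmem, by linarith, ?_,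
    rfl, hmem, hiff⟩
  rw [hagg, hw₀, hw₁, ← EReal.coe_add, ← EReal.coe_sub]
  congr 1
  ring
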